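/- Let $P=\{p_1,\dots,p_n\}$ be a set of $n$ distinct points in the Euclidean plane. A range assignment is a function $r:P\to[0,\infty)$; its communication graph $G_r$ is the directed graph on $P$ with an edge from $p$ to $q$ iff $|pq|\le r(p)$. The assignment is valid if $G_r$ is strongly connected. Its total interference is $I(G_r)=\sum_{p\in P}|\{q\in P\setminus\{p\}: |pq|\le r(q)\}|$, and $OPT$ is the minimum of $I(G_r)$ over all valid range assignments $r$. (a) There is an algorithm that, given the coordinates of any $n$ distinct points in the plane, computes in $O(n^2)$ time a valid range assignment $r$ with $I(G_r)\le 2\cdot OPT$. (The model is the real RAM: exact real arithmetic, including square roots, and comparisons of reals, arithmetic on $O(\log n)$-bit integers, and indirect addressing cost one step each; there is no rounding from reals to integers.) (b) Let $s\in P$. Let $r_1(s)=\max_{p\in P}|sp|$ and $r_1(p)=0$ for $p\ne s$. In the complete directed graph on $P$ let the edge $(p,q)$ have weight $w(p,q)=|\{z\in P\setminus\{p\}:|pz|\le|pq|\}|$, let $T$ be a minimum-weight spanning directed tree in which every point has a directed path to $s$ (a sink tree rooted at $s$), and let $r_2(s)=0$ and $r_2(p)=|pq|$ for each edge $(p,q)$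 of $T$. Then $I(G_{r_1})$ is minimum among all range assignments in whose communication graph $s$ reaches every point, $I(G_{r_2})$ is minimum among all range assignments in whose communication graph every point reaches $s$, and the pointwise maximum $r=\max\{r_1,r_2\}$ is valid and satisfies $I(G_r)\le 2\cdot OPT$. -/

import Mathlib

open scoped NNReal

/-! Total interference of range assignments in the plane. -/

namespace Interference

/-- The Euclidean plane. -/
abbrev Plane : Type := EuclideanSpace ℝ (Fin 2)

/-- The communication graph `G_r`: there is an edge from `p` to `q` iff `|pq| ≤ r(p)`. -/
def commGraph {n : ℕ} (P : Fin n → Plane) (r : Fin n → ℝ≥0) : Digraph (Fin n) where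
  Adj p q := dist (P p) (P q) ≤ r p

/-- There is a directed path (possibly of length zero) from `p` to `q`. -/
def Reaches {V : Type*} (G : Digraph V) (p q : V) : Prop :=
  Relation.ReflTransGen G.Adj p q

/-- Every vertex reaches every vertex along a directed path. -/
def StronglyConnected {V : Type*} (G : Digraph V) : Prop :=
  ∀ p q : V, Reaches G p q

/-- A range assignment is valid if its communication graph is strongly connected. -/
def Valid {n : ℕ} (P : Fin n → Plane) (r : Fin n → ℝ≥0) : Prop :=
  StronglyConnected (commGraph P r)

open Classical in
/-- Receiver-centric interference of `p`: the number of points other than `p` whose range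
covers `p`. -/
noncomputable def RI {n : ℕ} (P : Fin n → Plane) (r : Fin n → ℝ≥0) (p : Fin n) : ℕ :=
  (Finset.univ.filter fun q : Fin n => q ≠ p ∧ dist (P p) (P q) ≤ r q).card

/-- Total interference `I(G_r)`. -/
noncomputable def totalInterference {n : ℕ} (P : Fin n → Plane) (r : Fin n → ℝ≥0) : ℕ :=
  ∑ p, RI P r p

/-- `OPT`: the minimum total interference of a valid range assignment. -/
noncomputable def opt {n : ℕ} (P : Fin n → Plane) : ℕ :=
  sInf {m : ℕ | ∃ r : Fin n → ℝ≥0, Valid P r ∧ totalInterference P r = m}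

/-- The minimum defining `opt` is attained. -/
theorem opt_isLeast {n : ℕ} (P : Fin n → Plane) :
    IsLeast {m : ℕ | ∃ r : Fin n → ℝ≥0, Valid P r ∧ totalInterference P r = m} (opt P) := by
  have hne : {m : ℕ | ∃ r : Fin n → ℝ≥0, Valid P r ∧ totalInterference P r = m}.Nonempty := by
    refine ⟨_, fun p => Finset.univ.sup fun q => nndist (P p) (P q), ?_, rfl⟩
    intro p q
    refine Relation.ReflTransGen.single ?_
    have h : nndist (P p) (P q) ≤ Finset.univ.sup fun q => nndist (P p) (P q) :=
      Finset.le_sup (f := fun q => nndist (P p) (P q)) (Finset.mem_univ q)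
    exact_mod_cast h
  exact ⟨Nat.sInf_mem hne, fun m hm => Nat.sInf_le hm⟩

/-- `r` is an optimal broadcast assignment with root `s`: in `G_r` the root reaches every point
(so `G_r` contains a broadcast tree rooted at `s`), and the total interference is minimum among
all such assignments. -/
def IsOptimalBroadcast {n : ℕ} (P : Fin n → Plane) (s : Fin n) (r : Fin n → ℝ≥0) : Prop :=
  (∀ p, Reaches (commGraph P r) s p) ∧
    ∀ r' : Fin n → ℝ≥0, (∀ p, Reaches (commGraph P r') s p) →
      totalInterference P r ≤ totalInterference P r'

/-- `r` is an optimal sink assignment with root `s`: in `G_r` every point reaches the root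
(so `G_r` contains a sink tree rooted at `s`), and the total interference is minimum among
all such assignments. -/
def IsOptimalSink {n : ℕ} (P : Fin n → Plane) (s : Fin n) (r : Fin n → ℝ≥0) : Prop :=
  (∀ p, Reaches (commGraph P r) p s) ∧
    ∀ r' : Fin n → ℝ≥0, (∀ p, Reaches (commGraph P r') p s) →
      totalInterference P r ≤ totalInterference P r'

/-- The root `s` gets the range `max_p |sp|`, every other point gets the range `0`. -/
noncomputable def rootCover {n : ℕ} (P : Fin n → Plane) (s : Fin n) (p : Fin n) : ℝ≥0 :=
  if p = s then Finset.univ.sup (fun q => nndist (P s) (P q)) else 0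

/-- A spanning sink tree rooted at `s`, given by its parent function: the edges are
`(p, parent p)` for `p ≠ s`, and following them from any point leads to `s`.
The root carries the dummy value `parent s = s`. -/
def IsSinkTree {n : ℕ} (s : Fin n) (parent : Fin n → Fin n) : Prop :=
  parent s = s ∧ ∀ p, ∃ k : ℕ, parent^[k] p = s

open Classical in
/-- The weight `w(p, q) = |{z ∈ P \ {p} : |pz| ≤ |pq|}|`. -/
noncomputable def edgeWeight {n : ℕ} (P : Fin n → Plane) (p q : Fin n) : ℕ :=
  (Finset.univ.filter fun z : Fin n => z ≠ p ∧ dist (P p) (P z) ≤ dist (P p) (P q)).card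

/-- The weight of a sink tree: the sum of the weights of its edges. -/
noncomputable def treeWeight {n : ℕ} (P : Fin n → Plane) (s : Fin n)
    (parent : Fin n → Fin n) : ℕ :=
  ∑ p ∈ Finset.univ.erase s, edgeWeight P p (parent p)

/-- A sink tree rooted at `s` of minimum weight in the complete weighted digraph on the points. -/
def IsMinSinkTree {n : ℕ} (P : Fin n → Plane) (s : Fin n) (parent : Fin n → Fin n) : Prop :=
  IsSinkTree s parent ∧
    ∀ parent' : Fin n → Fin n, IsSinkTree s parent' →
      treeWeight P s parent ≤ treeWeight P s parent'

/-- The ranges that realize the edges of a sink tree; the root gets range `0`. -/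
noncomputable def treeRange {n : ℕ} (P : Fin n → Plane) (parent : Fin n → Fin n)
    (p : Fin n) : ℝ≥0 :=
  nndist (P p) (P (parent p))

end Interference

/-! The real RAM: a random access machine with two kinds of memory cells, one for exact real
numbers and one for integers of logarithmically many bits (addresses, counters). It is
programmed in a language of assignments, sequences, conditionals and while loops, and every
elementary operation costs one step. There is no rounding from reals to integers. -/

namespace RealRAM

/-- The memory: arrays of words and arrays of reals, both indexed by `array number, cell`.
A program refers to finitely many array numbers; a scalar variable is cell `0` of an array. -/
structure Store where
  word : ℕ → ℕ → ℕ
  real : ℕ → ℕ → ℝ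

/-- Overwrite one word cell. -/
def Store.setWord (σ : Store) (a i v : ℕ) : Store where
  word := Function.update σ.word a (Function.update (σ.word a) i v)
  real := σ.real

/-- Overwrite one real cell. -/
noncomputable def Store.setReal (σ : Store) (a i : ℕ) (v : ℝ) : Store where
  word := σ.word
  real := Function.update σ.real a (Function.update (σ.real a) i v)

/-- Integer expressions; `load a i` reads cell `i` of word array `a`. -/
inductive WExp where
  | const (k : ℕ)
  | load (a : ℕ) (i : WExp)
  | add (e f : WExp)
  | sub (e f : WExp)
  | mul (e f : WExp)
  | div (e f : WExp)
  | mod (e f : WExp)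

/-- The value of an integer expression; subtraction is truncated at `0`. -/
def WExp.eval (σ : Store) : WExp → ℕ
  | .const k => k
  | .load a i => σ.word a (i.eval σ)
  | .add e f => e.eval σ + f.eval σ
  | .sub e f => e.eval σ - f.eval σ
  | .mul e f => e.eval σ * f.eval σ
  | .div e f => e.eval σ / f.eval σ
  | .mod e f => e.eval σ % f.eval σ

/-- The number of elementary operations in an integer expression. -/
def WExp.cost : WExp → ℕ
  | .const _ => 1
  | .load _ i => i.cost + 1
  | .add e f => e.cost + f.cost + 1
  | .sub e f => e.cost + f.cost + 1
  | .mul e f => e.cost + f.cost + 1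
  | .div e f => e.cost + f.cost + 1
  | .mod e f => e.cost + f.cost + 1

/-- Real expressions; `load a i` reads cell `i` of real array `a`, and `ofWord` turns an integer
into a real number. The only constants are integers. -/
inductive RExp where
  | ofWord (e : WExp)
  | load (a : ℕ) (i : WExp)
  | add (x y : RExp)
  | sub (x y : RExp)
  | mul (x y : RExp)
  | div (x y : RExp)
  | sqrt (x : RExp)

/-- The value of a real expression. -/
noncomputable def RExp.eval (σ : Store) : RExp → ℝ
  | .ofWord e => (e.eval σ : ℝ)
  | .load a i => σ.real a (i.eval σ)
  | .add x y => x.eval σ + y.eval σ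
  | .sub x y => x.eval σ - y.eval σ
  | .mul x y => x.eval σ * y.eval σ
  | .div x y => x.eval σ / y.eval σ
  | .sqrt x => Real.sqrt (x.eval σ)

/-- The number of elementary operations in a real expression. -/
def RExp.cost : RExp → ℕ
  | .ofWord e => e.cost + 1
  | .load _ i => i.cost + 1
  | .add x y => x.cost + y.cost + 1
  | .sub x y => x.cost + y.cost + 1
  | .mul x y => x.cost + y.cost + 1
  | .div x y => x.cost + y.cost + 1
  | .sqrt x => x.cost + 1

/-- Tests: comparisons of integers and of reals, and their Boolean combinations. -/
inductive BExp where
  | wle (e f : WExp)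
  | rle (x y : RExp)
  | neg (b : BExp)
  | and (b c : BExp)

/-- The test succeeds. -/
def BExp.Holds (σ : Store) : BExp → Prop
  | .wle e f => e.eval σ ≤ f.eval σ
  | .rle x y => x.eval σ ≤ y.eval σ
  | .neg b => ¬ b.Holds σ
  | .and b c => b.Holds σ ∧ c.Holds σ

/-- The number of elementary operations in a test. -/
def BExp.cost : BExp → ℕ
  | .wle e f => e.cost + f.cost + 1
  | .rle x y => x.cost + y.cost + 1
  | .neg b => b.cost + 1
  | .and b c => b.cost + c.cost + 1

/-- Programs. `setW a i e` stores the value of `e` in cell `i` of word array `a`, and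
`setR a i x` stores the value of `x` in cell `i` of real array `a`. -/
inductive Prog where
  | skip
  | setW (a : ℕ) (i e : WExp)
  | setR (a : ℕ) (i : WExp) (x : RExp)
  | seq (c d : Prog)
  | ite (b : BExp) (c d : Prog)
  | loop (b : BExp) (c : Prog)

/-- `Exec W c σ t τ`: started in the memory `σ`, the program `c` halts after exactly `t` steps
with memory `τ`. Only integers smaller than `W` may be stored; a program that tries to store a
larger one is stuck and computes nothing. Since the size of the expressions is fixed by the
program, all intermediate integers are then polynomially bounded in `W` as well. -/
inductive Exec (W : ℕ) : Prog → Store → ℕ → Store → Prop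
  | skip (σ : Store) : Exec W .skip σ 1 σ
  | setW (a : ℕ) (i e : WExp) (σ : Store) (h : e.eval σ < W) :
      Exec W (.setW a i e) σ (i.cost + e.cost + 1) (σ.setWord a (i.eval σ) (e.eval σ))
  | setR (a : ℕ) (i : WExp) (x : RExp) (σ : Store) :
      Exec W (.setR a i x) σ (i.cost + x.cost + 1) (σ.setReal a (i.eval σ) (x.eval σ))
  | seq {c d : Prog} {σ τ υ : Store} {t u : ℕ} (h : Exec W c σ t τ) (h' : Exec W d τ u υ) :
      Exec W (.seq c d) σ (t + u) υ
  | iteTrue {b : BExp} {c d : Prog} {σ τ : Store} {t : ℕ} (hb : b.Holds σ)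
      (h : Exec W c σ t τ) : Exec W (.ite b c d) σ (b.cost + 1 + t) τ
  | iteFalse {b : BExp} {c d : Prog} {σ τ : Store} {t : ℕ} (hb : ¬ b.Holds σ)
      (h : Exec W d σ t τ) : Exec W (.ite b c d) σ (b.cost + 1 + t) τ
  | loopTrue {b : BExp} {c : Prog} {σ τ υ : Store} {t u : ℕ} (hb : b.Holds σ)
      (h : Exec W c σ t τ) (h' : Exec W (.loop b c) τ u υ) :
      Exec W (.loop b c) σ (b.cost + 1 + t + u) υ
  | loopFalse {b : BExp} {c : Prog} {σ : Store} (hb : ¬ b.Holds σ) :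
      Exec W (.loop b c) σ (b.cost + 1) σ

/-- The machine is deterministic: running time and final memory are determined by the input. -/
theorem Exec.unique {W : ℕ} {c : Prog} {σ τ τ' : Store} {t t' : ℕ}
    (h : Exec W c σ t τ) (h' : Exec W c σ t' τ') : t = t' ∧ τ = τ' := by
  induction h generalizing t' τ' with
  | skip σ => cases h'; exact ⟨rfl, rfl⟩
  | setW a i e σ _ => cases h'; exact ⟨rfl, rfl⟩
  | setR a i x σ => cases h'; exact ⟨rfl, rfl⟩
  | seq _ _ ih₁ ih₂ =>
    cases h' with
    | seq g g' =>
      obtain ⟨rfl, rfl⟩ := ih₁ g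
      obtain ⟨rfl, rfl⟩ := ih₂ g'
      exact ⟨rfl, rfl⟩
  | iteTrue hb _ ih =>
    cases h' with
    | iteTrue _ g => obtain ⟨rfl, rfl⟩ := ih g; exact ⟨rfl, rfl⟩
    | iteFalse hb' _ => exact absurd hb hb'
  | iteFalse hb _ ih =>
    cases h' with
    | iteTrue hb' _ => exact absurd hb' hb
    | iteFalse _ g => obtain ⟨rfl, rfl⟩ := ih g; exact ⟨rfl, rfl⟩
  | loopTrue hb _ _ ih₁ ih₂ =>
    cases h' with
    | loopTrue _ g g' =>
      obtain ⟨rfl, rfl⟩ := ih₁ g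
      obtain ⟨rfl, rfl⟩ := ih₂ g'
      exact ⟨rfl, rfl⟩
    | loopFalse hb' => exact absurd hb hb'
  | loopFalse hb =>
    cases h' with
    | loopTrue hb' _ _ => exact absurd hb' hb
    | loopFalse _ => exact ⟨rfl, rfl⟩

/-- The initial memory for `n` points: cell `0` of word array `0` holds `n`, real arrays `0` and
`1` hold the two coordinates of the points in the cells `0, …, n - 1`, and all other cells
hold `0`. -/
noncomputable def input {n : ℕ} (P : Fin n → Interference.Plane) : Store where
  word a i := if a = 0 ∧ i = 0 then n else 0
  real a i :=
    if h : i < n then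
      if a = 0 then P ⟨i, h⟩ 0 else if a = 1 then P ⟨i, h⟩ 1 else 0
    else 0

/-- The memory `τ` holds the range assignment `r` in the cells `0, …, n - 1` of real
array `2`. -/
def Outputs {n : ℕ} (τ : Store) (r : Fin n → ℝ≥0) : Prop :=
  ∀ p : Fin n, τ.real 2 (p : ℕ) = (r p : ℝ)

end RealRAM

/-! Counted at the sender, total interference is the sum over `q` of the number of other points
covered by the range of `q`. A broadcast from `s` costs at least `n - 1`, because every other point
must be covered by somebody, and `rootCover` attains this bound. If every point reaches `s`, each
point other than `s` can be given a parent within its range so that a sink tree results, and the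
weight of this tree is at most the interference (`exists_sinkTree_le`); conversely, the ranges of a
sink tree have exactly its weight as interference. Hence a minimum sink tree is an optimal sink
assignment. A valid assignment is of both kinds at once, and a pointwise maximum costs at most the
sum of its two parts, which gives the factor two.

For the algorithm, sorting all rows of distances would cost an extra logarithm. Approximate weights
`V` with `w + 1 ≤ V ≤ 2 * w` suffice: a tree of minimum `V`-weight has `V`-weight at most `2 * opt`,
and that number is at least its `w`-weight plus `n - 1`, so it already contains the price of the
broadcast (`exists_of_computes`).

Each row of `V` takes linear time. A pivot that is roughly a median of the remaining points is
chosen, the points not nearer than the pivot receive their ranks, and at most three quarters of the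
points remain (`Lists.goodRank`, `run_rowProg`). The pivot comes from repeated sampling: within
blocks every fourth entry by rank is kept while the block length doubles, so that work and rank
error are both dominated by geometric series (`Approx.step`, `Approx.pick`).

The minimum sink tree is found by Edmonds' contraction algorithm in path-growing form. The stack
holds a path of contracted components; the top one selects its cheapest leaving edge and is then
extended, connected to the root, or merged along a cycle. The reduced weights of the selected edges
form a dual solution. Expanding the components from the newest to the oldest gives a tree of cost at
most the dual total (`cost_run_le`), and no sink tree is cheaper than this total (`total_le`). A
table of best edges per component and target makes each selection linear.

Running times are verified by counting loop iterations (`Run`): a fixed program spends at most a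
constant number of steps per iteration. -/

namespace Interference

/-! ### Broadcast and sink assignments, and their combination -/

variable {n : ℕ}

open Classical in
/-- The number of points other than `q` in the range of `q`. -/
noncomputable def coverage (P : Fin n → Plane) (r : Fin n → ℝ≥0) (q : Fin n) : ℕ :=
  (Finset.univ.filter fun z : Fin n => z ≠ q ∧ dist (P q) (P z) ≤ r q).card

/-- Double counting of the pairs of a sender and a point in its range. -/
theorem totalInterference_eq_sum_coverage (P : Fin n → Plane) (r : Fin n → ℝ≥0) :
    totalInterference P r = ∑ q, coverage P r q := by
  classical
  simp only [totalInterference, RI, coverage, Finset.card_filter]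
  rw [Finset.sum_comm]
  refine Finset.sum_congr rfl fun q _ => Finset.sum_congr rfl fun z _ => ?_
  simp only [dist_comm (P z) (P q), ne_comm]

theorem coverage_le {P : Fin n → Plane} {r r' : Fin n → ℝ≥0} {q : Fin n} (h : r q ≤ r' q) :
    coverage P r q ≤ coverage P r' q := by
  classical
  refine Finset.card_le_card fun z hz => ?_
  simp only [Finset.mem_filter, Finset.mem_univ, true_and] at hz ⊢
  exact ⟨hz.1, hz.2.trans (by exact_mod_cast h)⟩

/-- This is where distinctness of the points enters: a coincident point would be covered even by
range zero. -/
theorem coverage_eq_zero {P : Fin n → Plane} (hP : Function.Injective P) {r : Fin n → ℝ≥0}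
    {q : Fin n} (h : r q = 0) : coverage P r q = 0 := by
  classical
  rw [coverage, Finset.card_eq_zero, Finset.filter_eq_empty_iff]
  rintro z - ⟨hz, hd⟩
  rw [h, NNReal.coe_zero, dist_le_zero] at hd
  exact hz (hP hd).symm

theorem coverage_le_pred (P : Fin n → Plane) (r : Fin n → ℝ≥0) (q : Fin n) :
    coverage P r q ≤ n - 1 := by
  classical
  have h : (Finset.univ.filter fun z : Fin n => z ≠ q ∧ dist (P q) (P z) ≤ r q) ⊆
      Finset.univ.erase q := by
    intro z hz
    simp only [Finset.mem_filter, Finset.mem_univ, true_and] at hz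
    simp [hz.1]
  simpa [coverage] using Finset.card_le_card h

theorem coverage_treeRange (P : Fin n → Plane) (parent : Fin n → Fin n) (p : Fin n) :
    coverage P (treeRange P parent) p = edgeWeight P p (parent p) := by
  simp only [coverage, treeRange, edgeWeight, coe_nndist]
  congr!

theorem totalInterference_treeRange {P : Fin n → Plane} (hP : Function.Injective P) {s : Fin n}
    {parent : Fin n → Fin n} (h : IsSinkTree s parent) :
    totalInterference P (treeRange P parent) = treeWeight P s parent := by
  rw [totalInterference_eq_sum_coverage, treeWeight,
    ← Finset.add_sum_erase _ _ (Finset.mem_univ s),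
    coverage_eq_zero hP (by simp [treeRange, h.1]), zero_add]
  exact Finset.sum_congr rfl fun p _ => coverage_treeRange P parent p

theorem totalInterference_rootCover_le {P : Fin n → Plane} (hP : Function.Injective P)
    (s : Fin n) : totalInterference P (rootCover P s) ≤ n - 1 := by
  rw [totalInterference_eq_sum_coverage, ← Finset.add_sum_erase _ _ (Finset.mem_univ s),
    Finset.sum_eq_zero, add_zero]
  · exact coverage_le_pred _ _ _
  · intro q hq
    exact coverage_eq_zero hP (by simp [rootCover, (Finset.mem_erase.1 hq).1])

/-- At each point the maximum equals one of the two ranges, so only one of the two coverages is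
paid. -/
theorem totalInterference_max_le (P : Fin n → Plane) (r r' : Fin n → ℝ≥0) :
    totalInterference P (fun p => max (r p) (r' p)) ≤
      totalInterference P r + totalInterference P r' := by
  simp only [totalInterference_eq_sum_coverage, ← Finset.sum_add_distrib]
  refine Finset.sum_le_sum fun q _ => ?_
  rcases le_total (r q) (r' q) with h | h
  · exact (coverage_le (r' := r') (by simp [h])).trans (Nat.le_add_left _ _)
  · exact (coverage_le (r' := r) (by simp [h])).trans (Nat.le_add_right _ _)

theorem reaches_mono {P : Fin n → Plane} {r r' : Fin n → ℝ≥0} (h : ∀ p, r p ≤ r' p)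
    {p q : Fin n} (hr : Reaches (commGraph P r) p q) : Reaches (commGraph P r') p q :=
  Relation.ReflTransGen.mono (fun a _ hab => le_trans hab (by exact_mod_cast h a)) _ _ hr

theorem reaches_rootCover (P : Fin n → Plane) (s p : Fin n) :
    Reaches (commGraph P (rootCover P s)) s p := by
  refine Relation.ReflTransGen.single ?_
  have h : nndist (P s) (P p) ≤ rootCover P s s := by
    rw [rootCover, if_pos rfl]
    exact Finset.le_sup (f := fun q => nndist (P s) (P q)) (Finset.mem_univ p)
  exact_mod_cast h

theorem reaches_treeRange (P : Fin n → Plane) {s : Fin n} {parent : Fin n → Fin n}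
    (h : IsSinkTree s parent) (p : Fin n) : Reaches (commGraph P (treeRange P parent)) p s := by
  have key : ∀ k, Reaches (commGraph P (treeRange P parent)) p (parent^[k] p) := by
    intro k
    induction k with
    | zero => exact Relation.ReflTransGen.refl
    | succ k ih =>
      rw [Function.iterate_succ_apply']
      exact ih.tail (le_of_eq (by simp [treeRange]))
  obtain ⟨k, hk⟩ := h.2 p
  exact hk ▸ key k

/-- Any point reaches any other by way of `s`: up the tree, then one broadcast edge. -/
theorem valid_max_rootCover_treeRange (P : Fin n → Plane) {s : Fin n} {parent : Fin n → Fin n}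
    (h : IsSinkTree s parent) :
    Valid P fun p => max (rootCover P s p) (treeRange P parent p) := fun p q =>
  (reaches_mono (fun _ => le_max_right _ _) (reaches_treeRange P h p)).trans
    (reaches_mono (fun _ => le_max_left _ _) (reaches_rootCover P s q))

/-- Whoever reaches `s` does so along a sink tree. -/
theorem exists_parent_of_reaches {V : Type*} (R : V → V → Prop) (s : V)
    (h : ∀ p, Relation.ReflTransGen R p s) :
    ∃ parent : V → V, parent s = s ∧ (∀ p, ∃ k : ℕ, parent^[k] p = s) ∧
      ∀ p, p ≠ s → R p (parent p) := by
  classical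
  -- `L k p` says that some walk of exactly `k` edges leads from `p` to `s`; the least such `k` is
  -- the distance, and a parent is any successor at smaller distance.
  let F : (V → Prop) → V → Prop := fun A p => ∃ q, R p q ∧ A q
  let L : ℕ → V → Prop := fun k => F^[k] fun p => p = s
  have hsucc : ∀ k p, L (k + 1) p ↔ ∃ q, R p q ∧ L k q := fun k p => by
    simp only [L, Function.iterate_succ_apply']; rfl
  have hL : ∀ p, ∃ k, L k p := by
    intro p
    induction h p using Relation.ReflTransGen.head_induction_on with
    | refl => exact ⟨0, rfl⟩
    | head hab _ ih => obtain ⟨k, hk⟩ := ih; exact ⟨k + 1, (hsucc _ _).2 ⟨_, hab, hk⟩⟩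
  have hstep : ∀ p, p ≠ s → ∃ q : V, R p q ∧ Nat.find (hL q) < Nat.find (hL p) := by
    intro p hp
    have h1 := Nat.find_spec (hL p)
    rcases hk : Nat.find (hL p) with _ | k
    · rw [hk] at h1; exact absurd h1 hp
    · rw [hk] at h1
      obtain ⟨q, hq, hq'⟩ := (hsucc _ _).1 h1
      exact ⟨q, hq, by have := Nat.find_min' (hL q) hq'; omega⟩
  choose f hf hlt using hstep
  refine ⟨fun p => if hp : p = s then s else f p hp, by simp, ?_, fun p hp => by simp [hp, hf]⟩
  intro p
  induction hk : Nat.find (hL p) using Nat.strong_induction_on generalizing p with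
  | _ k ih =>
    by_cases hp : p = s
    · exact ⟨0, hp⟩
    · obtain ⟨j, hj⟩ := ih _ (hk ▸ hlt p hp) _ rfl
      exact ⟨j + 1, by simpa [Function.iterate_succ_apply, hp] using hj⟩

/-- A tree edge leaving `p` is no longer than `r p`, so its weight is at most the coverage of `p`;
the coverage of the root is discarded. -/
theorem exists_sinkTree_le {P : Fin n → Plane} {s : Fin n} {r : Fin n → ℝ≥0}
    (h : ∀ p, Reaches (commGraph P r) p s) :
    ∃ parent, IsSinkTree s parent ∧ treeWeight P s parent ≤ totalInterference P r := by
  obtain ⟨parent, h1, h2, h3⟩ := exists_parent_of_reaches _ s h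
  refine ⟨parent, ⟨h1, h2⟩, ?_⟩
  rw [totalInterference_eq_sum_coverage, treeWeight]
  refine (Finset.sum_le_sum fun p hp => ?_).trans
    (Finset.sum_le_sum_of_subset (Finset.subset_univ _))
  rw [← coverage_treeRange]
  exact coverage_le (h3 p (Finset.mem_erase.1 hp).1)

theorem exists_sinkTree_le_opt (P : Fin n → Plane) (s : Fin n) :
    ∃ parent, IsSinkTree s parent ∧ treeWeight P s parent ≤ opt P := by
  obtain ⟨r, hr, hI⟩ := (opt_isLeast P).1
  rw [← hI]
  exact exists_sinkTree_le fun p => hr p s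

/-- A path from `s` to another point must enter it from a different point, so each of the `n - 1`
others receives interference at least one. -/
theorem pred_le_of_broadcast {P : Fin n → Plane} {s : Fin n} {r : Fin n → ℝ≥0}
    (h : ∀ p, Reaches (commGraph P r) s p) : n - 1 ≤ totalInterference P r := by
  classical
  have h1 : ∀ p ∈ Finset.univ.erase s, 1 ≤ RI P r p := by
    intro p hp
    have hps : p ≠ s := (Finset.mem_erase.1 hp).1
    have key : ∀ x, Reaches (commGraph P r) s x → x = p → 1 ≤ RI P r p := by
      intro x hx
      induction hx with
      | refl => exact fun h => absurd h.symm hps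
      | @tail b c hsb hbc ih =>
        rintro rfl
        -- A final self-loop causes no interference; the entering edge then lies earlier on the
        -- path.
        by_cases hb : b = c
        · exact ih hb
        · refine Finset.card_pos.2 ⟨b, ?_⟩
          simp only [Finset.mem_filter, Finset.mem_univ, true_and]
          exact ⟨hb, by rw [dist_comm]; exact hbc⟩
    exact key p (h p) rfl
  calc n - 1 = ∑ _p ∈ (Finset.univ : Finset (Fin n)).erase s, 1 := by simp
    _ ≤ ∑ p ∈ Finset.univ.erase s, RI P r p := Finset.sum_le_sum h1
    _ ≤ totalInterference P r := Finset.sum_le_sum_of_subset (Finset.subset_univ _)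

theorem isOptimalBroadcast_rootCover {P : Fin n → Plane} (hP : Function.Injective P)
    (s : Fin n) : IsOptimalBroadcast P s (rootCover P s) :=
  ⟨reaches_rootCover P s, fun _ h =>
    (totalInterference_rootCover_le hP s).trans (pred_le_of_broadcast h)⟩

theorem isOptimalSink_treeRange {P : Fin n → Plane} (hP : Function.Injective P) {s : Fin n}
    {parent : Fin n → Fin n} (h : IsMinSinkTree P s parent) :
    IsOptimalSink P s (treeRange P parent) := by
  refine ⟨reaches_treeRange P h.1, fun r' h' => ?_⟩
  obtain ⟨parent', h1, h2⟩ := exists_sinkTree_le h'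
  rw [totalInterference_treeRange hP h.1]
  exact (h.2 _ h1).trans h2

/-- Minimality of the tree is not required, so the bound also serves the tree found with approximate
weights. -/
theorem totalInterference_max_rootCover_treeRange_le {P : Fin n → Plane}
    (hP : Function.Injective P) {s : Fin n} {parent : Fin n → Fin n} (h : IsSinkTree s parent) :
    totalInterference P (fun p => max (rootCover P s p) (treeRange P parent p)) ≤
      (n - 1) + treeWeight P s parent := by
  rw [← totalInterference_treeRange hP h]
  exact (totalInterference_max_le _ _ _).trans
    (Nat.add_le_add_right (totalInterference_rootCover_le hP s) _)

theorem pred_le_opt (P : Fin n → Plane) (s : Fin n) : n - 1 ≤ opt P := by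
  obtain ⟨r, hr, hI⟩ := (opt_isLeast P).1
  rw [← hI]
  exact pred_le_of_broadcast fun p => hr s p

end Interference

namespace RealRAM

/-! ### A program logic that counts loop iterations -/

/-- The word arrays written by a program. -/
def Prog.wordWrites : Prog → List ℕ
  | .skip => []
  | .setW a _ _ => [a]
  | .setR _ _ _ => []
  | .seq c d => c.wordWrites ++ d.wordWrites
  | .ite _ c d => c.wordWrites ++ d.wordWrites
  | .loop _ c => c.wordWrites

/-- The real arrays written by a program. -/
def Prog.realWrites : Prog → List ℕ
  | .skip => []
  | .setW _ _ _ => []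
  | .setR a _ _ => [a]
  | .seq c d => c.realWrites ++ d.realWrites
  | .ite _ c d => c.realWrites ++ d.realWrites
  | .loop _ c => c.realWrites

/-- A bound for the number of steps per loop iteration. -/
def Prog.overhead : Prog → ℕ
  | .skip => 1
  | .setW _ i e => i.cost + e.cost + 1
  | .setR _ i x => i.cost + x.cost + 1
  | .seq c d => c.overhead + d.overhead
  | .ite b c d => b.cost + 1 + c.overhead + d.overhead
  | .loop b c => b.cost + 1 + c.overhead

/-- `σ` and `τ` differ at most in the word arrays `A` and the real arrays `B`. -/
def Same (A B : List ℕ) (σ τ : Store) : Prop :=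
  (∀ a, a ∉ A → τ.word a = σ.word a) ∧ ∀ a, a ∉ B → τ.real a = σ.real a

theorem Same.refl (A B : List ℕ) (σ : Store) : Same A B σ σ :=
  ⟨fun _ _ => rfl, fun _ _ => rfl⟩

theorem Same.trans {A B : List ℕ} {σ τ υ : Store} (h : Same A B σ τ) (h' : Same A B τ υ) :
    Same A B σ υ :=
  ⟨fun a ha => (h'.1 a ha).trans (h.1 a ha), fun a ha => (h'.2 a ha).trans (h.2 a ha)⟩

theorem Same.mono {A B A' B' : List ℕ} {σ τ : Store} (h : Same A B σ τ) (hA : A ⊆ A')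
    (hB : B ⊆ B') : Same A' B' σ τ :=
  ⟨fun a ha => h.1 a fun h => ha (hA h), fun a ha => h.2 a fun h => ha (hB h)⟩

theorem Store.setWord_word (σ : Store) (a i v b j : ℕ) :
    (σ.setWord a i v).word b j = if b = a then if j = i then v else σ.word b j else σ.word b j := by
  by_cases h : b = a
  · subst h; simp [Store.setWord, Function.update_apply]
  · simp [Store.setWord, h]

theorem Store.setWord_word_of_ne (σ : Store) {a b : ℕ} (i v : ℕ) (h : b ≠ a) :
    (σ.setWord a i v).word b = σ.word b := by
  simp [Store.setWord, h]

theorem Store.setReal_real (σ : Store) (a i : ℕ) (v : ℝ) (b j : ℕ) :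
    (σ.setReal a i v).real b j = if b = a then if j = i then v else σ.real b j else σ.real b j := by
  by_cases h : b = a
  · subst h; simp [Store.setReal, Function.update_apply]
  · simp [Store.setReal, h]

theorem Store.setReal_real_of_ne (σ : Store) {a b : ℕ} (i : ℕ) (v : ℝ) (h : b ≠ a) :
    (σ.setReal a i v).real b = σ.real b := by
  simp [Store.setReal, h]

@[simp] theorem Store.setWord_real (σ : Store) (a i v : ℕ) : (σ.setWord a i v).real = σ.real := rfl

@[simp] theorem Store.setReal_word (σ : Store) (a i : ℕ) (v : ℝ) :
    (σ.setReal a i v).word = σ.word := rfl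

/-- The frame property. The write lists are computable, so `by decide` settles the side conditions
whenever a later proof carries an array past a program. -/
theorem Exec.same {W : ℕ} {c : Prog} {σ τ : Store} {t : ℕ} (h : Exec W c σ t τ) :
    Same c.wordWrites c.realWrites σ τ := by
  induction h with
  | skip σ => exact Same.refl _ _ _
  | setW a i e σ _ =>
    refine ⟨fun b hb => Store.setWord_word_of_ne _ _ _ ?_, fun _ _ => rfl⟩
    simpa [Prog.wordWrites] using hb
  | setR a i x σ =>
    refine ⟨fun _ _ => rfl, fun b hb => Store.setReal_real_of_ne _ _ _ ?_⟩
    simpa [Prog.realWrites] using hb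
  | seq _ _ ih₁ ih₂ =>
    exact (ih₁.mono (List.subset_append_left _ _) (List.subset_append_left _ _)).trans
      (ih₂.mono (List.subset_append_right _ _) (List.subset_append_right _ _))
  | iteTrue _ _ ih => exact ih.mono (List.subset_append_left _ _) (List.subset_append_left _ _)
  | iteFalse _ _ ih => exact ih.mono (List.subset_append_right _ _) (List.subset_append_right _ _)
  | loopTrue _ _ _ ih₁ ih₂ => exact ih₁.trans ih₂
  | loopFalse _ => exact Same.refl _ _ _

/-- Started in `σ`, the program halts after some number `N` of loop iterations, within
`c.overhead * (N + 1)` steps, in a memory `τ` such that `Q N τ`. -/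
def Run (W : ℕ) (c : Prog) (σ : Store) (Q : ℕ → Store → Prop) : Prop :=
  ∃ t τ N, Exec W c σ t τ ∧ t ≤ c.overhead * (N + 1) ∧ Q N τ

variable {W : ℕ} {c d : Prog} {σ : Store} {Q Q' : ℕ → Store → Prop}

theorem Run.mono (h : Run W c σ Q) (hQ : ∀ N τ, Q N τ → Q' N τ) : Run W c σ Q' := by
  obtain ⟨t, τ, N, h1, h2, h3⟩ := h
  exact ⟨t, τ, N, h1, h2, hQ _ _ h3⟩

theorem Run.frame (h : Run W c σ Q)
    (hQ : ∀ N τ, Same c.wordWrites c.realWrites σ τ → Q N τ → Q' N τ) : Run W c σ Q' := by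
  obtain ⟨t, τ, N, h1, h2, h3⟩ := h
  exact ⟨t, τ, N, h1, h2, hQ _ _ h1.same h3⟩

theorem Run.skip (h : Q 0 σ) : Run W .skip σ Q :=
  ⟨_, _, 0, Exec.skip σ, by simp [Prog.overhead], h⟩

theorem Run.setW {a : ℕ} {i e : WExp} (he : e.eval σ < W)
    (h : Q 0 (σ.setWord a (i.eval σ) (e.eval σ))) : Run W (.setW a i e) σ Q :=
  ⟨_, _, 0, Exec.setW a i e σ he, by simp [Prog.overhead], h⟩

theorem Run.setR {a : ℕ} {i : WExp} {x : RExp}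
    (h : Q 0 (σ.setReal a (i.eval σ) (x.eval σ))) : Run W (.setR a i x) σ Q :=
  ⟨_, _, 0, Exec.setR a i x σ, by simp [Prog.overhead], h⟩

theorem Run.seq (h : Run W c σ fun N τ => Run W d τ fun M υ => Q (N + M) υ) :
    Run W (.seq c d) σ Q := by
  obtain ⟨t, τ, N, h1, h2, t', υ, M, h3, h4, h5⟩ := h
  refine ⟨_, _, N + M, Exec.seq h1 h3, ?_, h5⟩
  simp only [Prog.overhead]
  nlinarith [Nat.zero_le (c.overhead * M), Nat.zero_le (d.overhead * N)]

theorem Run.ite {b : BExp} (h1 : b.Holds σ → Run W c σ Q) (h2 : ¬ b.Holds σ → Run W d σ Q) :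
    Run W (.ite b c d) σ Q := by
  by_cases hb : b.Holds σ
  · obtain ⟨t, τ, N, h3, h4, h5⟩ := h1 hb
    refine ⟨_, _, N, Exec.iteTrue hb h3, ?_, h5⟩
    simp only [Prog.overhead]
    nlinarith [Nat.zero_le (b.cost * N), Nat.zero_le (d.overhead * N)]
  · obtain ⟨t, τ, N, h3, h4, h5⟩ := h2 hb
    refine ⟨_, _, N, Exec.iteFalse hb h3, ?_, h5⟩
    simp only [Prog.overhead]
    nlinarith [Nat.zero_le (b.cost * N), Nat.zero_le (c.overhead * N)]

/-- Loops with an invariant and a potential that pays for the iterations. -/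
theorem Run.loop {b : BExp} (Inv : Store → Prop) (Φ : Store → ℕ) (h0 : Inv σ)
    (hstep : ∀ τ, Same c.wordWrites c.realWrites σ τ → Inv τ → b.Holds τ →
      Run W c τ fun N υ => Inv υ ∧ Φ υ + N + 1 ≤ Φ τ)
    (hend : ∀ N τ, N ≤ Φ σ → Same c.wordWrites c.realWrites σ τ → Inv τ → ¬ b.Holds τ → Q N τ) :
    Run W (.loop b c) σ Q := by
  have key : ∀ m, ∀ τ, Φ τ = m → Same c.wordWrites c.realWrites σ τ → Inv τ →
      ∃ t υ N, Exec W (.loop b c) τ t υ ∧ t ≤ (Prog.loop b c).overhead * (N + 1) ∧ N ≤ Φ τ ∧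
        Inv υ ∧ ¬ b.Holds υ := by
    intro m
    induction m using Nat.strong_induction_on with
    | _ m ih =>
      intro τ hm hs hI
      by_cases hb : b.Holds τ
      · obtain ⟨t, υ, N, h1, h2, h3, h4⟩ := hstep τ hs hI hb
        obtain ⟨t', ω, M, h5, h6, h7, h8⟩ := ih (Φ υ) (by omega) υ rfl (hs.trans h1.same) h3
        refine ⟨_, ω, N + 1 + M, Exec.loopTrue hb h1 h5, ?_, by omega, h8⟩
        simp only [Prog.overhead] at h6 ⊢
        nlinarith [Nat.zero_le (b.cost * N)]
      · exact ⟨_, τ, 0, Exec.loopFalse hb, by simp [Prog.overhead], Nat.zero_le _, hI, hb⟩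
  obtain ⟨t, υ, N, h1, h2, h3, h4, h5⟩ := key _ σ rfl (Same.refl _ _ _) h0
  exact ⟨t, υ, N, h1, h2, hend N υ h3 h1.same h4 h5⟩

/-- The scalar word variable `a`. -/
abbrev WExp.var (a : ℕ) : WExp := .load a (.const 0)

/-- The scalar real variable `a`. -/
abbrev RExp.var (a : ℕ) : RExp := .load a (.const 0)

/-- Assignment to a scalar word variable. -/
abbrev Prog.setV (a : ℕ) (e : WExp) : Prog := .setW a (.const 0) e

/-- `e < f`. -/
abbrev BExp.wlt (e f : WExp) : BExp := .neg (.wle f e)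

/-- `e = f`. -/
abbrev BExp.weq (e f : WExp) : BExp := .and (.wle e f) (.wle f e)

/-- Run `c` with the scalar variable `i` counting from `0` up to `e`. -/
def Prog.forTo (i : ℕ) (e : WExp) (c : Prog) : Prog :=
  .seq (.setV i (.const 0))
    (.loop (.wlt (.var i) e) (.seq c (.setV i (.add (.var i) (.const 1)))))

infixr:60 " ;; " => Prog.seq

/-- The invariant speaks of memories whose counter has already been advanced, so it may read the
counter cell. Each round costs one iteration plus at most `B` inner ones. -/
theorem Run.forTo {i : ℕ} {e : WExp} (m B : ℕ) (Inv : ℕ → Store → Prop) (hi : i ∉ c.wordWrites)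
    (he : ∀ τ, Same (i :: c.wordWrites) c.realWrites σ τ → e.eval τ = m) (hW : m < W)
    (h0 : Inv 0 (σ.setWord i 0 0))
    (hstep : ∀ j, j < m → ∀ τ, Same (i :: c.wordWrites) c.realWrites σ τ → τ.word i 0 = j →
      Inv j τ → Run W c τ fun N υ => N ≤ B ∧ Inv (j + 1) (υ.setWord i 0 (j + 1)))
    (hend : ∀ N τ, N ≤ m * (B + 1) → Same (i :: c.wordWrites) c.realWrites σ τ →
      τ.word i 0 = m → Inv m τ → Q N τ) :
    Run W (.forTo i e c) σ Q := by
  have hs0 : Same (i :: c.wordWrites) c.realWrites σ (σ.setWord i 0 0) :=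
    ⟨fun a ha => Store.setWord_word_of_ne _ _ _ (by simp at ha; exact ha.1), fun _ _ => rfl⟩
  refine Run.seq (Run.setW (by simp [WExp.eval]; omega) ?_)
  have hsub : ∀ τ, Same (c.wordWrites ++ ([i] : List ℕ)) (c.realWrites ++ ([] : List ℕ))
      (σ.setWord i 0 0) τ → Same (i :: c.wordWrites) c.realWrites σ τ := by
    intro τ h
    exact hs0.trans (h.mono (by simp) (by simp))
  refine Run.loop (fun τ => τ.word i 0 ≤ m ∧ Inv (τ.word i 0) τ)
    (fun τ => (m - τ.word i 0) * (B + 1)) ?_ ?_ ?_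
  · simpa [WExp.eval, Store.setWord_word] using h0
  · rintro τ hs ⟨h1, h2⟩ hb
    have hs' := hsub τ hs
    have hlt : τ.word i 0 < m := by
      simpa [BExp.Holds, WExp.eval, he τ hs'] using hb
    refine Run.seq ((hstep _ hlt τ hs' rfl h2).frame ?_)
    rintro N υ hυ ⟨hN, hI⟩
    have hiυ : υ.word i = τ.word i := hυ.1 i hi
    refine Run.setW (by simp [WExp.eval, hiυ]; omega) ?_
    simp only [WExp.eval, hiυ, Store.setWord_word, if_true]
    refine ⟨⟨hlt, hI⟩, ?_⟩
    have : m - τ.word i 0 = (m - (τ.word i 0 + 1)) + 1 := by omega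
    rw [this, add_mul]
    omega
  · rintro N τ hN hs ⟨h1, h2⟩ hb
    have hs' := hsub τ hs
    have heq : τ.word i 0 = m := by
      have : m ≤ τ.word i 0 := by simpa [BExp.Holds, WExp.eval, he τ hs'] using hb
      omega
    rw [zero_add]
    refine hend N τ ?_ hs' heq (heq ▸ h2)
    simpa [WExp.eval, Store.setWord_word] using hN

end RealRAM

/-! ### Minimum sink trees by path growing and contraction -/

namespace Arborescence

/-- The record of one selection step: the component `C` selects the edge `(p, q)`, and its dual
variable is `y`. Histories list the most recent record first. -/
structure Entry where
  C : Finset ℕ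
  p : ℕ
  q : ℕ
  y : ℕ

/-- The total dual value of the components containing `v`. -/
def load (h : List Entry) (v : ℕ) : ℕ := (h.map fun e => if v ∈ e.C then e.y else 0).sum

/-- The total dual value of the components left by the edge `(v, u)`. -/
def cross (h : List Entry) (v u : ℕ) : ℕ :=
  (h.map fun e => if v ∈ e.C ∧ u ∉ e.C then e.y else 0).sum

/-- The total dual value. -/
def total (h : List Entry) : ℕ := (h.map Entry.y).sum

/-- A partial parent function `f`, where `f v = 0` stands for undefined and `f v = q + 1` for
the parent `q`, is extended by the selected edge of a component without any defined parent. -/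
def step (e : Entry) (f : ℕ → ℕ) : ℕ → ℕ :=
  if ∃ v ∈ e.C, f v ≠ 0 then f else Function.update f e.p (e.q + 1)

/-- Expansion of the contracted components, from the most recent to the oldest. -/
def run : List Entry → (ℕ → ℕ) → ℕ → ℕ
  | [], f => f
  | e :: h, f => run h (step e f)

/-- The structural properties of a history. -/
def Good (n : ℕ) (V : ℕ → ℕ → ℕ) (s : ℕ) : List Entry → Prop
  | [] => True
  | e :: h => Good n V s h ∧ e.C ⊆ Finset.range n ∧ e.p ∈ e.C ∧ e.q < n ∧ e.q ∉ e.C ∧ s ∉ e.C ∧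
      (∀ e' ∈ h, ∀ v ∈ e'.C, v ∈ e.C → e'.C ⊆ e.C) ∧ V e.p e.q = e.y + load h e.p ∧
      ∀ p ∈ e.C, ∀ q < n, q ∉ e.C → e.y + load h p ≤ V p q

/-- Reachability along defined parents. -/
def Path (f : ℕ → ℕ) (v x : ℕ) : Prop := Relation.ReflTransGen (fun a b => f a = b + 1) v x

variable {n s : ℕ} {V : ℕ → ℕ → ℕ} {h : List Entry}

theorem Good.lt_of_mem (hg : Good n V s h) {e : Entry} (he : e ∈ h) {v : ℕ} (hv : v ∈ e.C) :
    v < n := by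
  induction h with
  | nil => simp at he
  | cons x l ih =>
    rcases List.mem_cons.1 he with rfl | hm
    · exact Finset.mem_range.1 (hg.2.1 hv)
    · exact ih hg.1 hm

theorem step_of_ne {e : Entry} {f : ℕ → ℕ} {v : ℕ} (hv : v ≠ e.p) : step e f v = f v := by
  unfold step; split_ifs
  · rfl
  · exact Function.update_of_ne hv _ _

theorem step_of_defined {e : Entry} {f : ℕ → ℕ} {v : ℕ} (he : e.p ∈ e.C) (hv : f v ≠ 0) :
    step e f v = f v := by
  unfold step; split_ifs with h1
  · rfl
  · refine Function.update_of_ne ?_ _ _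
    rintro rfl
    exact h1 ⟨_, he, hv⟩

theorem run_of_defined (hg : Good n V s h) {f : ℕ → ℕ} {v : ℕ} (hv : f v ≠ 0) :
    run h f v = f v := by
  induction h generalizing f with
  | nil => rfl
  | cons e h ih =>
    have h1 := step_of_defined (e := e) hg.2.2.1 hv
    rw [run, ih hg.1 (by rwa [h1]), h1]

theorem run_root (hg : Good n V s h) {f : ℕ → ℕ} (hf : f s = 0) : run h f s = 0 := by
  induction h generalizing f with
  | nil => exact hf
  | cons e h ih =>
    refine ih hg.1 ?_
    rwa [step_of_ne]
    rintro rfl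
    exact hg.2.2.2.2.2.1 hg.2.2.1

theorem run_le (hg : Good n V s h) {f : ℕ → ℕ} (hf : ∀ v, f v ≤ n) (v : ℕ) : run h f v ≤ n := by
  induction h generalizing f with
  | nil => exact hf v
  | cons e h ih =>
    refine ih hg.1 fun u => ?_
    unfold step; split_ifs
    · exact hf u
    · rw [Function.update_apply]; split_ifs
      · exact hg.2.2.2.1
      · exact hf u

/-- The weight of the defined edges. -/
def cost (n : ℕ) (V : ℕ → ℕ → ℕ) (f : ℕ → ℕ) : ℕ :=
  ∑ v ∈ Finset.range n, if f v = 0 then 0 else V v (f v - 1)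

/-- The total dual value of the components without any defined parent. -/
def openTotal (h : List Entry) (f : ℕ → ℕ) : ℕ :=
  (h.map fun e => if ∃ v ∈ e.C, f v ≠ 0 then 0 else e.y).sum

/-- Giving `p` a parent closes all components containing `p`. They were all open, so the open dual
value drops by the full load of `p`. -/
theorem load_add_openTotal_le {f : ℕ → ℕ} {p z : ℕ} (hz : z ≠ 0)
    (hh : ∀ e ∈ h, p ∈ e.C → ∀ v ∈ e.C, f v = 0) :
    load h p + openTotal h (Function.update f p z) ≤ openTotal h f := by
  induction h with
  | nil => simp [load, openTotal]
  | cons e h ih =>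
    have ih' := ih fun e' he' => hh e' (List.mem_cons_of_mem _ he')
    have he := hh e List.mem_cons_self
    have key : (if p ∈ e.C then e.y else 0) +
        (if ∃ v ∈ e.C, Function.update f p z v ≠ 0 then 0 else e.y) ≤
        (if ∃ v ∈ e.C, f v ≠ 0 then 0 else e.y) := by
      by_cases hp : p ∈ e.C
      · have h1 : ∃ v ∈ e.C, Function.update f p z v ≠ 0 := ⟨p, hp, by simpa using hz⟩
        have h2 : ¬ ∃ v ∈ e.C, f v ≠ 0 := by
          rintro ⟨v, hv, hv'⟩
          exact hv' (he hp v hv)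
        rw [if_pos hp, if_pos h1, if_neg h2, add_zero]
      · have h1 : (∃ v ∈ e.C, Function.update f p z v ≠ 0) ↔ ∃ v ∈ e.C, f v ≠ 0 := by
          refine exists_congr fun v => and_congr_right fun hv => ?_
          rw [Function.update_of_ne (by rintro rfl; exact hp hv)]
        simp only [hp, if_false, zero_add, h1, le_refl]
    simp only [load, openTotal, List.map_cons, List.sum_cons] at ih' key ⊢
    omega

theorem cost_update {f : ℕ → ℕ} {p q : ℕ} (hp : p < n) (h0 : f p = 0) :
    cost n V (Function.update f p (q + 1)) = V p q + cost n V f := by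
  have hp' : p ∈ Finset.range n := Finset.mem_range.2 hp
  rw [cost, cost, ← Finset.add_sum_erase _ _ hp', ← Finset.add_sum_erase _ _ hp']
  simp only [Function.update_self, Nat.add_eq_zero_iff, one_ne_zero, and_false, if_false,
    Nat.add_sub_cancel, h0, if_true, zero_add]
  congr 1
  refine Finset.sum_congr rfl fun v hv => ?_
  rw [Function.update_of_ne (Finset.mem_erase.1 hv).1]

/-! ### Optimality by duality -/

/-- A used edge is tight: its weight is the dual of its own component plus the duals of the older
components containing its source. By laminarity those lie inside the open component, so they are
open too, and the new parent closes them. Thus every dual value is paid at most once. -/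
theorem cost_run_le (hg : Good n V s h) (f : ℕ → ℕ) :
    cost n V (run h f) ≤ cost n V f + openTotal h f := by
  induction h generalizing f with
  | nil => simp [run, openTotal]
  | cons e h ih =>
    obtain ⟨hg', hn, hp, _, _, _, hlam, htight, _⟩ := hg
    refine (ih hg' _).trans ?_
    unfold step
    by_cases h1 : ∃ v ∈ e.C, f v ≠ 0
    · rw [if_pos h1]
      simp only [openTotal, List.map_cons, List.sum_cons, if_pos h1, zero_add, le_refl]
    · have h2 : ∀ v ∈ e.C, f v = 0 := fun v hv => by
        by_contra h3; exact h1 ⟨v, hv, h3⟩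
      rw [if_neg h1, cost_update (Finset.mem_range.1 (hn hp)) (h2 _ hp), htight]
      have h3 := load_add_openTotal_le (h := h) (f := f) (p := e.p) (z := e.q + 1)
        (Nat.succ_ne_zero _) fun e' he' hpe v hv => h2 v (hlam e' he' e.p hpe hp hv)
      have h4 : openTotal (e :: h) f = e.y + openTotal h f := by
        simp only [openTotal, List.map_cons, List.sum_cons, if_neg h1]
      omega

theorem cost_run_zero_le (hg : Good n V s h) : cost n V (run h fun _ => 0) ≤ total h := by
  have := cost_run_le hg fun _ => 0
  simpa [cost, openTotal, total] using this

theorem cross_le_load (v u : ℕ) : cross h v u ≤ load h v := by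
  refine List.sum_le_sum fun e _ => ?_
  split_ifs <;> simp_all

/-- Dual feasibility. If the edge leaves the newest component, the inequality recorded there bounds
that dual plus the whole older load of `v`; otherwise the newest record contributes nothing. -/
theorem cross_le (hg : Good n V s h) {v u : ℕ} (hu : u < n) : cross h v u ≤ V v u := by
  induction h with
  | nil => simp [cross]
  | cons e h ih =>
    by_cases h1 : v ∈ e.C ∧ u ∉ e.C
    · refine le_trans ?_ (hg.2.2.2.2.2.2.2.2 v h1.1 u hu h1.2)
      simp only [cross, List.map_cons, List.sum_cons, if_pos h1]
      exact Nat.add_le_add_left (cross_le_load v u) _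
    · refine le_trans ?_ (ih hg.1)
      simp only [cross, List.map_cons, List.sum_cons, if_neg h1, zero_add, le_refl]

/-- No component contains `s`, so following `g` from inside must leave it along some tree edge,
which collects the dual of that component. -/
theorem total_le_sum_cross (hg : Good n V s h) {g : ℕ → ℕ}
    (hs : ∀ v < n, ∃ k : ℕ, g^[k] v = s) :
    total h ≤ ∑ v ∈ (Finset.range n).erase s, cross h v (g v) := by
  induction h with
  | nil => simp [total]
  | cons e h ih =>
    have ih' := ih hg.1
    obtain ⟨_, hn, hp, _, _, hsC, _⟩ := hg
    have hex : ∃ v ∈ e.C, g v ∉ e.C := by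
      by_contra! hcon
      obtain ⟨k, hk⟩ := hs e.p (Finset.mem_range.1 (hn hp))
      have : ∀ k, g^[k] e.p ∈ e.C := by
        intro k
        induction k with
        | zero => exact hp
        | succ k ih => rw [Function.iterate_succ_apply']; exact hcon _ ih
      exact hsC (hk ▸ this k)
    obtain ⟨v, hv, hgv⟩ := hex
    have hv' : v ∈ (Finset.range n).erase s :=
      Finset.mem_erase.2 ⟨by rintro rfl; exact hsC hv, hn hv⟩
    have h1 : e.y ≤ ∑ v ∈ (Finset.range n).erase s, if v ∈ e.C ∧ g v ∉ e.C then e.y else 0 := by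
      refine le_trans (by rw [if_pos ⟨hv, hgv⟩]) (Finset.single_le_sum
        (f := fun v => if v ∈ e.C ∧ g v ∉ e.C then e.y else 0) (fun _ _ => Nat.zero_le _) hv')
    simp only [total, cross, List.map_cons, List.sum_cons, Finset.sum_add_distrib] at ih' ⊢
    omega

theorem total_le (hg : Good n V s h) {g : ℕ → ℕ} (hgn : ∀ v < n, g v < n)
    (hs : ∀ v < n, ∃ k : ℕ, g^[k] v = s) :
    total h ≤ ∑ v ∈ (Finset.range n).erase s, V v (g v) :=
  (total_le_sum_cross hg hs).trans (Finset.sum_le_sum fun v hv =>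
    cross_le hg (hgn v (Finset.mem_range.1 (Finset.mem_erase.1 hv).2)))

/-! ### Connectivity of the expansion -/

/-- Once a vertex `x` of `C` has its parent, the expansion leads all of `C` to `x`. -/
def Inward (h : List Entry) (C : Finset ℕ) : Prop :=
  ∀ (f : ℕ → ℕ) (x : ℕ), x ∈ C → f x ≠ 0 → (∀ v ∈ C, v ≠ x → f v = 0) →
    ∀ v ∈ C, Path (run h f) v x

/-- As long as no vertex of `C` has a parent, the expansion leads all of `C` to `q`. -/
def Outward (h : List Entry) (C : Finset ℕ) (q : ℕ) : Prop :=
  ∀ f : ℕ → ℕ, (∀ v ∈ C, f v = 0) → ∀ v ∈ C, Path (run h f) v q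

theorem inward_of_subsingleton {C : Finset ℕ} (hC : ∀ v ∈ C, ∀ u ∈ C, v = u) : Inward h C := by
  intro f x hx _ _ v hv
  rw [hC v hv x hx]
  exact Relation.ReflTransGen.refl

theorem Inward.cons {C : Finset ℕ} (hC : Inward h C) {e : Entry} (hp : e.p ∉ C) :
    Inward (e :: h) C := by
  intro f x hx hfx hf
  have hne : ∀ v ∈ C, step e f v = f v := fun v hv =>
    step_of_ne (by rintro rfl; exact hp hv)
  exact hC _ x hx (by rwa [hne x hx]) fun v hv hvx => by rw [hne v hv, hf v hv hvx]

theorem Outward.cons {C : Finset ℕ} {q : ℕ} (hC : Outward h C q) {e : Entry} (hp : e.p ∉ C) :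
    Outward (e :: h) C q := by
  intro f hf
  exact hC _ fun v hv => by rw [step_of_ne (by rintro rfl; exact hp hv), hf v hv]

/-- A component that has already received a parent skips its own record. -/
theorem Inward.cons_self {e : Entry} (hC : Inward h e.C) : Inward (e :: h) e.C := by
  intro f x hx hfx hf
  have : step e f = f := if_pos ⟨x, hx, hfx⟩
  simpa [run, this] using hC f x hx hfx hf

/-- In an open component the record gives `e.p` the parent `e.q`; everything flows to `e.p`, and
this parent is never overwritten. -/
theorem Inward.outward {e : Entry} (hC : Inward h e.C) (hg : Good n V s (e :: h)) :
    Outward (e :: h) e.C e.q := by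
  intro f hf v hv
  have hp := hg.2.2.1
  have h1 : step e f = Function.update f e.p (e.q + 1) :=
    if_neg (by rintro ⟨u, hu, hu'⟩; exact hu' (hf u hu))
  have h2 : (Function.update f e.p (e.q + 1)) e.p = e.q + 1 := Function.update_self ..
  rw [run, h1]
  refine Relation.ReflTransGen.tail (hC _ e.p hp (by simp) (fun u hu hup => ?_) v hv) ?_
  · rw [Function.update_of_ne hup, hf u hu]
  · rw [run_of_defined hg.1 (by simp), h2]

/-! ### Path growing and the preservation of its invariant -/

/-- The vertices of the component at stack position `j`. -/
def comp (n : ℕ) (cid : ℕ → ℕ) (j : ℕ) : Finset ℕ := (Finset.range n).filter fun v => cid v = j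

@[simp] theorem mem_comp {cid : ℕ → ℕ} {j v : ℕ} : v ∈ comp n cid j ↔ v < n ∧ cid v = j := by
  simp [comp]

/-- The invariant of the algorithm. Unvisited vertices have `cid v = 0`, the components on the
stack have the positions `1, …, k`, and the vertices known to reach the root have
`cid v = n + 1`. The potential of `v` is `a v`, and `best j q` is the best source of an edge
from the component `j` to `q`. -/
structure Inv (n : ℕ) (V : ℕ → ℕ → ℕ) (s : ℕ) (cid : ℕ → ℕ) (k : ℕ) (h : List Entry)
    (a : ℕ → ℕ) (best : ℕ → ℕ → ℕ) : Prop where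
  root_lt : s < n
  root : cid s = n + 1
  range : ∀ v < n, cid v ≤ k ∨ cid v = n + 1
  card : k + (comp n cid 0).card ≤ n
  good : Good n V s h
  load : ∀ v < n, a v = load h v
  hist : ∀ e ∈ h, ∀ v ∈ e.C, cid v ≠ 0 ∧ ∀ u ∈ e.C, cid u = cid v
  slack : ∀ p < n, ∀ q < n, cid p ≠ cid q → cid p ≠ n + 1 → a p ≤ V p q
  best : ∀ j, 1 ≤ j → j ≤ k → ∀ q < n, best j q < n ∧ cid (best j q) = j ∧
    ∀ p < n, cid p = j → cid q ≠ j → V (best j q) q - a (best j q) ≤ V p q - a p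
  inward : ∀ j, 1 ≤ j → j ≤ k → Inward h (comp n cid j)
  outward : ∀ j, 1 ≤ j → j < k → ∃ q ∈ comp n cid (j + 1), Outward h (comp n cid j) q
  done : ∀ f : ℕ → ℕ, (∀ v ∈ comp n cid (n + 1), f v = 0) →
    ∀ v ∈ comp n cid (n + 1), Path (run h f) v s

variable {cid a : ℕ → ℕ} {k : ℕ} {best : ℕ → ℕ → ℕ}

theorem Inv.init (hs : s < n) :
    Inv n V s (fun v => if v = s then n + 1 else 0) 0 [] (fun _ => 0) best where
  root_lt := hs
  root := if_pos rfl
  range v _ := by by_cases hv : v = s <;> simp [hv]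
  card := by
    rw [zero_add]
    exact (Finset.card_filter_le _ _).trans (by simp)
  good := trivial
  load _ _ := rfl
  hist := by simp
  slack := by simp
  best j h1 h2 := by omega
  inward j h1 h2 := by omega
  outward j h1 h2 := by omega
  done f _ v hv := by
    have : v = s := by
      by_contra hne
      simp [hne] at hv
    exact this ▸ Relation.ReflTransGen.refl

/-- An unvisited vertex lies in no recorded component and has potential zero, so as a singleton
component it satisfies the new conditions trivially. The former top already leads to it. -/
theorem Inv.push (H : Inv n V s cid k h a best) {u : ℕ} (hu : u < n) (hu0 : cid u = 0)
    (hout : 1 ≤ k → Outward h (comp n cid k) u) {best' : ℕ → ℕ → ℕ}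
    (hb : ∀ j, j ≠ k + 1 → ∀ q < n, best' j q = best j q) (hb' : ∀ q < n, best' (k + 1) q = u) :
    Inv n V s (Function.update cid u (k + 1)) (k + 1) h a best' ∧
      (comp n (Function.update cid u (k + 1)) 0).card + 1 = (comp n cid 0).card := by
  have hmem : u ∈ comp n cid 0 := by simp [hu, hu0]
  have hcard : (comp n (Function.update cid u (k + 1)) 0).card + 1 = (comp n cid 0).card := by
    have : comp n (Function.update cid u (k + 1)) 0 = (comp n cid 0).erase u := by
      ext v
      by_cases hv : v = u <;> simp [hv]
    rw [this, Finset.card_erase_add_one hmem]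
  have hkn : k + 1 ≤ n := by
    have := H.card
    omega
  have hsu : s ≠ u := by rintro rfl; have := H.root; omega
  have hne : ∀ v, v ≠ u → Function.update cid u (k + 1) v = cid v :=
    fun v hv => Function.update_of_ne hv _ _
  have hself : Function.update cid u (k + 1) u = k + 1 := Function.update_self ..
  have hcomp : ∀ j, 1 ≤ j → j ≠ k + 1 → comp n (Function.update cid u (k + 1)) j = comp n cid j := by
    intro j h1 h2
    ext v
    by_cases hv : v = u
    · subst hv; simp [hu0]; omega
    · simp [hv]
  have hk1 : ∀ v < n, cid v ≠ k + 1 := by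
    intro v hv hc
    have := H.range v hv
    omega
  have htop : ∀ v ∈ comp n (Function.update cid u (k + 1)) (k + 1), v = u := by
    intro v hv
    by_contra hvu
    rw [mem_comp, hne v hvu] at hv
    exact hk1 v hv.1 hv.2
  have hload0 : Arborescence.load h u = 0 := by
    rw [Arborescence.load, List.sum_eq_zero]
    intro x hx
    obtain ⟨e, he, rfl⟩ := List.mem_map.1 hx
    exact if_neg fun hue => (H.hist e he u hue).1 hu0
  refine ⟨?_, hcard⟩
  constructor
  · exact H.root_lt
  · rw [hne s hsu, H.root]
  · intro v hv
    by_cases hvu : v = u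
    · rw [hvu, hself]; exact Or.inl le_rfl
    · rw [hne v hvu]
      have := H.range v hv
      omega
  · have := H.card
    omega
  · exact H.good
  · exact H.load
  · intro e he v hv
    have huC : ∀ w ∈ e.C, w ≠ u := fun w hw hwu => (H.hist e he w hw).1 (by rw [hwu, hu0])
    rw [hne v (huC v hv)]
    exact ⟨(H.hist e he v hv).1, fun w hw => by
      rw [hne w (huC w hw)]; exact (H.hist e he v hv).2 w hw⟩
  · intro p hp q hq hpq hpn
    by_cases hpu : p = u
    · rw [hpu, H.load u hu, hload0]; exact Nat.zero_le _
    · rw [hne p hpu] at hpq hpn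
      by_cases hqu : q = u
      · by_cases hp0 : cid p = 0
        · have : a p = 0 := by
            rw [H.load p hp, Arborescence.load, List.sum_eq_zero]
            intro x hx
            obtain ⟨e, he, rfl⟩ := List.mem_map.1 hx
            exact if_neg fun hue => (H.hist e he p hue).1 hp0
          omega
        · exact H.slack p hp q hq (by rw [hqu, hu0]; exact hp0) hpn
      · rw [hne q hqu] at hpq
        exact H.slack p hp q hq hpq hpn
  · intro j h1 h2 q hq
    by_cases hj : j = k + 1
    · subst hj
      rw [hb' q hq]
      refine ⟨hu, hself, fun p hp hpj _ => ?_⟩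
      rw [htop p (mem_comp.2 ⟨hp, hpj⟩)]
    · rw [hb j hj q hq]
      obtain ⟨h3, h4, h5⟩ := H.best j h1 (by omega) q hq
      refine ⟨h3, ?_, fun p hp hpj hqj => ?_⟩
      · rw [hne _ (by rintro h6; rw [h6, hu0] at h4; omega), h4]
      · have hpu : p ≠ u := by rintro rfl; rw [hself] at hpj; omega
        rw [hne p hpu] at hpj
        refine h5 p hp hpj ?_
        by_cases hqu : q = u
        · rw [hqu, hu0]; omega
        · rwa [hne q hqu] at hqj
  · intro j h1 h2
    by_cases hj : j = k + 1
    · subst hj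
      exact inward_of_subsingleton fun v hv w hw => (htop v hv).trans (htop w hw).symm
    · rw [hcomp j h1 hj]
      exact H.inward j h1 (by omega)
  · intro j h1 h2
    rw [hcomp j h1 (by omega)]
    by_cases hj : j = k
    · subst hj
      exact ⟨u, by simp [hu], hout h1⟩
    · rw [hcomp (j + 1) (by omega) (by omega)]
      exact H.outward j h1 (by omega)
  · rw [hcomp (n + 1) (by omega) (by omega)]
    exact H.done

/-- The raise is the least reduced weight leaving the top component, hence feasibility survives and
the selected edge becomes tight. Slack makes the truncated subtractions exact where equality
matters, and a uniform raise does not change which source is best. -/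
theorem Inv.select (H : Inv n V s cid k h a best) (hk : 1 ≤ k) {q : ℕ} (hq : q < n)
    (hqk : cid q ≠ k) (hmin : ∀ u < n, cid u ≠ k →
      V (best k q) q - a (best k q) ≤ V (best k u) u - a (best k u)) {a' : ℕ → ℕ}
    (ha' : ∀ v < n, a' v = if cid v = k then a v + (V (best k q) q - a (best k q)) else a v) :
    Inv n V s cid k (⟨comp n cid k, best k q, q, V (best k q) q - a (best k q)⟩ :: h) a' best ∧
      Outward (⟨comp n cid k, best k q, q, V (best k q) q - a (best k q)⟩ :: h)
        (comp n cid k) q := by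
  obtain ⟨hb1, hb2, _⟩ := H.best k hk le_rfl q hq
  have hkn : k ≤ n := by have := H.card; omega
  set y := V (best k q) q - a (best k q) with hy
  set e : Entry := ⟨comp n cid k, best k q, q, y⟩ with he
  have hmin' : ∀ p < n, cid p = k → ∀ u < n, cid u ≠ k → y + a p ≤ V p u := by
    intro p hp hpk u hu huk
    have h1 := hmin u hu huk
    have h2 := (H.best k hk le_rfl u hu).2.2 p hp hpk huk
    have h3 := H.slack p hp u hu (by rw [hpk]; exact fun h => huk h.symm) (by omega)
    omega
  have hgood : Good n V s (e :: h) := by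
    refine ⟨H.good, Finset.filter_subset _ _, by simp [he, hb1, hb2], hq, by simp [he, hqk], ?_,
      ?_, ?_, ?_⟩
    · have := H.root
      simp only [he, mem_comp, not_and]
      omega
    · intro e' he' v hv hvC u hu
      have hvk : cid v = k := (mem_comp.1 hvC).2
      refine mem_comp.2 ⟨?_, ((H.hist e' he' v hv).2 u hu).trans hvk⟩
      exact H.good.lt_of_mem he' hu
    · have h3 := H.slack _ hb1 q hq (by rw [hb2]; exact fun h => hqk h.symm) (by omega)
      have := H.load _ hb1
      simp only [he]
      omega
    · intro p hp u hu huC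
      obtain ⟨hp1, hp2⟩ := mem_comp.1 hp
      have := H.load _ hp1
      rw [← this]
      exact hmin' p hp1 hp2 u hu fun hc => huC (mem_comp.2 ⟨hu, hc⟩)
  have hpC : ∀ j, j ≠ k → e.p ∉ comp n cid j := by
    intro j hj hm
    exact hj ((mem_comp.1 hm).2.symm.trans hb2)
  have hloadc : ∀ v, Arborescence.load (e :: h) v =
      (if v ∈ comp n cid k then y else 0) + Arborescence.load h v := fun v => rfl
  refine ⟨?_, (H.inward k hk le_rfl).outward (e := e) hgood⟩
  constructor
  · exact H.root_lt
  · exact H.root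
  · exact H.range
  · exact H.card
  · exact hgood
  · intro v hv
    rw [ha' v hv, hloadc, ← H.load v hv]
    by_cases hc : cid v = k
    · rw [if_pos hc, if_pos (mem_comp.2 ⟨hv, hc⟩), add_comm]
    · rw [if_neg hc, if_neg (by simp [hc]), zero_add]
  · intro e' he' v hv
    rcases List.mem_cons.1 he' with rfl | hm
    · have := (mem_comp.1 hv).2
      exact ⟨by omega, fun u hu => ((mem_comp.1 hu).2).trans this.symm⟩
    · exact H.hist e' hm v hv
  · intro p hp u hu hpu hpn
    rw [ha' p hp]
    split_ifs with hc
    · have := hmin' p hp hc u hu (by rw [← hc]; exact hpu.symm)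
      omega
    · exact H.slack p hp u hu hpu hpn
  · intro j h1 h2 u hu
    obtain ⟨h3, h4, h5⟩ := H.best j h1 h2 u hu
    refine ⟨h3, h4, fun p hp hpj huj => ?_⟩
    have := h5 p hp hpj huj
    rw [ha' p hp, ha' _ h3, h4, hpj]
    split_ifs <;> omega
  · intro j h1 h2
    by_cases hj : j = k
    · subst hj
      exact (H.inward j h1 le_rfl).cons_self (e := e)
    · exact (H.inward j h1 h2).cons (hpC j hj)
  · intro j h1 h2
    obtain ⟨u, hu, hu'⟩ := H.outward j h1 h2
    exact ⟨u, hu, hu'.cons (hpC j (by omega))⟩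
  · intro f hf
    exact H.done _ fun v hv => by
      rw [step_of_ne (by rintro rfl; exact hpC (n + 1) (by omega) hv), hf v hv]

/-- Induction from `m` down to `l`, used to follow the stack to its top. -/
theorem descend {P : ℕ → Prop} {l m : ℕ} (hm : P m) (hs : ∀ j, l ≤ j → j < m → P (j + 1) → P j)
    {j : ℕ} (h1 : l ≤ j) (h2 : j ≤ m) : P j := by
  obtain ⟨d, rfl⟩ := Nat.exists_eq_add_of_le h2
  clear h2
  induction d generalizing j with
  | zero => exact hm
  | succ d ih =>
    refine hs j h1 (by omega) (ih (j := j + 1) (by omega) ?_ ?_)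
    · convert hm using 1; omega
    · intro i h3 h4; exact hs i h3 (by omega)

/-- The outward paths lead each stack component to the next one and the top to `q`, which already
reaches the root. Marks and potentials inside the connected set no longer matter for slack. -/
theorem Inv.absorb (H : Inv n V s cid k h a best) (hk : 1 ≤ k) {q : ℕ} (hq : q < n)
    (hqn : cid q = n + 1) (hout : Outward h (comp n cid k) q) {cid' : ℕ → ℕ}
    (hcid : ∀ v < n, cid' v = if cid v = 0 then 0 else n + 1) :
    Inv n V s cid' 0 h a best ∧ comp n cid' 0 = comp n cid 0 := by
  have hcomp0 : comp n cid' 0 = comp n cid 0 := by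
    ext v
    simp only [mem_comp]
    refine and_congr_right fun hv => ?_
    rw [hcid v hv]
    split_ifs with h0 <;> simp [h0]
  have hmem : ∀ e ∈ h, ∀ v ∈ e.C, v < n := fun e he v => H.good.lt_of_mem he
  refine ⟨?_, hcomp0⟩
  constructor
  · exact H.root_lt
  · rw [hcid s H.root_lt, H.root]; simp
  · intro v hv
    rw [hcid v hv]
    split_ifs <;> simp
  · rw [hcomp0]; have := H.card; omega
  · exact H.good
  · exact H.load
  · intro e he v hv
    have h1 := H.hist e he v hv
    rw [hcid v (hmem e he v hv), if_neg h1.1]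
    refine ⟨by omega, fun u hu => ?_⟩
    rw [hcid u (hmem e he u hu), if_neg (H.hist e he u hu).1]
  · intro p hp u hu hpu hpn
    have hp0 : cid p = 0 := by
      by_contra h0
      rw [hcid p hp, if_neg h0] at hpn
      exact hpn rfl
    have hu0 : cid u ≠ 0 := by
      intro h0
      rw [hcid p hp, hcid u hu, h0, hp0] at hpu
      exact hpu rfl
    exact H.slack p hp u hu (by omega) (by omega)
  · intro j h1 h2; omega
  · intro j h1 h2; omega
  · intro j h1 h2; omega
  · intro f hf
    have hf' : ∀ v < n, cid v ≠ 0 → f v = 0 := fun v hv h0 =>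
      hf v (mem_comp.2 ⟨hv, by rw [hcid v hv, if_neg h0]⟩)
    have hdone : ∀ v < n, cid v = n + 1 → Path (run h f) v s := fun v hv hc =>
      H.done f (fun u hu => hf' u (mem_comp.1 hu).1 (by rw [(mem_comp.1 hu).2]; omega)) v
        (mem_comp.2 ⟨hv, hc⟩)
    have hstack : ∀ j, 1 ≤ j → j ≤ k → ∀ v ∈ comp n cid j, Path (run h f) v s := by
      intro j h1 h2
      have hz : ∀ j, 1 ≤ j → ∀ u ∈ comp n cid j, f u = 0 := fun j hj u hu =>
        hf' u (mem_comp.1 hu).1 (by rw [(mem_comp.1 hu).2]; omega)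
      refine descend (P := fun j => ∀ v ∈ comp n cid j, Path (run h f) v s) (l := 1) ?_ ?_ h1 h2
      · exact fun v hv => (hout f (hz k hk) v hv).trans (hdone q hq hqn)
      · intro i h3 h4 ih v hv
        obtain ⟨u, hu, hu'⟩ := H.outward i h3 h4
        exact (hu' f (hz i h3) v hv).trans (ih u hu)
    intro v hv
    obtain ⟨hvn, hvc⟩ := mem_comp.1 hv
    have h0 : cid v ≠ 0 := by
      intro h0
      rw [hcid v hvn, if_pos h0] at hvc
      omega
    rcases H.range v hvn with h1 | h1
    · exact hstack (cid v) (by omega) h1 v (mem_comp.2 ⟨hvn, rfl⟩)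
    · exact hdone v hvn h1

/-- The components `i, …, k` form a cycle, closed by the edge from the top to `q`. If a vertex `x`
of the merged component receives its parent from a later record, only the component containing `x`
is closed; the others stay open and follow the cycle to it, and there `Inward` leads on to `x`. -/
theorem Inv.merge (H : Inv n V s cid k h a best) {q i : ℕ} (hq : q < n) (hi : 1 ≤ i) (hik : i < k)
    (hqi : cid q = i) (hout : Outward h (comp n cid k) q) {cid' : ℕ → ℕ} {best' : ℕ → ℕ → ℕ}
    (hcid : ∀ v < n, cid' v = if i ≤ cid v ∧ cid v ≤ k then i else cid v)
    (hb : ∀ j, j < i → ∀ u < n, best' j u = best j u)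
    (hb' : ∀ u < n, best' i u < n ∧ i ≤ cid (best' i u) ∧ cid (best' i u) ≤ k ∧
      ∀ p < n, i ≤ cid p → cid p ≤ k → (cid u < i ∨ k < cid u) →
        V (best' i u) u - a (best' i u) ≤ V p u - a p) :
    Inv n V s cid' i h a best' ∧ comp n cid' 0 = comp n cid 0 := by
  have hkn : k ≤ n := by have := H.card; omega
  have hcomp : ∀ j, j ≠ i → (j < i ∨ k < j) → comp n cid' j = comp n cid j := by
    intro j hj hj'
    ext v
    simp only [mem_comp]
    refine and_congr_right fun hv => ?_
    rw [hcid v hv]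
    split_ifs with h0 <;> omega
  have hmemi : ∀ v, v ∈ comp n cid' i ↔ v < n ∧ i ≤ cid v ∧ cid v ≤ k := by
    intro v
    rw [mem_comp]
    refine and_congr_right fun hv => ?_
    rw [hcid v hv]
    split_ifs with h0
    · simp [h0]
    · omega
  have hcomp0 : comp n cid' 0 = comp n cid 0 := hcomp 0 (by omega) (by omega)
  have hmem : ∀ e ∈ h, ∀ v ∈ e.C, v < n := fun e he v => H.good.lt_of_mem he
  refine ⟨?_, hcomp0⟩
  constructor
  · exact H.root_lt
  · rw [hcid s H.root_lt, H.root, if_neg (by omega)]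
  · intro v hv
    rw [hcid v hv]
    have := H.range v hv
    split_ifs <;> omega
  · rw [hcomp0]; have := H.card; omega
  · exact H.good
  · exact H.load
  · intro e he v hv
    have h1 := H.hist e he v hv
    rw [hcid v (hmem e he v hv)]
    refine ⟨by split_ifs <;> omega, fun u hu => ?_⟩
    rw [hcid u (hmem e he u hu), h1.2 u hu]
  · intro p hp u hu hpu hpn
    rw [hcid p hp, hcid u hu] at hpu
    rw [hcid p hp] at hpn
    refine H.slack p hp u hu ?_ ?_
    · intro h1; rw [h1] at hpu; exact hpu rfl
    · intro h1; rw [if_neg (by omega)] at hpn; exact hpn h1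
  · intro j h1 h2 u hu
    by_cases hj : j = i
    · subst hj
      obtain ⟨h3, h4, h5, h6⟩ := hb' u hu
      refine ⟨h3, by rw [hcid _ h3, if_pos ⟨h4, h5⟩], fun p hp hpj huj => ?_⟩
      have h7 := (hmemi p).1 (mem_comp.2 ⟨hp, hpj⟩)
      refine h6 p hp h7.2.1 h7.2.2 ?_
      rw [hcid u hu] at huj
      by_contra hcon
      rw [if_pos (by omega)] at huj
      exact huj rfl
    · have hjlt : j < i := by omega
      rw [hb j hjlt u hu]
      obtain ⟨h3, h4, h5⟩ := H.best j h1 (by omega) u hu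
      refine ⟨h3, by rw [hcid _ h3, if_neg (by omega), h4], fun p hp hpj huj => ?_⟩
      rw [hcid p hp] at hpj
      rw [hcid u hu] at huj
      refine h5 p hp ?_ ?_
      · split_ifs at hpj <;> omega
      · split_ifs at huj <;> omega
  · intro j h1 h2
    by_cases hj : j = i
    · subst hj
      intro f x hx hfx hf
      obtain ⟨hxn, hx1, hx2⟩ := (hmemi x).1 hx
      have hz : ∀ l, j ≤ l → l ≤ k → l ≠ cid x → ∀ v ∈ comp n cid l, f v = 0 := by
        intro l h3 h4 h5 v hv
        obtain ⟨hvn, hvl⟩ := mem_comp.1 hv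
        refine hf v ((hmemi v).2 ⟨hvn, by omega, by omega⟩) ?_
        rintro rfl
        exact h5 hvl.symm
      have hown : ∀ v ∈ comp n cid (cid x), Path (run h f) v x := by
        refine H.inward (cid x) (by omega) hx2 f x (mem_comp.2 ⟨hxn, rfl⟩) hfx ?_
        intro v hv hvx
        obtain ⟨hvn, hvl⟩ := mem_comp.1 hv
        exact hf v ((hmemi v).2 ⟨hvn, by omega, by omega⟩) hvx
      have hstep : ∀ l, j ≤ l → l < k → l ≠ cid x → (∀ v ∈ comp n cid (l + 1), Path (run h f) v x) →
          ∀ v ∈ comp n cid l, Path (run h f) v x := by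
        intro l h3 h4 h5 ih v hv
        obtain ⟨u, hu, hu'⟩ := H.outward l (by omega) h4
        exact (hu' f (hz l h3 (by omega) h5) v hv).trans (ih u hu)
      have hlow : ∀ l, j ≤ l → l ≤ cid x → ∀ v ∈ comp n cid l, Path (run h f) v x := by
        intro l h3 h4
        exact descend (P := fun l => ∀ v ∈ comp n cid l, Path (run h f) v x) (l := j) hown
          (fun i h5 h6 => hstep i h5 (by omega) (by omega)) h3 h4
      -- Components above the one of `x` first climb to the top, take the closing edge to component
      -- `j`, and then climb to `x`.
      have htop : ∀ v ∈ comp n cid k, Path (run h f) v x := by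
        by_cases hxk : cid x = k
        · exact hxk ▸ hown
        · intro v hv
          exact (hout f (hz k (by omega) le_rfl (Ne.symm hxk)) v hv).trans
            (hlow j le_rfl hx1 q (mem_comp.2 ⟨hq, hqi⟩))
      have hhigh : ∀ l, cid x < l → l ≤ k → ∀ v ∈ comp n cid l, Path (run h f) v x := by
        intro l h3 h4
        exact descend (P := fun l => ∀ v ∈ comp n cid l, Path (run h f) v x) (l := cid x + 1) htop
          (fun i h5 h6 => hstep i (by omega) h6 (by omega)) h3 h4
      intro v hv
      obtain ⟨hvn, hv1, hv2⟩ := (hmemi v).1 hv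
      rcases le_or_gt (cid v) (cid x) with h3 | h3
      · exact hlow _ hv1 h3 v (mem_comp.2 ⟨hvn, rfl⟩)
      · exact hhigh _ h3 hv2 v (mem_comp.2 ⟨hvn, rfl⟩)
    · rw [hcomp j hj (by omega)]
      exact H.inward j h1 (by omega)
  · intro j h1 h2
    obtain ⟨u, hu, hu'⟩ := H.outward j h1 (by omega)
    rw [hcomp j (by omega) (by omega)]
    refine ⟨u, ?_, hu'⟩
    by_cases hj : j + 1 = i
    · rw [hj, hmemi]
      have := mem_comp.1 hu
      omega
    · rw [hcomp (j + 1) hj (by omega)]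
      exact hu
  · rw [hcomp (n + 1) (by omega) (by omega)]
    exact H.done

/-- When nothing is left on the stack and all vertices have been visited, the expansion of the
history is a minimum sink tree. -/
theorem Inv.final (H : Inv n V s cid 0 h a best) (h0 : ∀ v < n, cid v ≠ 0) :
    run h (fun _ => 0) s = 0 ∧ (∀ v < n, v ≠ s → run h (fun _ => 0) v ≠ 0) ∧
      (∀ v, run h (fun _ => 0) v ≤ n) ∧ (∀ v < n, Path (run h fun _ => 0) v s) ∧
      ∀ g : ℕ → ℕ, (∀ v < n, g v < n) → (∀ v < n, ∃ k : ℕ, g^[k] v = s) →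
        cost n V (run h fun _ => 0) ≤ ∑ v ∈ (Finset.range n).erase s, V v (g v) := by
  have hpath : ∀ v < n, Path (run h fun _ => 0) v s := by
    intro v hv
    refine H.done _ (fun _ _ => rfl) v (mem_comp.2 ⟨hv, ?_⟩)
    have := H.range v hv
    have := h0 v hv
    omega
  refine ⟨run_root H.good rfl, fun v hv hvs => ?_, run_le H.good fun _ => Nat.zero_le _, hpath,
    fun g hg hs => (cost_run_zero_le H.good).trans (total_le H.good hg hs)⟩
  rcases Relation.ReflTransGen.cases_head (hpath v hv) with h1 | ⟨c, h1, _⟩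
  · exact absurd h1 hvs
  · rw [h1]; omega

end Arborescence

/-! ### Approximate medians -/

namespace Selection

open Classical in
/-- The number of entries among the first `N` that satisfy `Q`. -/
noncomputable def cnt (S : ℕ → ℝ) (N : ℕ) (Q : ℝ → Prop) : ℕ :=
  ((Finset.range N).filter fun i => Q (S i)).card

/-- Positions ordered by value, ties broken by position. -/
def Before (S : ℕ → ℝ) (j i : ℕ) : Prop := S j < S i ∨ (S j = S i ∧ j < i)

open Classical in
/-- The rank of the `i`-th entry in its block of length `blk`. -/
noncomputable def rank (S : ℕ → ℝ) (N blk i : ℕ) : ℕ :=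
  ((Finset.range blk).filter fun j =>
    i / blk * blk + j < N ∧ Before S (i / blk * blk + j) i).card

/-- `Q` is closed downwards. -/
def Down (Q : ℝ → Prop) : Prop := ∀ x y, x ≤ y → Q y → Q x

theorem Before.trans {S : ℕ → ℝ} {i j k : ℕ} (h : Before S i j) (h' : Before S j k) :
    Before S i k := by
  rcases h with h | ⟨h, h1⟩ <;> rcases h' with h' | ⟨h', h1'⟩
  · exact Or.inl (h.trans h')
  · exact Or.inl (h' ▸ h)
  · exact Or.inl (h ▸ h')
  · exact Or.inr ⟨h.trans h', h1.trans h1'⟩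

theorem Before.irrefl {S : ℕ → ℝ} {i : ℕ} : ¬ Before S i i := by
  rintro (h | ⟨_, h⟩)
  · exact lt_irrefl _ h
  · exact lt_irrefl _ h

theorem before_or {S : ℕ → ℝ} {i j : ℕ} (h : i ≠ j) : Before S i j ∨ Before S j i := by
  rcases lt_trichotomy (S i) (S j) with h1 | h1 | h1
  · exact Or.inl (Or.inl h1)
  · rcases lt_or_gt_of_ne h with h2 | h2
    · exact Or.inl (Or.inr ⟨h1, h2⟩)
    · exact Or.inr (Or.inr ⟨h1.symm, h2⟩)
  · exact Or.inr (Or.inl h1)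

theorem Before.le {S : ℕ → ℝ} {i j : ℕ} (h : Before S i j) : S i ≤ S j := by
  rcases h with h | ⟨h, _⟩
  · exact h.le
  · exact h.le

-- `Before` is a strict total order, so ranks are distinct. The entries satisfying a downward closed
-- condition come first, so their ranks fill an initial interval; this follows by comparing
-- cardinalities.
open Classical in
theorem image_rank (S : ℕ → ℝ) (B : Finset ℕ) {Q : ℝ → Prop} (hQ : Down Q) :
    ((B.filter fun i => Q (S i)).image fun i => (B.filter fun j => Before S j i).card) =
      Finset.range (B.filter fun i => Q (S i)).card ∧
    Set.InjOn (fun i => (B.filter fun j => Before S j i).card) (B : Set ℕ) := by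
  have hlt : ∀ i ∈ B, ∀ j ∈ B, Before S i j →
      (B.filter fun l => Before S l i).card < (B.filter fun l => Before S l j).card := by
    intro i hi j hj hij
    refine Finset.card_lt_card ⟨fun l hl => ?_, fun h => ?_⟩
    · rw [Finset.mem_filter] at hl ⊢
      exact ⟨hl.1, hl.2.trans hij⟩
    · have := h (Finset.mem_filter.2 ⟨hi, hij⟩)
      exact Before.irrefl (Finset.mem_filter.1 this).2
  have hinj : Set.InjOn (fun i => (B.filter fun j => Before S j i).card) (B : Set ℕ) := by
    intro i hi j hj hij
    by_contra hne
    rcases before_or (S := S) hne with h | h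
    · exact (hlt i hi j hj h).ne hij
    · exact (hlt j hj i hi h).ne hij.symm
  refine ⟨Finset.eq_of_subset_of_card_le ?_ ?_, hinj⟩
  · intro c hc
    obtain ⟨i, hi, rfl⟩ := Finset.mem_image.1 hc
    obtain ⟨hiB, hiQ⟩ := Finset.mem_filter.1 hi
    refine Finset.mem_range.2 (Finset.card_lt_card ⟨fun l hl => ?_, fun h => ?_⟩)
    · rw [Finset.mem_filter] at hl ⊢
      exact ⟨hl.1, hQ _ _ hl.2.le hiQ⟩
    · exact Before.irrefl (Finset.mem_filter.1 (h hi)).2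
  · rw [Finset.card_range, Finset.card_image_of_injOn]
    exact hinj.mono (Finset.coe_subset.2 (Finset.filter_subset _ _))

theorem card_filter_mod_four (r : ℕ) : ((Finset.range r).filter fun c => c % 4 = 3).card = r / 4 := by
  induction r with
  | zero => rfl
  | succ r ih =>
    rw [Finset.range_add_one, Finset.filter_insert]
    split_ifs with h
    · rw [Finset.card_insert_of_notMem (by simp), ih]; omega
    · rw [ih]; omega

-- Residue three rounds down: among the first `c` ranks exactly `⌊c / 4⌋` are kept, so scaled sample
-- counts never exceed true counts.
open Classical in
theorem card_filter_rank (S : ℕ → ℝ) (B : Finset ℕ) {Q : ℝ → Prop} (hQ : Down Q) :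
    (B.filter fun i => Q (S i) ∧ (B.filter fun j => Before S j i).card % 4 = 3).card =
      (B.filter fun i => Q (S i)).card / 4 := by
  obtain ⟨h1, h2⟩ := image_rank S B hQ
  rw [← card_filter_mod_four, ← h1, Finset.filter_image, Finset.card_image_of_injOn,
    Finset.filter_filter]
  exact h2.mono (by intro i hi; simp at hi ⊢; exact hi.1.1)

open Classical in
theorem rank_eq (S : ℕ → ℝ) {N blk i : ℕ} (hb : 0 < blk) :
    rank S N blk i =
      (((Finset.range N).filter fun j => j / blk = i / blk).filter fun j => Before S j i).card := by
  refine Finset.card_bij (fun j _ => i / blk * blk + j) ?_ ?_ ?_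
  · intro j hj
    simp only [Finset.mem_filter, Finset.mem_range] at hj ⊢
    refine ⟨⟨hj.2.1, ?_⟩, hj.2.2⟩
    rw [add_comm, Nat.add_mul_div_right _ _ hb, Nat.div_eq_of_lt hj.1, zero_add]
  · intro a _ b _ h
    exact Nat.add_left_cancel h
  · intro j hj
    simp only [Finset.mem_filter, Finset.mem_range] at hj
    have h1 : i / blk * blk + j % blk = j := by
      rw [← hj.1.2, mul_comm]; exact Nat.div_add_mod j blk
    refine ⟨j % blk, ?_, h1⟩
    simp only [Finset.mem_filter, Finset.mem_range]
    rw [h1]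
    exact ⟨Nat.mod_lt _ hb, hj.1.1, hj.2⟩

open Classical in
/-- Keeping every fourth entry of each block divides all counts by four, up to an error of
three per block. -/
theorem cnt_sample (S : ℕ → ℝ) {N blk : ℕ} (hb : 0 < blk) {Q : ℝ → Prop} (hQ : Down Q) :
    4 * ((Finset.range N).filter fun i => Q (S i) ∧ rank S N blk i % 4 = 3).card ≤ cnt S N Q ∧
      cnt S N Q ≤ 4 * ((Finset.range N).filter fun i => Q (S i) ∧ rank S N blk i % 4 = 3).card +
        3 * (N / blk + 1) := by
  have hmaps : ∀ F ⊆ Finset.range N, Set.MapsTo (fun i => i / blk) (F : Set ℕ)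
      (Finset.range (N / blk + 1) : Finset ℕ) := by
    intro F hF i hi
    have := Finset.mem_range.1 (hF hi)
    simp only [Finset.coe_range, Set.mem_Iio]
    exact Nat.lt_succ_of_le (Nat.div_le_div_right this.le)
  have hblock : ∀ b, (((Finset.range N).filter fun i => Q (S i) ∧ rank S N blk i % 4 = 3).filter
        fun i => i / blk = b).card =
      (((Finset.range N).filter fun i => Q (S i)).filter fun i => i / blk = b).card / 4 := by
    intro b
    rw [Finset.filter_filter, Finset.filter_filter]
    convert card_filter_rank S ((Finset.range N).filter fun j => j / blk = b) hQ using 2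
    · ext i
      simp only [Finset.mem_filter, rank_eq S hb]
      constructor
      · rintro ⟨h1, ⟨h2, h3⟩, rfl⟩
        exact ⟨⟨h1, rfl⟩, h2, h3⟩
      · rintro ⟨⟨h1, rfl⟩, h2, h3⟩
        exact ⟨h1, ⟨h2, h3⟩, rfl⟩
    · rw [Finset.filter_filter]
      congr 1
      exact Finset.filter_congr fun i _ => and_comm
  have h1 := Finset.card_eq_sum_card_fiberwise (hmaps ((Finset.range N).filter fun i => Q (S i)) (Finset.filter_subset _ _))
  have h2 := Finset.card_eq_sum_card_fiberwise
    (hmaps ((Finset.range N).filter fun i => Q (S i) ∧ rank S N blk i % 4 = 3)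
      (Finset.filter_subset _ _))
  rw [cnt, h1, h2]
  simp only [hblock]
  rw [Finset.mul_sum]
  constructor
  · exact Finset.sum_le_sum fun b _ => Nat.mul_div_le _ _
  · have h3 : 3 * (N / blk + 1) = ∑ _b ∈ Finset.range (N / blk + 1), 3 := by simp [mul_comm]
    rw [h3, ← Finset.sum_add_distrib]
    exact Finset.sum_le_sum fun b _ => by omega

/-! ### Error control for repeated sampling -/

/-- `S` is a sample of `L` that is good enough for approximate medians. -/
def Approx (t N blk : ℕ) (L S : ℕ → ℝ) : Prop :=
  ∃ ω E : ℕ, (∀ Q, Down Q → ω * cnt S N Q ≤ cnt L t Q ∧ cnt L t Q ≤ ω * cnt S N Q + E) ∧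
    8 * (E * blk + 12 * t) ≤ t * blk

theorem cnt_true (S : ℕ → ℝ) (N : ℕ) : cnt S N (fun _ => True) = N := by simp [cnt]

/-- With no error yet, block length `96` is the least that meets the error budget for positive `t`.
-/
theorem Approx.init (t : ℕ) (L : ℕ → ℝ) : Approx t t 96 L L :=
  ⟨1, 0, fun Q _ => by simp, by omega⟩

-- A sample entry stands for `ω` original ones. One round adds an error of at most `6 * t / blk`; as
-- `blk` doubles, all later rounds together cost at most `12 * t / blk`. This is the reserve in the
-- budget, which keeps `E` at most `t / 8` throughout.
open Classical in
theorem Approx.step {t N N' blk : ℕ} {L S S' : ℕ → ℝ} (h : Approx t N blk L S) (hb : 0 < blk)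
    (hN : blk < N) (hS : ∀ Q : ℝ → Prop, cnt S' N' Q =
      ((Finset.range N).filter fun i => Q (S i) ∧ rank S N blk i % 4 = 3).card) :
    Approx t N' (2 * blk) L S' ∧ 4 * N' ≤ N := by
  obtain ⟨ω, E, h1, h2⟩ := h
  have hT : Down fun _ => True := fun _ _ _ _ => trivial
  constructor
  · refine ⟨4 * ω, E + ω * (3 * (N / blk + 1)), fun Q hQ => ?_, ?_⟩
    · obtain ⟨h3, h4⟩ := h1 Q hQ
      obtain ⟨h5, h6⟩ := cnt_sample S (N := N) hb hQ
      rw [← hS Q] at h5 h6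
      constructor
      · calc 4 * ω * cnt S' N' Q = ω * (4 * cnt S' N' Q) := by ring
          _ ≤ ω * cnt S N Q := Nat.mul_le_mul_left _ h5
          _ ≤ _ := h3
      · calc cnt L t Q ≤ ω * cnt S N Q + E := h4
          _ ≤ ω * (4 * cnt S' N' Q + 3 * (N / blk + 1)) + E :=
            Nat.add_le_add_right (Nat.mul_le_mul_left _ h6) _
          _ = _ := by ring
    · have h3 : ω * N ≤ t := by simpa [cnt_true] using (h1 _ hT).1
      -- The incomplete last block is affordable because sampling occurs only while `blk < N`.
      have h4 : (N / blk + 1) * blk ≤ 2 * N := by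
        have := Nat.div_mul_le_self N blk
        rw [add_mul]; omega
      have h5 : ω * (3 * (N / blk + 1)) * blk ≤ 6 * t := by
        calc ω * (3 * (N / blk + 1)) * blk = 3 * (ω * ((N / blk + 1) * blk)) := by ring
          _ ≤ 3 * (ω * (2 * N)) := Nat.mul_le_mul_left _ (Nat.mul_le_mul_left _ h4)
          _ = 6 * (ω * N) := by ring
          _ ≤ 6 * t := Nat.mul_le_mul_left _ h3
      nlinarith
  · have := (cnt_sample S (N := N) hb hT).1
    have h3 := hS fun _ => True
    rw [cnt_true] at h3 this
    convert this

/-- An error of at most `t / 8` cannot account for all `t` entries, so the sample is nonempty. -/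
theorem Approx.pos {t N blk : ℕ} {L S : ℕ → ℝ} (h : Approx t N blk L S) (ht : 0 < t)
    (hb : 0 < blk) : 0 < N := by
  obtain ⟨ω, E, h1, h2⟩ := h
  have h3 := (h1 (fun _ => True) fun _ _ _ _ => trivial).2
  rw [cnt_true, cnt_true] at h3
  have h4 : 8 * E ≤ t := by
    by_contra h; push Not at h
    nlinarith
  rcases Nat.eq_zero_or_pos N with rfl | h
  · omega
  · exact h

open Classical in
theorem exists_rank_eq (S : ℕ → ℝ) {N blk c : ℕ} (hb : 0 < blk) (hN : N ≤ blk) (hc : c < N) :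
    ∃ i < N, rank S N blk i = c := by
  have hB : ∀ i < N, (Finset.range N).filter (fun j => j / blk = i / blk) = Finset.range N := by
    intro i hi
    refine Finset.filter_true_of_mem fun j hj => ?_
    rw [Nat.div_eq_of_lt ((Finset.mem_range.1 hj).trans_le hN), Nat.div_eq_of_lt (hi.trans_le hN)]
  have h1 := (image_rank S (Finset.range N) (Q := fun _ => True) fun _ _ _ _ => trivial).1
  have h2 := Finset.ext_iff.1 h1 c
  simp only [Finset.filter_true, Finset.card_range, Finset.mem_range, hc, iff_true] at h2
  obtain ⟨i, hi, hic⟩ := Finset.mem_image.1 h2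
  have hi' : i < N := by simpa using hi
  exact ⟨i, hi', by rw [rank_eq S hb, hB i hi', hic]⟩

-- With `E ≤ t / 8`, position `5 / 8` in the sample gives at least `5 / 8 * (t - E) ≥ t / 2` entries
-- up to the pivot and at most `5 / 8 * t + E ≤ 3 / 4 * t` strictly below it.
open Classical in
theorem Approx.pick {t N blk i : ℕ} {L S : ℕ → ℝ} (h : Approx t N blk L S) (ht : 0 < t)
    (hb : 0 < blk) (hN : N ≤ blk) (hi : i < N) (hr : rank S N blk i = 5 * N / 8) :
    t ≤ 2 * cnt L t (fun x => x ≤ S i) ∧ 4 * cnt L t (fun x => x < S i) ≤ 3 * t := by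
  have hB : (Finset.range N).filter (fun j => j / blk = i / blk) = Finset.range N := by
    refine Finset.filter_true_of_mem fun j hj => ?_
    rw [Nat.div_eq_of_lt ((Finset.mem_range.1 hj).trans_le hN), Nat.div_eq_of_lt (hi.trans_le hN)]
  rw [rank_eq S hb, hB] at hr
  have hle : 5 * N / 8 + 1 ≤ cnt S N fun x => x ≤ S i := by
    rw [← hr, Nat.succ_le_iff]
    refine Finset.card_lt_card ⟨fun l hl => ?_, fun h => ?_⟩
    · rw [Finset.mem_filter] at hl ⊢
      exact ⟨hl.1, hl.2.le⟩
    · have := h (Finset.mem_filter.2 ⟨Finset.mem_range.2 hi, le_refl (S i)⟩)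
      exact Before.irrefl (Finset.mem_filter.1 this).2
  have hlt : cnt S N (fun x => x < S i) ≤ 5 * N / 8 := by
    rw [← hr]
    refine Finset.card_le_card fun l hl => ?_
    rw [Finset.mem_filter] at hl ⊢
    exact ⟨hl.1, Or.inl hl.2⟩
  obtain ⟨ω, E, h1, h2⟩ := h
  have hT := h1 (fun _ => True) fun _ _ _ _ => trivial
  rw [cnt_true, cnt_true] at hT
  have h3 := (h1 (fun x => x ≤ S i) fun x y hxy hy => hxy.trans hy).1
  have h4 := (h1 (fun x => x < S i) fun x y hxy hy => hxy.trans_lt hy).2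
  have hE : 8 * E ≤ t := by
    by_contra h; push Not at h
    nlinarith
  have h5 : 5 * (ω * N) ≤ 8 * (ω * cnt S N fun x => x ≤ S i) := by
    calc 5 * (ω * N) = ω * (5 * N) := by ring
      _ ≤ ω * (8 * cnt S N fun x => x ≤ S i) := Nat.mul_le_mul_left _ (by omega)
      _ = _ := by ring
  have h6 : 8 * (ω * cnt S N fun x => x < S i) ≤ 5 * (ω * N) := by
    calc 8 * (ω * cnt S N fun x => x < S i) = ω * (8 * cnt S N fun x => x < S i) := by ring
      _ ≤ ω * (5 * N) := Nat.mul_le_mul_left _ (by omega)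
      _ = _ := by ring
  constructor <;> omega

theorem cnt_succ (S : ℕ → ℝ) (N : ℕ) (Q : ℝ → Prop) [Decidable (Q (S N))] :
    cnt S (N + 1) Q = cnt S N Q + if Q (S N) then 1 else 0 := by
  classical
  rw [cnt, cnt, Finset.range_add_one, Finset.filter_insert]
  split_ifs with h
  · rw [Finset.card_insert_of_notMem (by simp)]
  · rfl

theorem cnt_congr {S S' : ℕ → ℝ} {N : ℕ} {Q : ℝ → Prop} (h : ∀ i < N, S i = S' i) :
    cnt S N Q = cnt S' N Q := by
  classical
  rw [cnt, cnt]
  congr 1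
  refine Finset.filter_congr fun i hi => ?_
  rw [h i (Finset.mem_range.1 hi)]

end Selection

/-! ### Approximate ranks in quadratic time

The scalar word variables are `0` (the number `n` of points), `1` (the current point), `4` (number
`t` of active points), `5`, `6`, `7` (length, start, and block length of the current sample),
`8` and `9` (counters), `10` and `11` (temporary), `12` (number of active points that are not
farther than the pivot). Word array `2` is the rank matrix and word array `3` lists the active
points. Real array `3` holds squared distances, real array `4` the samples, and real variable `5`
the pivot. -/

namespace RealRAM

open Selection

variable {W : ℕ}

/-- Count the entries of the sample that are before entry `i` in its block. -/
def rankProg : Prog :=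
  .setV 10 (.const 0) ;;
  .forTo 9 (.var 7)
    (.ite (.and (.wlt (.add (.mul (.div (.var 8) (.var 7)) (.var 7)) (.var 9)) (.var 5))
        (.and (.rle (.load 4 (.add (.var 6) (.add (.mul (.div (.var 8) (.var 7)) (.var 7))
            (.var 9)))) (.load 4 (.add (.var 6) (.var 8))))
          (.neg (.and (.rle (.load 4 (.add (.var 6) (.var 8))) (.load 4 (.add (.var 6)
            (.add (.mul (.div (.var 8) (.var 7)) (.var 7)) (.var 9)))))
            (.wle (.var 8) (.add (.mul (.div (.var 8) (.var 7)) (.var 7)) (.var 9)))))))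
      (.setV 10 (.add (.var 10) (.const 1))) .skip)

/-- Expresses the tie-breaking order by the comparisons `≤` that the machine offers. -/
theorem before_iff {S : ℕ → ℝ} {j i : ℕ} :
    Before S j i ↔ S j ≤ S i ∧ ¬ (S i ≤ S j ∧ i ≤ j) := by
  unfold Before
  constructor
  · rintro (h | ⟨h, h'⟩)
    · exact ⟨h.le, fun h' => absurd h'.1 (not_le.2 h)⟩
    · exact ⟨h.le, fun h'' => absurd h''.2 (not_le.2 h')⟩
  · rintro ⟨h, h'⟩
    rcases h.lt_or_eq with h1 | h1
    · exact Or.inl h1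
    · refine Or.inr ⟨h1, ?_⟩
      by_contra h2
      exact h' ⟨h1.ge, not_lt.1 h2⟩

theorem run_rankProg {σ : Store} (hW : σ.word 7 0 < W) :
    Run W rankProg σ fun M τ => M ≤ σ.word 7 0 ∧
      τ.word 10 0 = rank (fun l => σ.real 4 (σ.word 6 0 + l)) (σ.word 5 0) (σ.word 7 0)
        (σ.word 8 0) := by
  classical
  set S := fun l => σ.real 4 (σ.word 6 0 + l) with hS
  set b := σ.word 8 0 / σ.word 7 0 * σ.word 7 0 with hb
  refine Run.seq (Run.setW (by simp [WExp.eval]; omega) ?_)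
  refine Run.forTo (σ.word 7 0) 0 (fun m τ => τ.word 10 0 = ((Finset.range m).filter fun j =>
    b + j < σ.word 5 0 ∧ Before S (b + j) (σ.word 8 0)).card) (by decide) ?_ hW ?_ ?_ ?_
  · intro τ hs
    simp [WExp.eval, hs.1 7 (by decide), Store.setWord_word]
  · simp [Store.setWord_word, WExp.eval]
  · intro j hj τ hs hj' hI
    have h5 := hs.1 5 (by decide)
    have h6 := hs.1 6 (by decide)
    have h7 := hs.1 7 (by decide)
    have h8 := hs.1 8 (by decide)
    have h4 := hs.2 4 (by decide)
    simp [Store.setWord_word_of_ne] at h5 h6 h7 h8 h4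
    have hle : τ.word 10 0 ≤ j := by
      rw [hI]; exact (Finset.card_filter_le _ _).trans (by simp)
    have hiff : (b + j < σ.word 5 0 ∧ Before S (b + j) (σ.word 8 0)) ↔ _ :=
      and_congr_right fun _ => before_iff
    refine Run.ite ?_ ?_
    · intro hc
      simp only [BExp.Holds, RExp.eval, WExp.eval, h5, h6, h7, h8, h4, hj', ← hb, not_le] at hc
      refine Run.setW (by simp [WExp.eval]; omega) ⟨le_rfl, ?_⟩
      rw [Finset.range_add_one, Finset.filter_insert, if_pos (hiff.2 hc),
        Finset.card_insert_of_notMem (by simp)]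
      simp [WExp.eval, Store.setWord_word, hI]
    · intro hc
      simp only [BExp.Holds, RExp.eval, WExp.eval, h5, h6, h7, h8, h4, hj', ← hb, not_le] at hc
      refine Run.skip ⟨le_rfl, ?_⟩
      rw [Finset.range_add_one, Finset.filter_insert, if_neg (fun h => hc (hiff.1 h))]
      simp [Store.setWord_word, hI]
  · intro M τ hM hs _ hI
    refine ⟨by omega, ?_⟩
    rw [hI, rank]

/-- Replace the sample by every fourth entry of each of its blocks, and double the block length. -/
def sampleProg : Prog :=
  .setV 11 (.const 0) ;;
  .forTo 8 (.var 5) (rankProg ;;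
    .ite (.weq (.mod (.var 10) (.const 4)) (.const 3))
      (.setR 4 (.add (.add (.var 6) (.var 5)) (.var 11)) (.load 4 (.add (.var 6) (.var 8))) ;;
        .setV 11 (.add (.var 11) (.const 1))) .skip) ;;
  .setV 6 (.add (.var 6) (.var 5)) ;;
  .setV 5 (.var 11) ;;
  .setV 7 (.mul (.const 2) (.var 7))

/-- The current sample. -/
def sample (σ : Store) (l : ℕ) : ℝ := σ.real 4 (σ.word 6 0 + l)

-- The new sample is written directly behind the old one, so entries still needed for later ranks
-- are not disturbed.
open Classical in
theorem run_sampleProg {σ : Store} (h7 : 2 * σ.word 7 0 < W)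
    (h5 : σ.word 6 0 + σ.word 5 0 < W) :
    Run W sampleProg σ fun M τ => M ≤ σ.word 5 0 * (σ.word 7 0 + 1) ∧
      τ.word 7 0 = 2 * σ.word 7 0 ∧ τ.word 6 0 = σ.word 6 0 + σ.word 5 0 ∧
      ∀ Q : ℝ → Prop, cnt (sample τ) (τ.word 5 0) Q =
        ((Finset.range (σ.word 5 0)).filter fun i => Q (sample σ i) ∧
          rank (sample σ) (σ.word 5 0) (σ.word 7 0) i % 4 = 3).card := by
  refine Run.seq (Run.setW (by simp [WExp.eval]; omega) (Run.seq ?_))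
  refine Run.forTo (σ.word 5 0) (σ.word 7 0) (fun m τ => τ.word 11 0 ≤ m ∧
    (∀ l < σ.word 5 0, τ.real 4 (σ.word 6 0 + l) = sample σ l) ∧
    ∀ Q : ℝ → Prop, cnt (fun l => τ.real 4 (σ.word 6 0 + σ.word 5 0 + l)) (τ.word 11 0) Q =
        ((Finset.range m).filter fun i => Q (sample σ i) ∧
          rank (sample σ) (σ.word 5 0) (σ.word 7 0) i % 4 = 3).card)
    (by decide) ?_ (by omega) ?_ ?_ ?_
  · intro τ hs
    simp [WExp.eval, hs.1 5 (by decide), Store.setWord_word]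
  · refine ⟨by simp [Store.setWord_word, WExp.eval], fun l _ => rfl, fun Q => ?_⟩
    simp only [Store.setWord_word, WExp.eval, Finset.range_zero, Finset.filter_empty,
      Finset.card_empty]
    simp [cnt]
  · rintro j hj τ hs hj' ⟨hI1, hI2, hI3⟩
    have h5' := hs.1 5 (by decide)
    have h6' := hs.1 6 (by decide)
    have h7' := hs.1 7 (by decide)
    simp [Store.setWord_word_of_ne] at h5' h6' h7'
    refine Run.seq ((run_rankProg (by rw [h7']; omega)).frame ?_)
    rintro M υ hυ ⟨hM, hr⟩
    have g5 := hυ.1 5 (by decide)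
    have g6 := hυ.1 6 (by decide)
    have g8 := hυ.1 8 (by decide)
    have g11 := hυ.1 11 (by decide)
    have g4 := hυ.2 4 (by decide)
    have hr' : υ.word 10 0 = rank (sample σ) (σ.word 5 0) (σ.word 7 0) j := by
      rw [hr, h5', h6', h7', hj', rank, rank]
      congr 1
      refine Finset.filter_congr fun l _ => and_congr_right fun hl => ?_
      simp only [Before, hI2 _ hl, hI2 _ hj]
    rw [h7'] at hM
    refine Run.ite ?_ ?_
    · intro hc
      have hc' : rank (sample σ) (σ.word 5 0) (σ.word 7 0) j % 4 = 3 := by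
        simp only [BExp.Holds, WExp.eval, hr'] at hc
        omega
      refine Run.seq (Run.setR (Run.setW (by simp [WExp.eval, g11]; omega) ⟨by simpa using hM, ?_⟩))
      simp only [WExp.eval, RExp.eval, Store.setWord_word, Store.setReal_word, Store.setWord_real,
        g5, g6, g8, g11, g4, h5', h6', hj', if_true, Store.setReal_real]
      refine ⟨by simpa using hI1, fun l hl => ?_, fun Q => ?_⟩
      · rw [if_neg (by omega), hI2 l hl]
      · simp only [(by decide : (11 : ℕ) = 8 ↔ False), if_false]
        rw [Finset.range_add_one, Finset.filter_insert, cnt_succ, cnt_congr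
          (S' := fun l => τ.real 4 (σ.word 6 0 + σ.word 5 0 + l)), hI3 Q]
        · simp only [if_true, hI2 j hj, hc', and_true]
          split_ifs
          · rw [Finset.card_insert_of_notMem (by simp)]
          · rfl
        · intro i hi
          rw [if_neg (by omega)]
    · intro hc
      have hc' : ¬ rank (sample σ) (σ.word 5 0) (σ.word 7 0) j % 4 = 3 := by
        simp only [BExp.Holds, WExp.eval, hr'] at hc
        omega
      refine Run.skip ⟨by simpa using hM, ?_⟩
      simp only [Store.setWord_word, Store.setWord_real, g4, g11,
        (by decide : (11 : ℕ) = 8 ↔ False), if_false]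
      refine ⟨by omega, hI2, fun Q => ?_⟩
      rw [Finset.range_add_one, Finset.filter_insert, if_neg (fun h => hc' h.2), hI3 Q]
  · rintro M τ hM hs - ⟨hI1, hI2, hI3⟩
    have h5' := hs.1 5 (by decide)
    have h6' := hs.1 6 (by decide)
    have h7' := hs.1 7 (by decide)
    simp [Store.setWord_word_of_ne] at h5' h6' h7'
    refine Run.seq (Run.setW (by simpa [WExp.eval, h5', h6'] using h5) ?_)
    refine Run.seq (Run.setW (by simp [WExp.eval, Store.setWord_word]; omega) ?_)
    refine Run.setW (by simpa [WExp.eval, Store.setWord_word, h7'] using h7) ?_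
    simp only [WExp.eval, Store.setWord_word, h5', h6', h7']
    simp only [if_true, Nat.reduceEqDiff, if_false, true_and]
    refine ⟨by simpa using hM, fun Q => (cnt_congr fun l _ => ?_).trans (hI3 Q)⟩
    simp [sample, Store.setWord_word]

end RealRAM

/-! ### Choosing the pivot -/

namespace RealRAM

open Selection

variable {W : ℕ}

/-- Set the pivot to the entry of the current sample at five eighths of its length. -/
def pickProg : Prog :=
  .forTo 8 (.var 5) (rankProg ;;
    .ite (.weq (.var 10) (.div (.mul (.const 5) (.var 5)) (.const 8)))
      (.setR 5 (.const 0) (.load 4 (.add (.var 6) (.var 8)))) .skip)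

/-- The existence of an entry of the desired rank is left as a premise; `exists_rank_eq` supplies it
once a single block remains. -/
theorem run_pickProg {σ : Store} (h7 : σ.word 7 0 < W) (h5 : σ.word 5 0 < W) :
    Run W pickProg σ fun M τ => M ≤ σ.word 5 0 * (σ.word 7 0 + 1) ∧
      ∀ i < σ.word 5 0, rank (sample σ) (σ.word 5 0) (σ.word 7 0) i = 5 * σ.word 5 0 / 8 →
        ∃ i < σ.word 5 0, rank (sample σ) (σ.word 5 0) (σ.word 7 0) i = 5 * σ.word 5 0 / 8 ∧
          τ.real 5 0 = sample σ i := by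
  refine Run.forTo (σ.word 5 0) (σ.word 7 0) (fun m τ =>
      ∀ i < m, rank (sample σ) (σ.word 5 0) (σ.word 7 0) i = 5 * σ.word 5 0 / 8 →
        ∃ i < m, rank (sample σ) (σ.word 5 0) (σ.word 7 0) i = 5 * σ.word 5 0 / 8 ∧
          τ.real 5 0 = sample σ i) (by decide) ?_ h5 ?_ ?_ ?_
  · intro τ hs
    simp [WExp.eval, hs.1 5 (by decide)]
  · simp
  · rintro j hj τ hs hj' hI
    have h5' := hs.1 5 (by decide)
    have h6' := hs.1 6 (by decide)
    have h7' := hs.1 7 (by decide)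
    have h4' := hs.2 4 (by decide)
    refine Run.seq ((run_rankProg (by rw [h7']; omega)).frame ?_)
    rintro M υ hυ ⟨hM, hr⟩
    have g5 := hυ.1 5 (by decide)
    have g6 := hυ.1 6 (by decide)
    have g8 := hυ.1 8 (by decide)
    have g4 := hυ.2 4 (by decide)
    have r5 := hυ.2 5 (by decide)
    have hr' : υ.word 10 0 = rank (sample σ) (σ.word 5 0) (σ.word 7 0) j := by
      rw [hr, h5', h6', h7', hj', h4']; rfl
    rw [h7'] at hM
    refine Run.ite ?_ ?_
    · intro hc
      simp only [BExp.Holds, WExp.eval, hr', g5, h5', ← le_antisymm_iff] at hc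
      refine Run.setR ⟨by simpa using hM, fun _ _ _ => ⟨j, by omega, hc, ?_⟩⟩
      simp [WExp.eval, RExp.eval, Store.setReal_real, g4, g6, g8, h4', h6', hj', sample]
    · intro hc
      simp only [BExp.Holds, WExp.eval, hr', g5, h5', ← le_antisymm_iff] at hc
      refine Run.skip ⟨by simpa using hM, fun i hi hri => ?_⟩
      have hij : i < j := by
        rcases Nat.lt_succ_iff_lt_or_eq.1 hi with h | rfl
        · exact h
        · exact absurd hri hc
      obtain ⟨l, hl, hl', hl''⟩ := hI i hij hri
      exact ⟨l, by omega, hl', by rw [← hl'', Store.setWord_real, r5]⟩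
  · rintro M τ hM hs - hI
    exact ⟨hM, hI⟩

/-- Find an approximate median of the squared distances of the active points. -/
def pivotProg : Prog :=
  .forTo 8 (.var 4) (.setR 4 (.var 8) (.load 3 (.load 3 (.var 8)))) ;;
  .setV 5 (.var 4) ;;
  .setV 6 (.const 0) ;;
  .setV 7 (.const 96) ;;
  .loop (.wlt (.var 7) (.var 5)) sampleProg ;;
  pickProg

/-- The squared distances of the active points. -/
def active (σ : Store) (i : ℕ) : ℝ := σ.real 3 (σ.word 3 i)

/-- Each round divides the length by at least four and doubles the block length, so the product of
the two, which measures the cost of brute-force ranking, at least halves. Copying costs `t`, the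
rounds at most `4 * 96 * t`, and the final selection at most `97 * t` iterations. -/
theorem run_pivotProg {σ : Store} (h0 : 0 < σ.word 4 0) (hW : 4 * σ.word 4 0 + 200 ≤ W) :
    Run W pivotProg σ fun M τ => M ≤ 500 * σ.word 4 0 ∧
      σ.word 4 0 ≤ 2 * cnt (active σ) (σ.word 4 0) (fun x => x ≤ τ.real 5 0) ∧
      4 * cnt (active σ) (σ.word 4 0) (fun x => x < τ.real 5 0) ≤ 3 * σ.word 4 0 := by
  set t := σ.word 4 0 with ht
  refine Run.seq (Run.forTo t 0 (fun m τ => ∀ i < m, τ.real 4 i = active σ i)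
    (by decide) ?_ (by omega) ?_ ?_ ?_)
  · intro τ hs
    simp [WExp.eval, hs.1 4 (by decide), ht]
  · simp
  · intro j hj τ hs hj' hI
    refine Run.setR ⟨le_rfl, fun i hi => ?_⟩
    simp only [WExp.eval, RExp.eval, Store.setWord_real, Store.setReal_real, if_true, hj']
    split_ifs with hij
    · rw [hij, active, hs.2 3 (by decide), hs.1 3 (by decide)]
    · exact hI i (by omega)
  · intro M₁ τ₁ hM₁ hs₁ _ hI₁
    have h4 := hs₁.1 4 (by decide)
    refine Run.seq (Run.setW (by simp [WExp.eval, h4]; omega) ?_)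
    refine Run.seq (Run.setW (by simp [WExp.eval]; omega) ?_)
    refine Run.seq (Run.setW (by simp [WExp.eval]; omega) ?_)
    -- The bound on start plus twice the length survives because the start advances by the old
    -- length and the new length is at most a quarter of it. The block length is doubled only while
    -- it is below `t`. Both keep the stored words small.
    refine Run.seq (Run.loop (fun τ => Approx t (τ.word 5 0) (τ.word 7 0) (active σ) (sample τ) ∧
      τ.word 5 0 * τ.word 7 0 ≤ 96 * t ∧ τ.word 6 0 + 2 * τ.word 5 0 ≤ 2 * t ∧
      96 ≤ τ.word 7 0 ∧ τ.word 7 0 ≤ 96 + 2 * t ∧ τ.word 5 0 ≤ t)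
      (fun τ => 4 * (τ.word 5 0 * τ.word 7 0)) ?_ ?_ ?_)
    · simp only [WExp.eval, Store.setWord_word, h4]
      simp only [if_true, Nat.reduceEqDiff, if_false]
      refine ⟨?_, by omega, by omega, by omega, by omega, by omega⟩
      have := Approx.init t (active σ)
      obtain ⟨ω, E, h1, h2⟩ := this
      refine ⟨ω, E, fun Q hQ => ?_, h2⟩
      rw [cnt_congr (S := sample _) (S' := active σ)]
      · exact h1 Q hQ
      · intro i hi
        simpa [sample, Store.setWord_word] using hI₁ i hi
    · rintro τ - ⟨hA, hN, hst, hb, hb', ht'⟩ hc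
      have hlt : τ.word 7 0 < τ.word 5 0 := by simpa [BExp.Holds, WExp.eval] using hc
      refine (run_sampleProg (by omega) (by omega)).mono ?_
      rintro M υ ⟨hM, g7, g6, hQ⟩
      obtain ⟨hA', h4N⟩ := hA.step (by omega) hlt hQ
      rw [g7, g6]
      have h8 : 4 * (υ.word 5 0 * (2 * τ.word 7 0)) ≤ 2 * (τ.word 5 0 * τ.word 7 0) := by
        calc 4 * (υ.word 5 0 * (2 * τ.word 7 0)) = 2 * ((4 * υ.word 5 0) * τ.word 7 0) := by ring
          _ ≤ _ := Nat.mul_le_mul_left _ (Nat.mul_le_mul_right _ h4N)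
      have h9 : τ.word 5 0 * 96 ≤ τ.word 5 0 * τ.word 7 0 := Nat.mul_le_mul_left _ hb
      rw [mul_add, mul_one] at hM
      exact ⟨⟨hA', by omega, by omega, by omega, by omega, by omega⟩, by omega⟩
    · rintro M₂ τ hM₂ hs₂ ⟨hA, hN, hst, hb, hb', ht'⟩ hc
      have hle : τ.word 5 0 ≤ τ.word 7 0 := by simpa [BExp.Holds, WExp.eval] using hc
      simp only [WExp.eval, Store.setWord_word, h4] at hM₂
      simp only [if_true, Nat.reduceEqDiff, if_false] at hM₂
      have hNpos := hA.pos h0 (by omega)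
      refine (run_pickProg (by omega) (by omega)).mono ?_
      rintro M₃ υ ⟨hM₃, hυ⟩
      obtain ⟨i, hi, hri⟩ := exists_rank_eq (sample τ) (N := τ.word 5 0) (blk := τ.word 7 0)
        (c := 5 * τ.word 5 0 / 8) (by omega) hle (by omega)
      obtain ⟨l, hl, hrl, hυl⟩ := hυ i hi hri
      rw [mul_add, mul_one] at hM₃
      rw [hυl]
      exact ⟨by omega, hA.pick h0 (by omega) hle hl hrl⟩

end RealRAM

/-! ### From pivots to approximate ranks -/

namespace Selection

/-- `V` approximates the rank of `q` in the order of the distances `D`. -/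
def GoodRank (D : ℕ → ℝ) (n q V : ℕ) : Prop :=
  cnt D n (fun x => x ≤ D q) ≤ V ∧ V + 2 ≤ 2 * cnt D n (fun x => x ≤ D q) ∧ V ≤ n

/-- `act` lists the `t` smallest indices without repetition. -/
structure Lists (D : ℕ → ℝ) (n t : ℕ) (act : ℕ → ℕ) : Prop where
  lt : ∀ i < t, act i < n
  inj : ∀ i < t, ∀ j < t, act i = act j → i = j
  down : ∀ i < t, ∀ q < n, D q ≤ D (act i) → ∃ j < t, act j = q

theorem Lists.card_le {D : ℕ → ℝ} {n t : ℕ} {act : ℕ → ℕ} (h : Lists D n t act) : t ≤ n := by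
  have := Finset.card_le_card_of_injOn (s := Finset.range t) (t := Finset.range n) act
    (fun i hi => by simpa using h.lt i (by simpa using hi))
    (fun i hi j hj hij => h.inj i (by simpa using hi) j (by simpa using hj) hij)
  simpa using this

/-- Active points are closed under taking nearer ones, so the rank among them is the rank among all
points. -/
theorem Lists.cnt_eq {D : ℕ → ℝ} {n t : ℕ} {act : ℕ → ℕ} (h : Lists D n t act) {i : ℕ}
    (hi : i < t) : cnt D n (fun x => x ≤ D (act i)) =
      cnt (fun j => D (act j)) t (fun x => x ≤ D (act i)) := by
  classical
  symm
  refine Finset.card_bij (fun j _ => act j) ?_ ?_ ?_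
  · intro j hj
    simp only [Finset.mem_filter, Finset.mem_range] at hj ⊢
    exact ⟨h.lt j hj.1, hj.2⟩
  · intro j hj l hl hjl
    simp only [Finset.mem_filter, Finset.mem_range] at hj hl
    exact h.inj j hj.1 l hl.1 hjl
  · intro q hq
    simp only [Finset.mem_filter, Finset.mem_range] at hq
    obtain ⟨j, hj, hjq⟩ := h.down i hi q hq.1 hq.2
    refine ⟨j, ?_, hjq⟩
    simp only [Finset.mem_filter, Finset.mem_range]
    exact ⟨hj, by rw [hjq]; exact hq.2⟩

/-- A point beyond the pivot has rank above half of `t`, so the value `t` is at most twice its rank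
minus two. A point level with the pivot gets its exact rank, which is at least two because `p`
itself is counted too. -/
theorem Lists.goodRank {D : ℕ → ℝ} {n t p : ℕ} {act : ℕ → ℕ} (h : Lists D n t act) {i : ℕ}
    (hi : i < t) (hp : p < n) (hpi : act i ≠ p) (hD : ∀ q, D p ≤ D q) {v : ℝ}
    (hv : t ≤ 2 * cnt (fun j => D (act j)) t (fun x => x ≤ v)) (hvi : v ≤ D (act i)) :
    GoodRank D n (act i) (if D (act i) ≤ v then cnt (fun j => D (act j)) t (fun x => x ≤ v)
      else t) := by
  classical
  have h1 := h.cnt_eq hi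
  have h2 : 2 ≤ cnt D n (fun x => x ≤ D (act i)) := by
    rw [cnt, ← Finset.card_pair hpi]
    refine Finset.card_le_card fun z hz => ?_
    simp only [Finset.mem_insert, Finset.mem_singleton] at hz
    simp only [Finset.mem_filter, Finset.mem_range]
    rcases hz with rfl | rfl
    · exact ⟨h.lt i hi, le_rfl⟩
    · exact ⟨hp, hD _⟩
  have h3 : cnt D n (fun x => x ≤ D (act i)) ≤ t := by
    rw [h1]
    exact (Finset.card_filter_le _ _).trans (by simp)
  have h4 := h.card_le
  unfold GoodRank
  split_ifs with hc
  · have h5 : D (act i) = v := le_antisymm hc hvi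
    rw [h5] at h1 h2 h3 ⊢
    rw [← h1]
    omega
  · have h5 : cnt (fun j => D (act j)) t (fun x => x ≤ v) + 1 ≤
        cnt D n (fun x => x ≤ D (act i)) := by
      rw [h1]
      refine Finset.card_lt_card ⟨fun l hl => ?_, fun hh => ?_⟩
      · simp only [Finset.mem_filter] at hl ⊢
        exact ⟨hl.1, hl.2.trans hvi⟩
      · have := hh (Finset.mem_filter.2 ⟨Finset.mem_range.2 hi, le_refl (D (act i))⟩)
        exact hc (Finset.mem_filter.1 this).2
    omega

end Selection

/-! ### Partition at the pivot -/

namespace RealRAM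

open Selection

variable {W : ℕ}

/-- Assign ranks to the active points that are not nearer than the pivot, and deactivate them. -/
def partitionProg : Prog :=
  .setV 12 (.const 0) ;;
  .forTo 8 (.var 4) (.ite (.rle (.load 3 (.load 3 (.var 8))) (.var 5))
    (.setV 12 (.add (.var 12) (.const 1))) .skip) ;;
  .setV 11 (.const 0) ;;
  .forTo 8 (.var 4) (.ite (.rle (.var 5) (.load 3 (.load 3 (.var 8))))
    (.ite (.rle (.load 3 (.load 3 (.var 8))) (.var 5))
      (.setW 2 (.add (.mul (.var 1) (.var 0)) (.load 3 (.var 8))) (.var 12))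
      (.setW 2 (.add (.mul (.var 1) (.var 0)) (.load 3 (.var 8))) (.var 4)))
    (.setW 3 (.var 11) (.load 3 (.var 8)) ;; .setV 11 (.add (.var 11) (.const 1)))) ;;
  .setV 4 (.var 11)

/-- The invariant of the second loop of `partitionProg` after `m` iterations. -/
def PartitionInv (σ : Store) (n t p : ℕ) (v : ℝ) (m : ℕ) (τ : Store) : Prop :=
  τ.word 11 0 = cnt (active σ) m (fun x => x < v) ∧
  (∀ i < t, m ≤ i → τ.word 3 i = σ.word 3 i) ∧
  (∀ o < τ.word 11 0, ∃ i < m, τ.word 3 o = σ.word 3 i ∧ active σ i < v) ∧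
  (∀ i < m, active σ i < v → ∃ o < τ.word 11 0, τ.word 3 o = σ.word 3 i) ∧
  (∀ i < τ.word 11 0, ∀ j < τ.word 11 0, τ.word 3 i = τ.word 3 j → i = j) ∧
  (∀ i < m, v ≤ active σ i → τ.word 2 (p * n + σ.word 3 i) =
    if active σ i ≤ v then cnt (active σ) t (fun x => x ≤ v) else t) ∧
  ∀ x, (∀ i < m, v ≤ active σ i → x ≠ p * n + σ.word 3 i) → τ.word 2 x = σ.word 2 x

/-- The list is compacted in place: the write position is the number of points kept so far, so it
never passes the read position. -/
theorem run_partitionProg {σ : Store} {n t p : ℕ} {v : ℝ} (hn : σ.word 0 0 = n)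
    (ht : σ.word 4 0 = t) (hp : σ.word 1 0 = p) (hv : σ.real 5 0 = v)
    (hlt : ∀ i < t, σ.word 3 i < n)
    (hinj : ∀ i < t, ∀ j < t, σ.word 3 i = σ.word 3 j → i = j) (htn : t ≤ n) (hW : n < W) :
    Run W partitionProg σ fun M τ => M ≤ 2 * t ∧
      τ.word 4 0 = cnt (active σ) t (fun x => x < v) ∧
      (∀ o < τ.word 4 0, ∃ i < t, τ.word 3 o = σ.word 3 i ∧ active σ i < v) ∧
      (∀ i < t, active σ i < v → ∃ o < τ.word 4 0, τ.word 3 o = σ.word 3 i) ∧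
      (∀ i < τ.word 4 0, ∀ j < τ.word 4 0, τ.word 3 i = τ.word 3 j → i = j) ∧
      (∀ i < t, v ≤ active σ i → τ.word 2 (p * n + σ.word 3 i) =
        if active σ i ≤ v then cnt (active σ) t (fun x => x ≤ v) else t) ∧
      ∀ x, (∀ i < t, v ≤ active σ i → x ≠ p * n + σ.word 3 i) → τ.word 2 x = σ.word 2 x := by
  classical
  have hcnt : ∀ Q m, cnt (active σ) m Q ≤ m := fun Q m =>
    (Finset.card_filter_le _ _).trans (by simp)
  refine Run.seq (Run.setW (by simp [WExp.eval]; omega) (Run.seq ?_))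
  refine Run.forTo t 0 (fun m τ => τ.word 12 0 = cnt (active σ) m (fun x => x ≤ v))
    (by decide) ?_ (by omega) ?_ ?_ ?_
  · intro τ hs
    simp [WExp.eval, hs.1 4 (by decide), Store.setWord_word, ht]
  · simp [Store.setWord_word, WExp.eval, cnt]
  · intro j hj τ hs hj' hI
    have h3 := hs.2 3 (by decide)
    have h5 := hs.2 5 (by decide)
    have h3' := hs.1 3 (by decide)
    simp [Store.setWord_word_of_ne] at h3 h5 h3'
    have := hcnt (fun x => x ≤ v) j
    refine Run.ite ?_ ?_
    · intro hc
      simp only [BExp.Holds, RExp.eval, WExp.eval, hj', h3, h5, h3', hv] at hc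
      refine Run.setW (by simp [WExp.eval]; omega) ⟨le_rfl, ?_⟩
      rw [cnt_succ, if_pos (by exact hc)]
      simp [WExp.eval, Store.setWord_word, hI]
    · intro hc
      simp only [BExp.Holds, RExp.eval, WExp.eval, hj', h3, h5, h3', hv] at hc
      refine Run.skip ⟨le_rfl, ?_⟩
      rw [cnt_succ, if_neg (by exact hc)]
      simp [Store.setWord_word, hI]
  intro M₁ τ₁ hM₁ hs₁ _ hI₁
  refine Run.seq (Run.setW (by simp [WExp.eval]; omega) (Run.seq ?_))
  have e0 := hs₁.1 0 (by decide)
  have e1 := hs₁.1 1 (by decide)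
  have e2 := hs₁.1 2 (by decide)
  have e3 := hs₁.1 3 (by decide)
  have e4 := hs₁.1 4 (by decide)
  have f3 := hs₁.2 3 (by decide)
  have f5 := hs₁.2 5 (by decide)
  simp [Store.setWord_word_of_ne] at e0 e1 e2 e3 e4 f3 f5
  refine Run.forTo t 0 (PartitionInv σ n t p v)
    (by decide) ?_ (by omega) ?_ ?_ ?_
  · intro τ hs
    have h4 := hs.1 4 (by decide)
    simp [Store.setWord_word_of_ne] at h4
    simp [WExp.eval, h4, e4, ht]
  · simp [PartitionInv, Store.setWord_word, WExp.eval, cnt, e2, e3]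
  · rintro j hj τ hs hj' ⟨h1, h2, h3, h4, h5, h6, h7⟩
    have g0 := hs.1 0 (by decide)
    have g1 := hs.1 1 (by decide)
    have g4 := hs.1 4 (by decide)
    have g12 := hs.1 12 (by decide)
    have k3 := hs.2 3 (by decide)
    have k5 := hs.2 5 (by decide)
    simp [Store.setWord_word_of_ne] at g0 g1 g4 g12 k3 k5
    have hD : τ.real 3 (τ.word 3 (τ.word 8 0)) = active σ j := by
      rw [hj', h2 j hj le_rfl, k3, f3, active]
    have hv' : τ.real 5 0 = v := by rw [k5, f5, hv]
    have hidx : τ.word 1 0 * τ.word 0 0 + τ.word 3 (τ.word 8 0) = p * n + σ.word 3 j := by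
      rw [hj', h2 j hj le_rfl, g1, g0, e1, e0, hp, hn]
    have hjc := hcnt (fun x => x < v) j
    -- Common to points level with the pivot and points beyond it; only the written value differs.
    have key : ∀ z, v ≤ active σ j →
        z = (if active σ j ≤ v then cnt (active σ) t (fun x => x ≤ v) else t) → z < W →
        ∀ e : WExp, e.eval τ = z →
        Run W (.setW 2 (.add (.mul (.var 1) (.var 0)) (.load 3 (.var 8))) e) τ fun M υ =>
          M ≤ 0 ∧ PartitionInv σ n t p v (j + 1) (υ.setWord 8 0 (j + 1)) := by
      intro z hvj hz hzW e he
      refine Run.setW (by rw [he]; exact hzW) ⟨le_rfl, ?_⟩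
      simp only [WExp.eval, hidx, he]
      simp only [PartitionInv, Store.setWord_word, Nat.reduceEqDiff, if_false, if_true]
      refine ⟨by rw [h1, cnt_succ, if_neg (not_lt.2 hvj), add_zero], fun i hi hji => h2 i hi
        (by omega), fun o ho => ?_, fun i hi hiv => ?_, h5, fun i hi hvi => ?_, fun x hx => ?_⟩
      · obtain ⟨i, hi, hi'⟩ := h3 o ho
        exact ⟨i, by omega, hi'⟩
      · rcases Nat.lt_succ_iff_lt_or_eq.1 hi with h | rfl
        · exact h4 i h hiv
        · exact absurd hiv (not_lt.2 hvj)
      · split_ifs with h8 h9 h9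
        · have : i = j := hinj i (by omega) j hj (by omega)
          subst this
          rw [hz, if_pos h9]
        · have : i = j := hinj i (by omega) j hj (by omega)
          subst this
          rw [hz, if_neg h9]
        · rw [h6 i (by rcases Nat.lt_succ_iff_lt_or_eq.1 hi with h | rfl; exacts [h, absurd rfl h8])
            hvi, if_pos h9]
        · rw [h6 i (by rcases Nat.lt_succ_iff_lt_or_eq.1 hi with h | rfl; exacts [h, absurd rfl h8])
            hvi, if_neg h9]
      · rw [if_neg (hx j (by omega) hvj)]
        exact h7 x fun i hi => hx i (by omega)
    refine Run.ite ?_ ?_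
    · intro hc
      simp only [BExp.Holds, RExp.eval, WExp.eval, hD, hv'] at hc
      refine Run.ite ?_ ?_
      · intro hc'
        simp only [BExp.Holds, RExp.eval, WExp.eval, hD, hv'] at hc'
        have := hcnt (fun x => x ≤ v) t
        exact key (cnt (active σ) t (fun x => x ≤ v)) hc (by rw [if_pos hc']) (by omega) _
          (by simp [WExp.eval, g12, hI₁])
      · intro hc'
        simp only [BExp.Holds, RExp.eval, WExp.eval, hD, hv'] at hc'
        exact key t hc (by rw [if_neg hc']) (by omega) _ (by simp [WExp.eval, g4, e4, ht])
    · intro hc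
      simp only [BExp.Holds, RExp.eval, WExp.eval, hD, hv', not_le] at hc
      have hact : τ.word 3 j = σ.word 3 j := h2 j hj le_rfl
      have hjn := hlt j hj
      refine Run.seq (Run.setW (by simp [WExp.eval, hj', hact]; omega)
        (Run.setW (by simp [WExp.eval, Store.setWord_word]; omega) ⟨le_rfl, ?_⟩))
      simp only [PartitionInv, WExp.eval, Store.setWord_word, hj', hact]
      simp only [Nat.reduceEqDiff, if_false, if_true]
      refine ⟨by rw [h1, cnt_succ, if_pos hc], fun i hi hji => ?_, fun o ho => ?_,
        fun i hi hiv => ?_, ?_, fun i hi hvi => ?_, fun x hx => ?_⟩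
      · rw [if_neg (by omega)]; exact h2 i hi (by omega)
      · split_ifs with h8
        · exact ⟨j, by omega, rfl, hc⟩
        · obtain ⟨i, hi, hi'⟩ := h3 o (by omega)
          exact ⟨i, by omega, hi'⟩
      · rcases Nat.lt_succ_iff_lt_or_eq.1 hi with h | rfl
        · obtain ⟨o, ho, ho'⟩ := h4 i h hiv
          exact ⟨o, by omega, by rw [if_neg (by omega), ho']⟩
        · exact ⟨τ.word 11 0, by omega, by rw [if_pos rfl]⟩
      · have hnew : ∀ o < τ.word 11 0, τ.word 3 o ≠ σ.word 3 j := by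
          intro o ho heq
          obtain ⟨i, hi, hi', _⟩ := h3 o ho
          have := hinj i (by omega) j hj (by rw [← hi', heq])
          omega
        intro i hi l hl hil
        by_cases hi' : i = τ.word 11 0 <;> by_cases hl' : l = τ.word 11 0
        · omega
        · rw [if_pos hi', if_neg hl'] at hil
          exact absurd hil.symm (hnew l (by omega))
        · rw [if_neg hi', if_pos hl'] at hil
          exact absurd hil (hnew i (by omega))
        · rw [if_neg hi', if_neg hl'] at hil
          exact h5 i (by omega) l (by omega) hil
      · rcases Nat.lt_succ_iff_lt_or_eq.1 hi with h | rfl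
        · exact h6 i h hvi
        · exact absurd hc (not_lt.2 hvi)
      · exact h7 x fun i hi => hx i (by omega)
  · rintro M₂ τ hM₂ hs₂ - ⟨h1, h2, h3, h4, h5, h6, h7⟩
    have hjc := hcnt (fun x => x < v) t
    refine Run.setW (by simp [WExp.eval]; omega) ?_
    simp only [WExp.eval, Store.setWord_word, Nat.reduceEqDiff, if_false, if_true]
    exact ⟨by omega, h1, h3, h4, h5, h6, h7⟩

end RealRAM

/-! ### The matrix of approximate ranks -/

namespace RealRAM

open Selection

variable {W : ℕ}

/-- The squared distance of the points with numbers `a` and `b`. -/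
def sqDist (σ : Store) (a b : ℕ) : ℝ :=
  (σ.real 0 a - σ.real 0 b) * (σ.real 0 a - σ.real 0 b) +
    (σ.real 1 a - σ.real 1 b) * (σ.real 1 a - σ.real 1 b)

/-- The expression for the squared distance. -/
abbrev sqDistExp (e f : WExp) : RExp :=
  .add (.mul (.sub (.load 0 e) (.load 0 f)) (.sub (.load 0 e) (.load 0 f)))
    (.mul (.sub (.load 1 e) (.load 1 f)) (.sub (.load 1 e) (.load 1 f)))

theorem sqDist_self_le (σ : Store) (p q : ℕ) : sqDist σ p p ≤ sqDist σ p q := by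
  simp only [sqDist, sub_self, mul_zero, add_zero]
  exact add_nonneg (mul_self_nonneg _) (mul_self_nonneg _)

/-- Compute approximate ranks of all points as seen from the current point. -/
def rowProg : Prog :=
  .forTo 8 (.var 0) (.setR 3 (.var 8) (sqDistExp (.var 1) (.var 8)) ;; .setW 3 (.var 8) (.var 8)) ;;
  .setV 4 (.var 0) ;;
  .loop (.wle (.const 1) (.var 4)) (pivotProg ;; partitionProg)

/-- A round costs at most `502 * t + 1` iterations and removes at least a quarter of the `t` active
points; a potential of `2012` per active point releases `503 * t`. The initial loop adds `n`. -/
theorem run_rowProg {σ : Store} {n p : ℕ} (hn : σ.word 0 0 = n) (hp : σ.word 1 0 = p)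
    (hpn : p < n) (hW : 4 * n + 200 ≤ W) :
    Run W rowProg σ fun M τ => M ≤ 2013 * n ∧
      (∀ q < n, q ≠ p → GoodRank (sqDist σ p) n q (τ.word 2 (p * n + q))) ∧
      ∀ x, (∀ q < n, x ≠ p * n + q) → τ.word 2 x = σ.word 2 x := by
  refine Run.seq (Run.forTo n 0 (fun m τ => ∀ i < m, τ.real 3 i = sqDist σ p i ∧ τ.word 3 i = i)
    (by decide) ?_ (by omega) ?_ ?_ ?_)
  · intro τ hs
    simp [WExp.eval, hs.1 0 (by decide), hn]
  · simp
  · intro j hj τ hs hj' hI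
    have h0 := hs.2 0 (by decide)
    have h1 := hs.2 1 (by decide)
    have h1' := hs.1 1 (by decide)
    refine Run.seq (Run.setR (Run.setW (by simp [WExp.eval, hj']; omega) ⟨le_rfl, ?_⟩))
    intro i hi
    simp only [WExp.eval, RExp.eval, hj', h0, h1, h1', hp, Store.setWord_word, Store.setWord_real,
      Store.setReal_real, Store.setReal_word, Nat.reduceEqDiff, if_true, if_false]
    by_cases hij : i = j
    · simp [hij, sqDist]
    · simp only [if_neg hij]
      exact hI i (by omega)
  intro M₁ τ₁ hM₁ hs₁ _ hI₁
  have e0 := hs₁.1 0 (by decide)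
  have e1 := hs₁.1 1 (by decide)
  have e2 := hs₁.1 2 (by decide)
  refine Run.seq (Run.setW (by simp [WExp.eval, e0, hn]; omega) ?_)
  have hDp : ∀ i < n, τ₁.real 3 i = sqDist σ p i := fun i hi => (hI₁ i hi).1
  refine Run.loop (fun τ => Lists (sqDist σ p) n (τ.word 4 0) (τ.word 3) ∧
    (∀ q < n, q ≠ p → (∀ i < τ.word 4 0, τ.word 3 i ≠ q) →
      GoodRank (sqDist σ p) n q (τ.word 2 (p * n + q))) ∧
    ∀ x, (∀ q < n, x ≠ p * n + q) → τ.word 2 x = σ.word 2 x) (fun τ => 2012 * τ.word 4 0) ?_ ?_ ?_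
  · simp only [WExp.eval, Store.setWord_word, Nat.reduceEqDiff, if_true, if_false, e0, hn, e2,
      Store.setWord_word_of_ne _ (a := 4) (b := 3) _ _ (by decide)]
    refine ⟨⟨fun i hi => by rw [(hI₁ i hi).2]; exact hi, fun i hi j hj hij => by
      rwa [(hI₁ i hi).2, (hI₁ j hj).2] at hij, fun i hi q hq _ => ⟨q, hq, (hI₁ q hq).2⟩⟩,
      fun q hq _ h => absurd (hI₁ q hq).2 (h q hq), by simp⟩
  · rintro τ hs ⟨hL, hg, hx⟩ hc
    have g0 := hs.1 0 (by decide)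
    have g1 := hs.1 1 (by decide)
    have k3 := hs.2 3 (by decide)
    simp [Store.setWord_word_of_ne, e0, e1] at g0 g1 k3
    have hpos : 0 < τ.word 4 0 := by
      have : 1 ≤ τ.word 4 0 := by simpa [BExp.Holds, WExp.eval] using hc
      omega
    have htn := hL.card_le
    have hact : ∀ i < τ.word 4 0, active τ i = sqDist σ p (τ.word 3 i) := fun i hi => by
      rw [active, k3, hDp _ (hL.lt i hi)]
    have hcnt : ∀ Q, cnt (active τ) (τ.word 4 0) Q =
        cnt (fun j => sqDist σ p (τ.word 3 j)) (τ.word 4 0) Q := fun Q => cnt_congr hact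
    refine Run.seq ((run_pivotProg hpos (by omega)).frame ?_)
    rintro M υ hυ ⟨hM, hv1, hv2⟩
    have u0 := hυ.1 0 (by decide)
    have u1 := hυ.1 1 (by decide)
    have u2 := hυ.1 2 (by decide)
    have u3 := hυ.1 3 (by decide)
    have u4 := hυ.1 4 (by decide)
    have w3 := hυ.2 3 (by decide)
    have hact' : active υ = active τ := by funext i; rw [active, active, w3, u3]
    refine (run_partitionProg (n := n) (t := τ.word 4 0) (p := p) (v := υ.real 5 0)
      (by rw [u0, g0, hn]) (by rw [u4]) (by rw [u1, g1, hp]) rfl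
      (by rw [u3]; exact hL.lt) (by rw [u3]; exact hL.inj) htn (by omega)).mono ?_
    rintro M' ω ⟨hM', h4, hA, hB, hC, hV, hX⟩
    rw [hact', u3] at hA hB
    rw [hact'] at h4
    simp only [hact', u3, u2] at hV hX
    refine ⟨⟨⟨?_, hC, ?_⟩, ?_, ?_⟩, by omega⟩
    · intro o ho
      obtain ⟨i, hi, hi', _⟩ := hA o ho
      rw [hi']; exact hL.lt i hi
    · intro o ho q hq hqo
      obtain ⟨i, hi, hi', hiv⟩ := hA o ho
      rw [hi'] at hqo
      obtain ⟨j, hj, hjq⟩ := hL.down i hi q hq hqo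
      -- A point no farther than a kept point is also strictly nearer than the pivot, so downward
      -- closure is inherited.
      obtain ⟨o', ho', ho''⟩ := hB j hj (by
        rw [hact j hj, hjq]; rw [hact i hi] at hiv; exact hqo.trans_lt hiv)
      exact ⟨o', ho', by rw [ho'', hjq]⟩
    · intro q hq hqp hnot
      by_cases hold : ∃ i < τ.word 4 0, τ.word 3 i = q
      · obtain ⟨i, hi, rfl⟩ := hold
        have hvi : υ.real 5 0 ≤ active τ i := by
          by_contra hcon
          obtain ⟨o, ho, ho'⟩ := hB i hi (not_le.1 hcon)
          exact hnot o ho ho'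
        rw [hV i hi hvi, hcnt]
        rw [hcnt] at hv1
        rw [hact i hi] at hvi ⊢
        exact hL.goodRank hi hpn hqp (sqDist_self_le σ p) hv1 hvi
      · push Not at hold
        rw [hX _ fun i hi _ h => hold i hi (Nat.add_left_cancel h).symm]
        exact hg q hq hqp hold
    · intro x hx'
      rw [hX x fun i hi _ => hx' _ (hL.lt i hi)]
      exact hx x hx'
  · rintro M τ hM hs ⟨hL, hg, hx⟩ hc
    have h0 : τ.word 4 0 = 0 := by simpa [BExp.Holds, WExp.eval] using hc
    simp only [WExp.eval, Store.setWord_word, if_true, e0, hn] at hM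
    refine ⟨by omega, fun q hq hqp => hg q hq hqp fun i hi => by omega, hx⟩

/-- Compute approximate ranks of all points as seen from all points. -/
def ranksProg : Prog := .forTo 1 (.var 0) rowProg

theorem run_ranksProg {σ : Store} {n : ℕ} (hn : σ.word 0 0 = n) (hW : 4 * n + 200 ≤ W) :
    Run W ranksProg σ fun M τ => M ≤ n * (2013 * n + 1) ∧
      ∀ p < n, ∀ q < n, q ≠ p → GoodRank (sqDist σ p) n q (τ.word 2 (p * n + q)) := by
  refine Run.forTo n (2013 * n) (fun m τ => ∀ p < m, ∀ q < n, q ≠ p →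
    GoodRank (sqDist σ p) n q (τ.word 2 (p * n + q))) (by decide) ?_ (by omega) ?_ ?_ ?_
  · intro τ hs
    simp [WExp.eval, hs.1 0 (by decide), hn]
  · simp
  · intro j hj τ hs hj' hI
    have h0 := hs.1 0 (by decide)
    have hd : sqDist τ = sqDist σ := by
      funext a b
      rw [sqDist, sqDist, hs.2 0 (by decide), hs.2 1 (by decide)]
    refine (run_rowProg (by rw [h0, hn]) hj' hj hW).mono ?_
    rintro M υ ⟨hM, hg, hx⟩
    refine ⟨hM, fun p hp q hq hqp => ?_⟩
    rw [Store.setWord_word_of_ne _ _ _ (by decide)]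
    rcases Nat.lt_succ_iff_lt_or_eq.1 hp with h | rfl
    · rw [hx]
      · exact hI p h q hq hqp
      · intro q' hq' heq
        have : (p + 1) * n ≤ j * n := Nat.mul_le_mul_right _ h
        rw [add_mul, one_mul] at this
        omega
    · rw [← hd]; exact hg q hq hqp
  · intro M τ hM _ _ hI
    exact ⟨hM, hI⟩

end RealRAM

/-! ### Minimum sink trees in quadratic time

Word array `20` holds the components of the points, `21` the potentials, `22` the best sources,
`23` the recorded components, `24` and `25` the sources and the targets of the recorded edges. The
scalar word variables are `26` (height of the stack), `27` (length of the history), `28` (reduced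
weight), `29` (target), `30` (source), `31` (component of the target), `32` (counter), and `33`
(first point that may be unvisited). -/

namespace RealRAM

variable {W : ℕ}

/-- The cell of row `e` and column `f` of a matrix. -/
abbrev WExp.cell (e f : WExp) : WExp := .add (.mul e (.var 0)) f

theorem cell_inj {n i j u v : ℕ} (hu : u < n) (hv : v < n) :
    i * n + u = j * n + v ↔ i = j ∧ u = v := by
  constructor
  · intro h
    have h1 : (i * n + u) / n = i := by
      rw [mul_comm, Nat.mul_add_div (by omega), Nat.div_eq_of_lt hu, add_zero]
    have h2 : (j * n + v) / n = j := by
      rw [mul_comm, Nat.mul_add_div (by omega), Nat.div_eq_of_lt hv, add_zero]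
    rw [h, h2] at h1
    subst h1
    exact ⟨rfl, by omega⟩
  · rintro ⟨rfl, rfl⟩; rfl

/-- The reduced weight of the best edge from the component at stack position `j` to `u`. -/
def reduced (σ : Store) (n j u : ℕ) : ℕ :=
  σ.word 2 (σ.word 22 (j * n + u) * n + u) - σ.word 21 (σ.word 22 (j * n + u))

/-- The expression for the reduced weight. -/
abbrev reducedExp (e f : WExp) : WExp :=
  .sub (.load 2 (.cell (.load 22 (.cell e f)) f)) (.load 21 (.load 22 (.cell e f)))

/-- Find the cheapest edge that leaves the top component. -/
def exitProg : Prog :=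
  .setV 28 (.add (.var 0) (.const 1)) ;;
  .setV 29 (.const 0) ;;
  .forTo 32 (.var 0) (.ite (.weq (.load 20 (.var 32)) (.var 26)) .skip
    (.ite (.wlt (reducedExp (.var 26) (.var 32)) (.var 28))
      (.setV 28 (reducedExp (.var 26) (.var 32)) ;; .setV 29 (.var 32)) .skip))

/-- The starting value `n + 1` exceeds every admissible reduced weight, so a final value of at most
`n` certifies that a target was recorded. -/
theorem run_exitProg {σ : Store} {n k : ℕ} (hn : σ.word 0 0 = n) (hk : σ.word 26 0 = k)
    (hW : n + 1 < W) (hex : ∃ u < n, σ.word 20 u ≠ k)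
    (hle : ∀ u < n, σ.word 20 u ≠ k → reduced σ n k u ≤ n) :
    Run W exitProg σ fun M τ => M ≤ n ∧ τ.word 29 0 < n ∧ σ.word 20 (τ.word 29 0) ≠ k ∧
      τ.word 28 0 = reduced σ n k (τ.word 29 0) ∧
      ∀ u < n, σ.word 20 u ≠ k → τ.word 28 0 ≤ reduced σ n k u := by
  refine Run.seq (Run.setW (by simp [WExp.eval]; omega) ?_)
  refine Run.seq (Run.setW (by simp [WExp.eval]; omega) ?_)
  refine Run.forTo n 0 (fun m τ => τ.word 28 0 ≤ n + 1 ∧ (τ.word 28 0 ≤ n → τ.word 29 0 < n ∧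
      σ.word 20 (τ.word 29 0) ≠ k ∧ τ.word 28 0 = reduced σ n k (τ.word 29 0)) ∧
      ∀ u < m, σ.word 20 u ≠ k → τ.word 28 0 ≤ reduced σ n k u) (by decide) ?_ (by omega) ?_ ?_ ?_
  · intro τ hs
    have h0 := hs.1 0 (by decide)
    simp [Store.setWord_word_of_ne] at h0
    simp [WExp.eval, h0, hn]
  · simp [Store.setWord_word, WExp.eval, hn]
  · rintro j hj τ hs hj' ⟨h1, h2, h3⟩
    have g0 := hs.1 0 (by decide)
    have g2 := hs.1 2 (by decide)
    have g20 := hs.1 20 (by decide)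
    have g21 := hs.1 21 (by decide)
    have g22 := hs.1 22 (by decide)
    have g26 := hs.1 26 (by decide)
    simp [Store.setWord_word_of_ne] at g0 g2 g20 g21 g22 g26
    have hred : (reducedExp (.var 26) (.var 32)).eval τ = reduced σ n k j := by
      simp only [WExp.eval, g0, g2, g21, g22, g26, hj', hn, hk, reduced]
    refine Run.ite ?_ ?_
    · intro hc
      have hc' : σ.word 20 j = k := by
        simpa [BExp.Holds, WExp.eval, g20, g26, hj', hk, ← le_antisymm_iff] using hc
      refine Run.skip ⟨le_rfl, ?_⟩
      simp only [Store.setWord_word, Nat.reduceEqDiff, if_false]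
      refine ⟨h1, h2, fun u hu huk => h3 u ?_ huk⟩
      rcases Nat.lt_succ_iff_lt_or_eq.1 hu with h | rfl
      · exact h
      · exact absurd hc' huk
    · intro hc
      have hc' : σ.word 20 j ≠ k := by
        simpa [BExp.Holds, WExp.eval, g20, g26, hj', hk, ← le_antisymm_iff] using hc
      refine Run.ite ?_ ?_
      · intro hd
        have hd' : reduced σ n k j < τ.word 28 0 := by
          rw [← hred]; simpa only [BExp.Holds, WExp.eval, not_le] using hd
        refine Run.seq (Run.setW (by rw [hred]; omega) ?_)
        refine Run.setW (by simp [WExp.eval, Store.setWord_word, hj']; omega) ⟨le_rfl, ?_⟩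
        rw [hred]
        simp only [WExp.eval, Store.setWord_word, Nat.reduceEqDiff, if_false, if_true, hj']
        refine ⟨by omega, fun _ => ⟨hj, hc', trivial⟩, fun u hu huk => ?_⟩
        rcases Nat.lt_succ_iff_lt_or_eq.1 hu with h | rfl
        · exact hd'.le.trans (h3 u h huk)
        · exact le_rfl
      · intro hd
        have hd' : τ.word 28 0 ≤ reduced σ n k j := by
          rw [← hred]; simpa only [BExp.Holds, WExp.eval, not_not] using hd
        refine Run.skip ⟨le_rfl, ?_⟩
        simp only [Store.setWord_word, Nat.reduceEqDiff, if_false]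
        refine ⟨h1, h2, fun u hu huk => ?_⟩
        rcases Nat.lt_succ_iff_lt_or_eq.1 hu with h | rfl
        · exact h3 u h huk
        · exact hd'
  · rintro M τ hM hs - ⟨h1, h2, h3⟩
    obtain ⟨u, hu, huk⟩ := hex
    obtain ⟨h4, h5, h6⟩ := h2 ((h3 u hu huk).trans (hle u hu huk))
    exact ⟨by omega, h4, h5, h6, h3⟩

/-- Record the selected edge and raise the potentials of the top component. -/
def recordProg : Prog :=
  .setV 30 (.load 22 (.cell (.var 26) (.var 29))) ;;
  .forTo 32 (.var 0) (.ite (.weq (.load 20 (.var 32)) (.var 26))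
    (.setW 23 (.cell (.var 27) (.var 32)) (.const 1) ;;
      .setW 21 (.var 32) (.add (.load 21 (.var 32)) (.var 28)))
    (.setW 23 (.cell (.var 27) (.var 32)) (.const 0))) ;;
  .setW 24 (.var 27) (.var 30) ;;
  .setW 25 (.var 27) (.var 29) ;;
  .setV 27 (.add (.var 27) (.const 1))

/-- Only membership and the edge are stored; the dual value is needed for the proof, not for the
expansion. The bound `ha` keeps the raised potentials storable. -/
theorem run_recordProg {σ : Store} {n k m : ℕ} (hn : σ.word 0 0 = n) (hk : σ.word 26 0 = k)
    (hm : σ.word 27 0 = m) (hW : n + 1 < W) (hmW : m + 1 < W) (hq : σ.word 29 0 < n)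
    (hp : σ.word 22 (k * n + σ.word 29 0) < n)
    (ha : ∀ v < n, σ.word 20 v = k → σ.word 21 v + σ.word 28 0 ≤ n) :
    Run W recordProg σ fun M τ => M ≤ n ∧ τ.word 27 0 = m + 1 ∧
      (∀ v < n, τ.word 21 v = if σ.word 20 v = k then σ.word 21 v + σ.word 28 0
        else σ.word 21 v) ∧
      (∀ v < n, τ.word 23 (m * n + v) ≠ 0 ↔ σ.word 20 v = k) ∧
      (∀ x < m * n, τ.word 23 x = σ.word 23 x) ∧
      τ.word 24 m = σ.word 22 (k * n + σ.word 29 0) ∧ τ.word 25 m = σ.word 29 0 ∧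
      ∀ i < m, τ.word 24 i = σ.word 24 i ∧ τ.word 25 i = σ.word 25 i := by
  refine Run.seq (Run.setW (by simp [WExp.eval, hk, hn]; omega) (Run.seq ?_))
  refine Run.forTo n 0 (fun l τ =>
      (∀ v < n, τ.word 21 v = if v < l ∧ σ.word 20 v = k then σ.word 21 v + σ.word 28 0
        else σ.word 21 v) ∧
      (∀ v < l, τ.word 23 (m * n + v) ≠ 0 ↔ σ.word 20 v = k) ∧
      (∀ x < m * n, τ.word 23 x = σ.word 23 x)) (by decide) ?_ (by omega) ?_ ?_ ?_
  · intro τ hs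
    have h0 := hs.1 0 (by decide)
    simp [Store.setWord_word_of_ne] at h0
    simp [WExp.eval, h0, hn]
  · simp [Store.setWord_word]
  · rintro j hj τ hs hj' ⟨h1, h2, h3⟩
    have g0 := hs.1 0 (by decide)
    have g20 := hs.1 20 (by decide)
    have g26 := hs.1 26 (by decide)
    have g27 := hs.1 27 (by decide)
    have g28 := hs.1 28 (by decide)
    simp [Store.setWord_word_of_ne] at g0 g20 g26 g27 g28
    have h1j := h1 j hj
    rw [if_neg (by omega)] at h1j
    refine Run.ite ?_ ?_
    · intro hc
      have hc' : σ.word 20 j = k := by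
        simpa [BExp.Holds, WExp.eval, g20, g26, hj', hk, ← le_antisymm_iff] using hc
      have haj := ha j hj hc'
      refine Run.seq (Run.setW (by simp [WExp.eval]; omega) ?_)
      refine Run.setW (by simp [WExp.eval, Store.setWord_word, hj', g28, h1j]; omega) ⟨le_rfl, ?_⟩
      simp only [WExp.eval, Store.setWord_word, Nat.reduceEqDiff, if_false, if_true, hj', g0, g27,
        g28, h1j, hm, hn]
      refine ⟨fun v hv => ?_, fun v hv => ?_, fun x hx => ?_⟩
      · by_cases hvj : v = j
        · rw [if_pos hvj, hvj, if_pos ⟨by omega, hc'⟩]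
        · rw [if_neg hvj, h1 v hv]
          have : (v < j + 1 ∧ σ.word 20 v = k) ↔ (v < j ∧ σ.word 20 v = k) := by omega
          simp only [this]
      · by_cases hvj : v = j
        · simp [hvj, hc']
        · rw [if_neg (by omega)]; exact h2 v (by omega)
      · rw [if_neg (by omega)]; exact h3 x hx
    · intro hc
      have hc' : σ.word 20 j ≠ k := by
        simpa [BExp.Holds, WExp.eval, g20, g26, hj', hk, ← le_antisymm_iff] using hc
      refine Run.setW (by simp [WExp.eval]; omega) ⟨le_rfl, ?_⟩
      simp only [WExp.eval, Store.setWord_word, Nat.reduceEqDiff, if_false, if_true, hj', g0, g27,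
        hm, hn]
      refine ⟨fun v hv => ?_, fun v hv => ?_, fun x hx => ?_⟩
      · rw [h1 v hv]
        have : (v < j + 1 ∧ σ.word 20 v = k) ↔ (v < j ∧ σ.word 20 v = k) := by
          constructor
          · rintro ⟨h4, h5⟩
            refine ⟨?_, h5⟩
            rcases Nat.lt_succ_iff_lt_or_eq.1 h4 with h | rfl
            · exact h
            · exact absurd h5 hc'
          · rintro ⟨h4, h5⟩; exact ⟨by omega, h5⟩
        simp only [this]
      · by_cases hvj : v = j
        · simp [hvj, hc']
        · rw [if_neg (by omega)]; exact h2 v (by omega)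
      · rw [if_neg (by omega)]; exact h3 x hx
  · rintro M τ hM hs - ⟨h1, h2, h3⟩
    have g24 := hs.1 24 (by decide)
    have g25 := hs.1 25 (by decide)
    have g27 := hs.1 27 (by decide)
    have g29 := hs.1 29 (by decide)
    have g30 := hs.1 30 (by decide)
    simp [Store.setWord_word_of_ne] at g24 g25 g27 g29
    have g30' : τ.word 30 0 = σ.word 22 (k * n + σ.word 29 0) := by
      rw [g30]; simp [Store.setWord_word, WExp.eval, hk, hn]
    refine Run.seq (Run.setW (by simp [WExp.eval, g30']; omega) ?_)
    refine Run.seq (Run.setW (by simp [WExp.eval, Store.setWord_word, g29]; omega) ?_)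
    refine Run.setW (by simp [WExp.eval, Store.setWord_word, g27, hm]; omega) ?_
    simp only [WExp.eval, Store.setWord_word, Nat.reduceEqDiff, if_false, if_true, g30', g27, g29,
      hm, g24, g25]
    refine ⟨by omega, trivial, fun v hv => ?_, h2, h3, trivial, trivial, fun i hi => ?_⟩
    · rw [h1 v hv]; simp [hv]
    · rw [if_neg (by omega), if_neg (by omega)]; exact ⟨rfl, rfl⟩

/-- Push the target as a new component. -/
def pushProg : Prog :=
  .setV 26 (.add (.var 26) (.const 1)) ;;
  .setW 20 (.var 29) (.var 26) ;;
  .forTo 32 (.var 0) (.setW 22 (.cell (.var 26) (.var 32)) (.var 29))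

theorem run_pushProg {σ : Store} {n k u : ℕ} (hn : σ.word 0 0 = n) (hk : σ.word 26 0 = k)
    (hu : σ.word 29 0 = u) (hW : n < W) (hkW : k + 1 < W) (hun : u < n) :
    Run W pushProg σ fun M τ => M ≤ n ∧ τ.word 26 0 = k + 1 ∧
      τ.word 20 = Function.update (σ.word 20) u (k + 1) ∧
      (∀ q < n, τ.word 22 ((k + 1) * n + q) = u) ∧
      ∀ j, j ≠ k + 1 → ∀ q < n, τ.word 22 (j * n + q) = σ.word 22 (j * n + q) := by
  refine Run.seq (Run.setW (by simp [WExp.eval, hk]; omega) ?_)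
  refine Run.seq (Run.setW (by simp [WExp.eval, Store.setWord_word, hk]; omega) ?_)
  refine Run.forTo n 0 (fun l τ => (∀ q < l, τ.word 22 ((k + 1) * n + q) = u) ∧
      ∀ j, j ≠ k + 1 → ∀ q < n, τ.word 22 (j * n + q) = σ.word 22 (j * n + q))
      (by decide) ?_ (by omega) ?_ ?_ ?_
  · intro τ hs
    have h0 := hs.1 0 (by decide)
    simp [Store.setWord_word_of_ne] at h0
    simp [WExp.eval, h0, hn]
  · simp [Store.setWord_word]
  · rintro j hj τ hs hj' ⟨h1, h2⟩
    have g0 := hs.1 0 (by decide)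
    have g26 := hs.1 26 (by decide)
    have g29 := hs.1 29 (by decide)
    simp [Store.setWord_word_of_ne] at g0 g29
    have g26' : τ.word 26 0 = k + 1 := by
      rw [g26]; simp [Store.setWord_word, WExp.eval, hk]
    refine Run.setW (by simp [WExp.eval, g29, hu]; omega) ⟨le_rfl, ?_⟩
    simp only [WExp.eval, Store.setWord_word, Nat.reduceEqDiff, if_false, if_true, hj', g0, g26',
      g29, hn, hu]
    refine ⟨fun q hq => ?_, fun i hi q hq => ?_⟩
    · split_ifs with h
      · rfl
      · exact h1 q (by omega)
    · rw [if_neg (by rw [cell_inj hq hj]; exact fun h => hi h.1)]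
      exact h2 i hi q hq
  · rintro M τ hM hs - ⟨h1, h2⟩
    refine ⟨by omega, ?_, ?_, h1, h2⟩
    · rw [hs.1 26 (by decide)]; simp [Store.setWord_word, WExp.eval, hk]
    · rw [hs.1 20 (by decide)]
      funext v
      simp [Store.setWord_word, WExp.eval, hk, hu, Function.update_apply]

/-- Mark everything on the stack as connected to the root. -/
def absorbProg : Prog :=
  .forTo 32 (.var 0) (.ite (.weq (.load 20 (.var 32)) (.const 0)) .skip
    (.setW 20 (.var 32) (.add (.var 0) (.const 1)))) ;;
  .setV 26 (.const 0)

theorem run_absorbProg {σ : Store} {n : ℕ} (hn : σ.word 0 0 = n) (hW : n + 1 < W) :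
    Run W absorbProg σ fun M τ => M ≤ n ∧ τ.word 26 0 = 0 ∧
      ∀ v < n, τ.word 20 v = if σ.word 20 v = 0 then 0 else n + 1 := by
  refine Run.seq (Run.forTo n 0 (fun l τ => ∀ v < n, τ.word 20 v =
    if v < l ∧ σ.word 20 v ≠ 0 then n + 1 else σ.word 20 v) (by decide) ?_ (by omega) ?_ ?_ ?_)
  · intro τ hs
    simp [WExp.eval, hs.1 0 (by decide), hn]
  · simp [Store.setWord_word]
  · rintro j hj τ hs hj' h1
    have g0 := hs.1 0 (by decide)
    have h1j := h1 j hj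
    rw [if_neg (by omega)] at h1j
    refine Run.ite ?_ ?_
    · intro hc
      have hc' : σ.word 20 j = 0 := by simpa [BExp.Holds, WExp.eval, hj', h1j] using hc
      refine Run.skip ⟨le_rfl, fun v hv => ?_⟩
      rw [Store.setWord_word_of_ne _ _ _ (by decide), h1 v hv]
      by_cases hvj : v = j
      · simp [hvj, hc']
      · have : (v < j + 1 ∧ σ.word 20 v ≠ 0) ↔ (v < j ∧ σ.word 20 v ≠ 0) := by omega
        simp only [this]
    · intro hc
      have hc' : σ.word 20 j ≠ 0 := by simpa [BExp.Holds, WExp.eval, hj', h1j] using hc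
      refine Run.setW (by simp [WExp.eval, g0, hn]; omega) ⟨le_rfl, fun v hv => ?_⟩
      simp only [WExp.eval, Store.setWord_word, Nat.reduceEqDiff, if_false, if_true, hj', g0, hn]
      by_cases hvj : v = j
      · simp [hvj, hc']
      · rw [if_neg hvj, h1 v hv]
        have : (v < j + 1 ∧ σ.word 20 v ≠ 0) ↔ (v < j ∧ σ.word 20 v ≠ 0) := by omega
        simp only [this]
  · rintro M τ hM hs - h1
    refine Run.setW (by simp [WExp.eval]; omega) ?_
    simp only [WExp.eval, Store.setWord_word, Nat.reduceEqDiff, if_false, if_true]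
    refine ⟨by omega, trivial, fun v hv => ?_⟩
    rw [h1 v hv]
    by_cases h : σ.word 20 v = 0 <;> simp [h, hv]

end RealRAM

/-! ### Merging along the stack -/

namespace RealRAM

variable {W : ℕ}

/-- Merge the two topmost components. -/
def mergeStep : Prog :=
  .forTo 32 (.var 0) (.ite (.weq (.load 20 (.var 32)) (.var 26))
      (.setW 20 (.var 32) (.sub (.var 26) (.const 1))) .skip ;;
    .ite (.wlt (reducedExp (.var 26) (.var 32)) (reducedExp (.sub (.var 26) (.const 1)) (.var 32)))
      (.setW 22 (.cell (.sub (.var 26) (.const 1)) (.var 32))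
        (.load 22 (.cell (.var 26) (.var 32)))) .skip) ;;
  .setV 26 (.sub (.var 26) (.const 1))

theorem run_mergeStep {σ : Store} {n k : ℕ} (hn : σ.word 0 0 = n) (hk : σ.word 26 0 = k + 1)
    (hW : n < W) (hkW : k < W) (hb : ∀ u < n, σ.word 22 ((k + 1) * n + u) < n) :
    Run W mergeStep σ fun M τ => M ≤ n ∧ τ.word 26 0 = k ∧
      (∀ v < n, τ.word 20 v = if σ.word 20 v = k + 1 then k else σ.word 20 v) ∧
      ∀ j, ∀ u < n, τ.word 22 (j * n + u) =
        if j = k ∧ reduced σ n (k + 1) u < reduced σ n k u then σ.word 22 ((k + 1) * n + u)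
        else σ.word 22 (j * n + u) := by
  refine Run.seq (Run.forTo n 0 (fun l τ => (∀ v < n, τ.word 20 v =
      if v < l ∧ σ.word 20 v = k + 1 then k else σ.word 20 v) ∧
      ∀ j, ∀ u < n, τ.word 22 (j * n + u) =
        if u < l ∧ j = k ∧ reduced σ n (k + 1) u < reduced σ n k u
        then σ.word 22 ((k + 1) * n + u)
        else σ.word 22 (j * n + u)) (by decide) ?_ (by omega) ?_ ?_ ?_)
  · intro τ hs
    simp [WExp.eval, hs.1 0 (by decide), hn]
  · simp [Store.setWord_word]
  · rintro j hj τ hs hj' ⟨h1, h2⟩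
    have g0 := hs.1 0 (by decide)
    have g2 := hs.1 2 (by decide)
    have g21 := hs.1 21 (by decide)
    have g26 := hs.1 26 (by decide)
    have h1j := h1 j hj
    rw [if_neg (by omega)] at h1j
    have hfirst : Run W (.ite (.weq (.load 20 (.var 32)) (.var 26))
      (.setW 20 (.var 32) (.sub (.var 26) (.const 1))) .skip) τ fun M υ => M = 0 ∧
        ∀ v < n, υ.word 20 v = if v < j + 1 ∧ σ.word 20 v = k + 1 then k else σ.word 20 v := by
      refine Run.ite ?_ ?_
      · intro hc
        have hc' : σ.word 20 j = k + 1 := by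
          simp only [BExp.Holds, WExp.eval, g26, hj', hk, h1j] at hc
          omega
        refine Run.setW (by simp [WExp.eval, g26, hk]; omega) ⟨rfl, fun v hv => ?_⟩
        simp only [WExp.eval, Store.setWord_word, if_true, hj', g26, hk]
        by_cases hvj : v = j
        · rw [if_pos hvj, hvj, if_pos ⟨by omega, hc'⟩, Nat.add_sub_cancel]
        · rw [if_neg hvj, h1 v hv]
          have : (v < j + 1 ∧ σ.word 20 v = k + 1) ↔ (v < j ∧ σ.word 20 v = k + 1) := by omega
          simp only [this]
      · intro hc
        have hc' : σ.word 20 j ≠ k + 1 := by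
          simp only [BExp.Holds, WExp.eval, g26, hj', hk, h1j] at hc
          omega
        refine Run.skip ⟨rfl, fun v hv => ?_⟩
        rw [h1 v hv]
        by_cases hvj : v = j
        · simp [hvj, hc']
        · have : (v < j + 1 ∧ σ.word 20 v = k + 1) ↔ (v < j ∧ σ.word 20 v = k + 1) := by omega
          simp only [this]
    refine Run.seq (hfirst.frame ?_)
    rintro M υ hυ ⟨rfl, hc20⟩
    have u0 := hυ.1 0 (by decide)
    have u2 := hυ.1 2 (by decide)
    have u21 := hυ.1 21 (by decide)
    have u22 := hυ.1 22 (by decide)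
    have u26 := hυ.1 26 (by decide)
    have u32 := hυ.1 32 (by decide)
    -- Column `j` is untouched before round `j`, so the comparison uses the original best sources.
    have hcell : ∀ i, τ.word 22 (i * n + j) = σ.word 22 (i * n + j) := fun i => by
      rw [h2 i j hj, if_neg (by omega)]
    have hred1 : (reducedExp (.var 26) (.var 32)).eval υ = reduced σ n (k + 1) j := by
      simp only [WExp.eval, u0, u2, u21, u22, u26, u32, g0, g2, g21, g26, hj', hn, hk, reduced,
        hcell]
    have hred2 : (reducedExp (.sub (.var 26) (.const 1)) (.var 32)).eval υ =
        reduced σ n k j := by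
      simp only [WExp.eval, u0, u2, u21, u22, u26, u32, g0, g2, g21, g26, hj', hn, hk, reduced,
        hcell, Nat.add_sub_cancel]
    refine Run.ite ?_ ?_
    · intro hc
      have hc' : reduced σ n (k + 1) j < reduced σ n k j := by
        rw [← hred1, ← hred2]; simpa only [BExp.Holds, not_le] using hc
      have hbj := hb j hj
      refine Run.setW (by simp only [WExp.eval, u0, u22, u26, u32, g0, g26, hj', hn, hk, hcell];
                          omega) ⟨le_rfl, ?_⟩
      simp only [WExp.eval, Store.setWord_word, Nat.reduceEqDiff, if_false, if_true, u0, u22, u26,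
        u32, g0, g26, hj', hn, hk, hcell, Nat.add_sub_cancel]
      refine ⟨hc20, fun i u hu => ?_⟩
      simp only [cell_inj hu hj]
      by_cases huj : u = j
      · subst huj
        by_cases hik : i = k
        · simp [hik, hc']
        · simp [hik, hcell]
      · rw [if_neg (fun h => huj h.2), h2 i u hu]
        have : u < j + 1 ↔ u < j := by omega
        simp only [this]
    · intro hc
      have hc' : ¬ reduced σ n (k + 1) j < reduced σ n k j := by
        rw [← hred1, ← hred2]; simpa only [BExp.Holds, not_le] using hc
      refine Run.skip ⟨le_rfl, ?_⟩
      simp only [Store.setWord_word, Nat.reduceEqDiff, if_false, u22]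
      refine ⟨hc20, fun i u hu => ?_⟩
      rw [h2 i u hu]
      by_cases huj : u = j
      · subst huj; simp [hc']
      · have : u < j + 1 ↔ u < j := by omega
        simp only [this]
  · rintro M τ hM hs - ⟨h1, h2⟩
    have g26 := hs.1 26 (by decide)
    refine Run.setW (by simp [WExp.eval, g26, hk]; omega) ?_
    simp only [WExp.eval, Store.setWord_word, Nat.reduceEqDiff, if_false, if_true, g26, hk]
    refine ⟨by omega, Nat.add_sub_cancel _ _, fun v hv => ?_, fun j u hu => ?_⟩
    · rw [h1 v hv]; simp [hv]
    · rw [h2 j u hu]; simp [hu]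

/-- Merge the components from the top of the stack down to the component of the target. -/
def mergeProg : Prog := .loop (.wlt (.var 31) (.var 26)) mergeStep

/-- The surviving row keeps, in each column, the better of the rows merged so far. Its sources only
need to be best for targets outside the merged range, since edges inside a component are never
selected. -/
theorem run_mergeProg {σ : Store} {n k c : ℕ} (hn : σ.word 0 0 = n) (hk : σ.word 26 0 = k)
    (hc : σ.word 31 0 = c) (hck : c < k) (hW : n < W) (hkW : k < W)
    (hb : ∀ j, c ≤ j → j ≤ k → ∀ u < n, σ.word 22 (j * n + u) < n ∧
      σ.word 20 (σ.word 22 (j * n + u)) = j ∧ ∀ p < n, σ.word 20 p = j → σ.word 20 u ≠ j →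
        reduced σ n j u ≤ σ.word 2 (p * n + u) - σ.word 21 p) :
    Run W mergeProg σ fun M τ => M ≤ (k - c) * (n + 1) ∧ τ.word 26 0 = c ∧
      (∀ v < n, τ.word 20 v = if c ≤ σ.word 20 v ∧ σ.word 20 v ≤ k then c else σ.word 20 v) ∧
      (∀ j, j < c → ∀ u < n, τ.word 22 (j * n + u) = σ.word 22 (j * n + u)) ∧
      ∀ u < n, τ.word 22 (c * n + u) < n ∧ c ≤ σ.word 20 (τ.word 22 (c * n + u)) ∧
        σ.word 20 (τ.word 22 (c * n + u)) ≤ k ∧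
        ∀ p < n, c ≤ σ.word 20 p → σ.word 20 p ≤ k → (σ.word 20 u < c ∨ k < σ.word 20 u) →
          reduced τ n c u ≤ σ.word 2 (p * n + u) - σ.word 21 p := by
  refine Run.loop (fun τ => c ≤ τ.word 26 0 ∧ τ.word 26 0 ≤ k ∧
      (∀ v < n, τ.word 20 v = if τ.word 26 0 ≤ σ.word 20 v ∧ σ.word 20 v ≤ k then τ.word 26 0
        else σ.word 20 v) ∧
      (∀ j, j < τ.word 26 0 → ∀ u < n, τ.word 22 (j * n + u) = σ.word 22 (j * n + u)) ∧
      ∀ u < n, τ.word 22 (τ.word 26 0 * n + u) < n ∧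
        τ.word 26 0 ≤ σ.word 20 (τ.word 22 (τ.word 26 0 * n + u)) ∧
        σ.word 20 (τ.word 22 (τ.word 26 0 * n + u)) ≤ k ∧
        ∀ p < n, τ.word 26 0 ≤ σ.word 20 p → σ.word 20 p ≤ k →
          (σ.word 20 u < τ.word 26 0 ∨ k < σ.word 20 u) →
          reduced τ n (τ.word 26 0) u ≤ σ.word 2 (p * n + u) - σ.word 21 p)
    (fun τ => (τ.word 26 0 - c) * (n + 1)) ?_ ?_ ?_
  · simp only [hk]
    refine ⟨hck.le, le_rfl, fun v hv => ?_, fun _ _ _ _ => trivial, fun u hu => ?_⟩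
    · split_ifs with h
      · omega
      · rfl
    · obtain ⟨h1, h2, h3⟩ := hb k hck.le le_rfl u hu
      exact ⟨h1, h2.ge, h2.le, fun p hp hp1 hp2 hu' => h3 p hp (by omega) (by omega)⟩
  · rintro τ hs ⟨h1, h2, h3, h4, h5⟩ hcond
    have g0 := hs.1 0 (by decide)
    have g2 := hs.1 2 (by decide)
    have g21 := hs.1 21 (by decide)
    have g31 := hs.1 31 (by decide)
    have hlt : c < τ.word 26 0 := by simpa [BExp.Holds, WExp.eval, g31, hc] using hcond
    obtain ⟨l, hl⟩ : ∃ l, τ.word 26 0 = l + 1 := ⟨τ.word 26 0 - 1, by omega⟩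
    rw [hl] at h1 h2 h3 h4 h5 hlt
    refine (run_mergeStep (k := l) (by rw [g0, hn]) hl hW (by omega) fun u hu => (h5 u hu).1).frame ?_
    rintro M υ hυ ⟨hM, k26, k20, k22⟩
    have u2 := hυ.1 2 (by decide)
    have u21 := hυ.1 21 (by decide)
    simp only [k26, hl]
    refine ⟨⟨by omega, by omega, fun v hv => ?_, fun j hj u hu => ?_, fun u hu => ?_⟩, ?_⟩
    · rw [k20 v hv, h3 v hv]
      split_ifs <;> omega
    · rw [k22 j u hu, if_neg (by omega), h4 j (by omega) u hu]
    · have hlow := h4 l (by omega) u hu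
      obtain ⟨b1, b2, b3⟩ := hb l (by omega) (by omega) u hu
      obtain ⟨d1, d2, d3, d4⟩ := h5 u hu
      have hredl : reduced τ n l u = reduced σ n l u := by
        simp only [reduced, hlow, g2, g21]
      have hredυ : reduced υ n l u = min (reduced τ n (l + 1) u) (reduced τ n l u) := by
        have hcell := k22 l u hu
        rw [reduced, u2, u21, hcell]
        simp only [true_and]
        split_ifs with h
        · rw [min_eq_left h.le]; rfl
        · rw [min_eq_right (not_lt.1 h)]; rfl
      rw [hredυ, k22 l u hu]
      refine ⟨?_, ?_, ?_, fun p hp hp1 hp2 hu' => ?_⟩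
      · split_ifs
        · exact d1
        · rw [hlow]; exact b1
      · split_ifs
        · omega
        · rw [hlow, b2]
      · split_ifs
        · exact d3
        · rw [hlow, b2]; omega
      · rcases hp1.eq_or_lt with hpl | hpl
        · refine (min_le_right _ _).trans ?_
          rw [hredl]
          exact b3 p hp hpl.symm (by omega)
        · exact (min_le_left _ _).trans (d4 p hp hpl hp2 (by omega))
    · have : l + 1 - c = (l - c) + 1 := by omega
      rw [this, add_mul]
      omega
  · rintro M τ hM hs ⟨h1, h2, h3, h4, h5⟩ hcond
    have g31 := hs.1 31 (by decide)
    have hle : τ.word 26 0 ≤ c := by simpa [BExp.Holds, WExp.eval, g31, hc] using hcond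
    have heq : τ.word 26 0 = c := le_antisymm hle h1
    rw [hk] at hM
    rw [heq] at h3 h4 h5
    exact ⟨hM, heq, h3, h4, h5⟩

end RealRAM

/-! ### Correctness and cost of the contraction algorithm -/

namespace RealRAM

open Arborescence

variable {W : ℕ}

/-- The arrays `mem`, `ps`, `qs` hold the history `h`. -/
def Records (n : ℕ) (mem ps qs : ℕ → ℕ) : List Entry → Prop
  | [] => True
  | e :: h => Records n mem ps qs h ∧ ps h.length = e.p ∧ qs h.length = e.q ∧
      ∀ v < n, mem (h.length * n + v) ≠ 0 ↔ v ∈ e.C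

theorem Records.congr {n : ℕ} {mem ps qs mem' ps' qs' : ℕ → ℕ} {h : List Entry}
    (hr : Records n mem ps qs h) (hm : ∀ x < h.length * n, mem' x = mem x)
    (hp : ∀ i < h.length, ps' i = ps i) (hq : ∀ i < h.length, qs' i = qs i) :
    Records n mem' ps' qs' h := by
  induction h with
  | nil => trivial
  | cons e h ih =>
    obtain ⟨h1, h2, h3, h4⟩ := hr
    rw [List.length_cons] at hm hp hq
    rw [add_mul, one_mul] at hm
    refine ⟨ih h1 (fun x hx => hm x (by omega)) (fun i hi => hp i (by omega))
      (fun i hi => hq i (by omega)), by rw [hp _ (by omega), h2], by rw [hq _ (by omega), h3],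
      fun v hv => ?_⟩
    rw [hm _ (by omega)]
    exact h4 v hv

/-- Select an edge for the top component, and push, absorb or merge. -/
def selectProg : Prog :=
  exitProg ;; recordProg ;; .setV 31 (.load 20 (.var 29)) ;;
  .ite (.weq (.var 31) (.const 0)) pushProg
    (.ite (.weq (.var 31) (.add (.var 0) (.const 1))) absorbProg mergeProg)

/-- Grow and contract paths until every point is connected to the root. -/
def growProg : Prog :=
  .setW 20 (.const 0) (.add (.var 0) (.const 1)) ;;
  .loop (.wlt (.var 33) (.var 0))
    (.ite (.weq (.var 26) (.const 0))
      (.ite (.weq (.load 20 (.var 33)) (.const 0)) (.setV 29 (.var 33) ;; pushProg)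
        (.setV 33 (.add (.var 33) (.const 1))))
      selectProg)

/-- The memory represents a state of the algorithm with the history `h`. -/
structure State (n : ℕ) (V : ℕ → ℕ → ℕ) (τ : Store) (h : List Entry) : Prop where
  inv : Inv n V 0 (τ.word 20) (τ.word 26 0) h (τ.word 21) (fun j q => τ.word 22 (j * n + q))
  records : Records n (τ.word 23) (τ.word 24) (τ.word 25) h
  length : τ.word 27 0 = h.length

/-- The potential of the algorithm. -/
def work (n : ℕ) (τ : Store) : ℕ :=
  (n - τ.word 33 0) + 2 * (comp n (τ.word 20) 0).card + τ.word 26 0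

/-- Searching and recording cost `n` iterations each. If the update lowers `work` by `δ`, it costs
at most `δ * (n + 1)` more, so `3 * n + 4` iterations per unit of `work` suffice. -/
theorem run_selectProg {τ : Store} {n : ℕ} {V : ℕ → ℕ → ℕ} {h : List Entry}
    (hn : τ.word 0 0 = n) (hV : ∀ p < n, ∀ q < n, V p q = τ.word 2 (p * n + q))
    (hVn : ∀ p < n, ∀ q < n, p ≠ q → V p q ≤ n) (hW : 4 * n + 200 ≤ W)
    (H : State n V τ h) (hk : 1 ≤ τ.word 26 0) (hlen : h.length + work n τ ≤ 3 * n) :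
    Run W selectProg τ fun M υ => ∃ e, State n V υ (e :: h) ∧
      (∀ u < n, τ.word 20 u ≠ 0 → υ.word 20 u ≠ 0) ∧
      (3 * n + 4) * work n υ + M + 1 ≤ (3 * n + 4) * work n τ := by
  obtain ⟨HI, HR, HL⟩ := H
  set k := τ.word 26 0 with hkdef
  have hkn : k ≤ n := by have := HI.card; omega
  have hmn : h.length ≤ 3 * n := by omega
  have hred : ∀ u < n, reduced τ n k u = V (τ.word 22 (k * n + u)) u -
      τ.word 21 (τ.word 22 (k * n + u)) := fun u hu => by
    rw [hV _ (HI.best k hk le_rfl u hu).1 u hu, reduced]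
  refine Run.seq ((run_exitProg (n := n) (k := k) hn rfl (by omega)
    ⟨0, HI.root_lt, by rw [HI.root]; omega⟩ fun u hu huk => ?_).frame ?_)
  · obtain ⟨b1, b2, _⟩ := HI.best k hk le_rfl u hu
    rw [hred u hu]
    refine (Nat.sub_le _ _).trans (hVn _ b1 u hu ?_)
    intro heq
    rw [heq] at b2
    exact huk b2
  rintro M₁ τ₁ hs₁ ⟨hM₁, hq, hqk, h28, hmin⟩
  set q := τ₁.word 29 0 with hqdef
  have c0 := hs₁.1 0 (by decide)
  have c2 := hs₁.1 2 (by decide)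
  have c20 := hs₁.1 20 (by decide)
  have c21 := hs₁.1 21 (by decide)
  have c22 := hs₁.1 22 (by decide)
  have c23 := hs₁.1 23 (by decide)
  have c24 := hs₁.1 24 (by decide)
  have c25 := hs₁.1 25 (by decide)
  have c26 := hs₁.1 26 (by decide)
  have c27 := hs₁.1 27 (by decide)
  have c33 := hs₁.1 33 (by decide)
  obtain ⟨b1, b2, b3⟩ := HI.best k hk le_rfl q hq
  rw [hred q hq] at h28
  refine Run.seq ((run_recordProg (n := n) (k := k) (m := h.length) (by rw [c0, hn]) (by rw [c26])
    (by rw [c27, HL]) (by omega) (by omega) hq (by rw [c22]; exact b1) fun v hv hvk => ?_).frame ?_)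
  · rw [c20] at hvk
    rw [c21, h28]
    have s1 := HI.slack v hv q hq (by rw [hvk]; exact fun h => hqk h.symm) (by omega)
    have s2 := b3 v hv hvk hqk
    have s3 := hVn v hv q hq (by rintro rfl; exact hqk hvk)
    omega
  rintro M₂ τ₂ hs₂ ⟨hM₂, d27, d21, d23, d23', d24, d25, d245⟩
  rw [c20, c21, h28] at d21
  rw [c20] at d23
  rw [c22] at d24
  rw [c23] at d23'
  simp only [c24, c25] at d245
  have e0 := hs₂.1 0 (by decide)
  have e2 := hs₂.1 2 (by decide)
  have e20 := hs₂.1 20 (by decide)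
  have e22 := hs₂.1 22 (by decide)
  have e26 := hs₂.1 26 (by decide)
  have e29 := hs₂.1 29 (by decide)
  have e33 := hs₂.1 33 (by decide)
  rw [c0] at e0
  rw [c2] at e2
  rw [c20] at e20
  rw [c22] at e22
  rw [c26] at e26
  rw [c33] at e33
  obtain ⟨HI', hout⟩ := HI.select hk hq hqk (fun u hu huk => by
    have := hmin u hu huk
    rw [h28, hred u hu] at this
    exact this) d21
  set e : Entry := ⟨comp n (τ.word 20) k, τ.word 22 (k * n + q), q,
    V (τ.word 22 (k * n + q)) q - τ.word 21 (τ.word 22 (k * n + q))⟩ with he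
  have HR' : Records n (τ₂.word 23) (τ₂.word 24) (τ₂.word 25) (e :: h) :=
    ⟨HR.congr d23' (fun i hi => (d245 i hi).1) (fun i hi => (d245 i hi).2), d24, d25,
      fun v hv => by rw [d23 v hv, he, mem_comp]; exact ⟨fun h => ⟨hv, h⟩, fun h => h.2⟩⟩
  have hcq : τ.word 20 q < W := by
    have := HI.range q hq
    omega
  refine Run.seq (Run.setW (by simpa [WExp.eval, e20, e29] using hcq) ?_)
  have hc31 : (WExp.load 20 (.var 29)).eval τ₂ = τ.word 20 q := by simp [WExp.eval, e20, e29, q]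
  rw [hc31]
  simp only [WExp.eval]
  set τ₃ := τ₂.setWord 31 0 (τ.word 20 q) with hτ₃
  have f0 : τ₃.word 0 0 = n := by rw [hτ₃, Store.setWord_word_of_ne _ _ _ (by decide), e0, hn]
  have f2 : τ₃.word 2 = τ.word 2 := by rw [hτ₃, Store.setWord_word_of_ne _ _ _ (by decide), e2]
  have f20 : τ₃.word 20 = τ.word 20 := by
    rw [hτ₃, Store.setWord_word_of_ne _ _ _ (by decide), e20]
  have f21 : τ₃.word 21 = τ₂.word 21 := Store.setWord_word_of_ne _ _ _ (by decide)
  have f22 : τ₃.word 22 = τ.word 22 := by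
    rw [hτ₃, Store.setWord_word_of_ne _ _ _ (by decide), e22]
  have f23 : τ₃.word 23 = τ₂.word 23 := Store.setWord_word_of_ne _ _ _ (by decide)
  have f24 : τ₃.word 24 = τ₂.word 24 := Store.setWord_word_of_ne _ _ _ (by decide)
  have f25 : τ₃.word 25 = τ₂.word 25 := Store.setWord_word_of_ne _ _ _ (by decide)
  have f26 : τ₃.word 26 0 = k := by rw [hτ₃, Store.setWord_word_of_ne _ _ _ (by decide), e26]
  have f27 : τ₃.word 27 0 = h.length + 1 := by
    rw [hτ₃, Store.setWord_word_of_ne _ _ _ (by decide), d27]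
  have f29 : τ₃.word 29 0 = q := by rw [hτ₃, Store.setWord_word_of_ne _ _ _ (by decide), e29]
  have f31 : τ₃.word 31 0 = τ.word 20 q := by simp [hτ₃, Store.setWord_word]
  have f33 : τ₃.word 33 = τ.word 33 := by
    rw [hτ₃, Store.setWord_word_of_ne _ _ _ (by decide), e33]
  have hrec : ∀ υ : Store, υ.word 23 = τ₃.word 23 → υ.word 24 = τ₃.word 24 →
      υ.word 25 = τ₃.word 25 → Records n (υ.word 23) (υ.word 24) (υ.word 25) (e :: h) := by
    intro υ h1 h2 h3
    rw [h1, h2, h3, f23, f24, f25]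
    exact HR'
  -- Here `δ` is `1` for a push (the weight two of an unvisited vertex pays for the higher stack),
  -- `k` for an absorption, and the number of levels removed for a merge.
  have hwork : ∀ υ : Store, υ.word 33 = τ₃.word 33 → ∀ δ M, 1 ≤ δ → M ≤ δ * (n + 1) →
      2 * (comp n (υ.word 20) 0).card + υ.word 26 0 + δ =
        2 * (comp n (τ.word 20) 0).card + k →
      (3 * n + 4) * work n υ + (M₁ + (M₂ + (0 + M))) + 1 ≤ (3 * n + 4) * work n τ := by
    intro υ h33 δ M hδ hM hU
    have h1 : work n τ = work n υ + δ := by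
      rw [work, work, h33, f33]; omega
    rw [h1, mul_add]
    have h2 : (2 * n + 3) * 1 ≤ (2 * n + 3) * δ := Nat.mul_le_mul_left _ hδ
    have h3 : (3 * n + 4) * δ = (2 * n + 3) * δ + δ * (n + 1) := by ring
    omega
  refine Run.ite ?_ ?_
  · intro hc
    have hq0 : τ.word 20 q = 0 := by
      simp only [BExp.Holds, WExp.eval, f31] at hc
      omega
    refine (run_pushProg f0 f26 f29 (by omega) (by omega) hq).frame ?_
    rintro M υ hυ ⟨hM, g26, g20, g22, g22'⟩
    rw [f20] at g20
    rw [f22] at g22'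
    obtain ⟨P1, P2⟩ := HI'.push (best' := fun j u => υ.word 22 (j * n + u)) hq hq0 (fun _ => hout)
      (fun j hj u hu => g22' j hj u hu) g22
    have g21 := hυ.1 21 (by decide)
    have g27 := hυ.1 27 (by decide)
    refine ⟨e, ⟨?_, hrec υ (hυ.1 23 (by decide)) (hυ.1 24 (by decide)) (hυ.1 25 (by decide)),
      by rw [g27, f27]; rfl⟩, ?_, hwork υ (hυ.1 33 (by decide)) 1 M le_rfl (by omega) ?_⟩
    · rw [g26, g20, g21, f21]; exact P1
    · intro u hu hu0
      rw [g20, Function.update_apply]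
      split_ifs
      · omega
      · exact hu0
    · rw [g20, g26]; omega
  · intro hc
    have hq0 : τ.word 20 q ≠ 0 := by
      simp only [BExp.Holds, WExp.eval, f31] at hc
      omega
    refine Run.ite ?_ ?_
    · intro hc'
      have hqn : τ.word 20 q = n + 1 := by
        simp only [BExp.Holds, WExp.eval, f31, f0] at hc'
        omega
      refine (run_absorbProg f0 (by omega)).frame ?_
      rintro M υ hυ ⟨hM, g26, g20⟩
      rw [f20] at g20
      obtain ⟨P1, P2⟩ := HI'.absorb hk hq hqn hout g20
      have g21 := hυ.1 21 (by decide)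
      have g22 := hυ.1 22 (by decide)
      have g27 := hυ.1 27 (by decide)
      refine ⟨e, ⟨?_, hrec υ (hυ.1 23 (by decide)) (hυ.1 24 (by decide)) (hυ.1 25 (by decide)),
        by rw [g27, f27]; rfl⟩, ?_, hwork υ (hυ.1 33 (by decide)) k M hk ?_ ?_⟩
      · rw [g26, g21, g22, f21, f22]; exact P1
      · intro u hu hu0
        rw [g20 u hu, if_neg hu0]
        omega
      · have : 1 * (n + 1) ≤ k * (n + 1) := Nat.mul_le_mul_right _ hk
        omega
      · rw [P2, g26]; omega
    · intro hc'
      have hqn : τ.word 20 q ≠ n + 1 := by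
        simp only [BExp.Holds, WExp.eval, f31, f0] at hc'
        omega
      have hqk' : τ.word 20 q < k := by
        have := HI.range q hq
        omega
      refine (run_mergeProg f0 f26 f31 hqk' (by omega) (by omega) fun j hj1 hj2 u hu => ?_).frame ?_
      · obtain ⟨x1, x2, x3⟩ := HI'.best j (by omega) hj2 u hu
        refine ⟨by rw [f22]; exact x1, by rw [f20, f22]; exact x2, fun p hp hpj huj => ?_⟩
        rw [f20] at hpj huj
        have := x3 p hp hpj huj
        rw [hV _ x1 u hu, hV p hp u hu] at this
        rw [reduced, f2, f21, f22]
        exact this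
      rintro M υ hυ ⟨hM, g26, g20, g22, g22'⟩
      rw [f20] at g20
      rw [f22] at g22
      have g2 := hυ.1 2 (by decide)
      have g21 := hυ.1 21 (by decide)
      have g27 := hυ.1 27 (by decide)
      obtain ⟨P1, P2⟩ := HI'.merge (best' := fun j u => υ.word 22 (j * n + u)) hq (by omega) hqk'
        rfl hout g20 g22 (fun u hu => by
          obtain ⟨y1, y2, y3, y4⟩ := g22' u hu
          rw [f20] at y2 y3
          refine ⟨y1, y2, y3, fun p hp hp1 hp2 hu' => ?_⟩
          have := y4 p hp (by rwa [f20]) (by rwa [f20]) (by rwa [f20])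
          rw [reduced, g2, g21, f2, f21] at this
          rw [hV _ y1 u hu, hV p hp u hu]
          exact this)
      refine ⟨e, ⟨?_, hrec υ (hυ.1 23 (by decide)) (hυ.1 24 (by decide)) (hυ.1 25 (by decide)),
        by rw [g27, f27]; rfl⟩, ?_,
        hwork υ (hυ.1 33 (by decide)) (k - τ.word 20 q) M (by omega) hM ?_⟩
      · rw [g26, g21, f21]; exact P1
      · intro u hu hu0
        rw [g20 u hu]
        split_ifs
        · exact hq0
        · exact hu0
      · rw [P2, g26]; omega

/-- Every selection lowers `work`, initially at most `3 * n`, so the history has at most `3 * n`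
records. The scan pointer advances only over visited vertices and with an empty stack; hence at the
end the stack is empty and every vertex is visited. -/
theorem run_growProg {σ : Store} {n : ℕ} {V : ℕ → ℕ → ℕ} (hn : σ.word 0 0 = n) (hpos : 0 < n)
    (hV : ∀ p < n, ∀ q < n, V p q = σ.word 2 (p * n + q))
    (hVn : ∀ p < n, ∀ q < n, p ≠ q → V p q ≤ n) (hW : 4 * n + 200 ≤ W)
    (h20 : ∀ v, σ.word 20 v = 0) (h21 : ∀ v, σ.word 21 v = 0) (h26 : σ.word 26 0 = 0)
    (h27 : σ.word 27 0 = 0) (h33 : σ.word 33 0 = 0) :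
    Run W growProg σ fun M τ => M ≤ (3 * n + 4) * (3 * n) ∧
      ∃ h, State n V τ h ∧ h.length ≤ 3 * n ∧ τ.word 26 0 = 0 ∧ ∀ v < n, τ.word 20 v ≠ 0 := by
  refine Run.seq (Run.setW (by simp [WExp.eval, hn]; omega) ?_)
  have hinit : ((σ.setWord 20 0 (n + 1)).word 20) = fun v => if v = 0 then n + 1 else 0 := by
    funext v; simp [Store.setWord_word, h20]
  have heval : (WExp.add (.var 0) (.const 1)).eval σ = n + 1 := by simp [WExp.eval, hn]
  rw [heval]
  simp only [WExp.eval]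
  have hw0 : work n (σ.setWord 20 0 (n + 1)) ≤ 3 * n := by
    have : (comp n ((σ.setWord 20 0 (n + 1)).word 20) 0).card ≤ n :=
      (Finset.card_filter_le _ _).trans (by simp)
    rw [work, Store.setWord_word_of_ne _ (a := 20) (b := 33) _ _ (by decide),
      Store.setWord_word_of_ne _ (a := 20) (b := 26) _ _ (by decide), h33, h26]
    omega
  refine Run.loop (fun τ => ∃ h, State n V τ h ∧ h.length + work n τ ≤ 3 * n ∧
      τ.word 33 0 ≤ n ∧ (τ.word 33 0 < n ∨ τ.word 26 0 = 0) ∧ ∀ u < τ.word 33 0, τ.word 20 u ≠ 0)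
    (fun τ => (3 * n + 4) * work n τ) ?_ ?_ ?_
  · refine ⟨[], ⟨?_, trivial, ?_⟩, ?_⟩
    · rw [hinit, Store.setWord_word_of_ne _ (a := 20) (b := 26) _ _ (by decide),
        Store.setWord_word_of_ne _ (a := 20) (b := 21) _ _ (by decide), h26, funext h21]
      exact Inv.init hpos
    · rw [Store.setWord_word_of_ne _ (a := 20) (b := 27) _ _ (by decide), h27]; rfl
    · rw [Store.setWord_word_of_ne _ (a := 20) (b := 33) _ _ (by decide), h33]
      refine ⟨by simpa using hw0, Nat.zero_le _, Or.inl hpos, fun u hu => by omega⟩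
  · rintro τ hs ⟨h, H, hlen, h1, h2, h3⟩ hc
    have g0 : τ.word 0 0 = n := by
      rw [hs.1 0 (by decide), Store.setWord_word_of_ne _ _ _ (by decide), hn]
    have g2 : τ.word 2 = σ.word 2 := by
      rw [hs.1 2 (by decide), Store.setWord_word_of_ne _ _ _ (by decide)]
    have hv : τ.word 33 0 < n := by simpa [BExp.Holds, WExp.eval, g0] using hc
    refine Run.ite ?_ ?_
    · intro hc1
      have hk : τ.word 26 0 = 0 := by simpa [BExp.Holds, WExp.eval] using hc1
      refine Run.ite ?_ ?_
      · intro hc2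
        have hv0 : τ.word 20 (τ.word 33 0) = 0 := by simpa [BExp.Holds, WExp.eval] using hc2
        refine Run.seq (Run.setW (by simp [WExp.eval]; omega) ?_)
        refine (run_pushProg (n := n) (k := 0) (u := τ.word 33 0)
          (by simpa [Store.setWord_word] using g0)
          (by simpa [Store.setWord_word] using hk) (by simp [Store.setWord_word, WExp.eval])
          (by omega) (by omega) hv).frame ?_
        rintro M υ hυ ⟨hM, k26, k20, k22, k22'⟩
        have k21 := hυ.1 21 (by decide)
        have k23 := hυ.1 23 (by decide)
        have k24 := hυ.1 24 (by decide)
        have k25 := hυ.1 25 (by decide)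
        have k27 := hυ.1 27 (by decide)
        have k33 := hυ.1 33 (by decide)
        simp [Store.setWord_word_of_ne] at k20 k21 k22' k23 k24 k25 k27 k33
        have HI := H.inv
        rw [hk] at HI
        obtain ⟨P1, P2⟩ := HI.push (best' := fun j u => υ.word 22 (j * n + u)) hv hv0
          (fun h => by omega) (fun j hj u hu => k22' j (by simpa using hj) u hu)
          (fun u hu => k22 u hu)
        have hwork : work n τ = work n υ + 1 := by
          rw [work, work, k33, k20, k26, hk]
          simp only [zero_add] at P2 ⊢
          omega
        refine ⟨⟨h, ⟨?_, ?_, ?_⟩, by omega, ?_, ?_, ?_⟩, ?_⟩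
        · rw [k26, k20, k21]; exact P1
        · rw [k23, k24, k25]; exact H.records
        · rw [k27, H.length]
        · rw [k33]; exact h1
        · rw [k33]; exact Or.inl hv
        · rw [k33, k20]
          intro u hu
          rw [Function.update_of_ne (by omega)]
          exact h3 u hu
        · rw [hwork, mul_add]; omega
      · intro hc2
        have hv0 : τ.word 20 (τ.word 33 0) ≠ 0 := by simpa [BExp.Holds, WExp.eval] using hc2
        refine Run.setW (by simp [WExp.eval]; omega) ?_
        simp only [WExp.eval]
        have hw : work n τ = work n (τ.setWord 33 0 (τ.word 33 0 + 1)) + 1 := by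
          simp only [work, Store.setWord_word, Nat.reduceEqDiff, if_false, if_true]
          rw [Store.setWord_word_of_ne _ (a := 33) (b := 20) _ _ (by decide)]
          omega
        refine ⟨⟨h, ⟨?_, ?_, ?_⟩, by omega, ?_, ?_, ?_⟩, ?_⟩
        · simpa [Store.setWord_word_of_ne] using H.inv
        · simpa [Store.setWord_word_of_ne] using H.records
        · simpa [Store.setWord_word_of_ne] using H.length
        · simp [Store.setWord_word]; omega
        · right; simpa [Store.setWord_word_of_ne] using hk
        · intro u hu
          have hu' : u < τ.word 33 0 + 1 := by simpa [Store.setWord_word] using hu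
          rw [Store.setWord_word_of_ne _ _ _ (by decide)]
          rcases Nat.lt_succ_iff_lt_or_eq.1 hu' with h | rfl
          · exact h3 u h
          · exact hv0
        · rw [hw, mul_add]; omega
    · intro hc1
      have hk : 1 ≤ τ.word 26 0 := by
        have : τ.word 26 0 ≠ 0 := by simpa [BExp.Holds, WExp.eval] using hc1
        omega
      refine (run_selectProg g0 (by rw [g2]; exact hV) hVn hW H hk hlen).frame ?_
      rintro M υ hυ ⟨e, He, hz, hcost⟩
      have k33 := hυ.1 33 (by decide)
      -- The iteration bound itself forces the decrease: a positive cost was paid out of the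
      -- potential.
      have hdec : work n υ + 1 ≤ work n τ := by
        by_contra hcon
        have : (3 * n + 4) * work n τ ≤ (3 * n + 4) * work n υ := Nat.mul_le_mul_left _ (by omega)
        omega
      refine ⟨⟨e :: h, He, by rw [List.length_cons]; omega, ?_, ?_, ?_⟩, hcost⟩
      · rw [k33]; exact h1
      · rw [k33]; exact Or.inl hv
      · rw [k33]; exact fun u hu => hz u (by omega) (h3 u hu)
  · rintro M τ hM hs ⟨h, H, hlen, h1, h2, h3⟩ hc
    have g0 : τ.word 0 0 = n := by
      rw [hs.1 0 (by decide), Store.setWord_word_of_ne _ _ _ (by decide), hn]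
    have hv : ¬ τ.word 33 0 < n := by simpa [BExp.Holds, WExp.eval, g0] using hc
    have := Nat.mul_le_mul_left (3 * n + 4) hw0
    exact ⟨by omega, h, H, by omega, by omega, fun v hv' => h3 v (by omega)⟩

end RealRAM

/-! ### The whole algorithm

Word array `35` holds the parent function of the sink tree; the scalar word variables are `34`
(position in the history) and `36` (flag). -/

namespace RealRAM

open Arborescence Selection

variable {W : ℕ}

/-- Expand the recorded components into a sink tree. -/
def expandProg : Prog :=
  .setV 34 (.var 27) ;;
  .loop (.wle (.const 1) (.var 34))
    (.setV 34 (.sub (.var 34) (.const 1)) ;;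
      .setV 36 (.const 1) ;;
      .forTo 32 (.var 0) (.ite (.and (.wle (.const 1) (.load 23 (.cell (.var 34) (.var 32))))
        (.wle (.const 1) (.load 35 (.var 32)))) (.setV 36 (.const 0)) .skip) ;;
      .ite (.weq (.var 36) (.const 1))
        (.setW 35 (.load 24 (.var 34)) (.add (.load 25 (.var 34)) (.const 1))) .skip)

/-- Invariant: expanding the remaining records from the current parent array yields the same result
as expanding the full history from nothing. -/
theorem run_expandProg {σ : Store} {n s : ℕ} {V : ℕ → ℕ → ℕ} {h : List Entry}
    (hn : σ.word 0 0 = n) (hW : n + 1 < W) (hg : Good n V s h)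
    (hr : Records n (σ.word 23) (σ.word 24) (σ.word 25) h) (hl : σ.word 27 0 = h.length)
    (hlW : h.length < W) (h35 : ∀ v, σ.word 35 v = 0) :
    Run W expandProg σ fun M τ => M ≤ h.length * (n + 1) ∧
      τ.word 35 = Arborescence.run h fun _ => 0 := by
  refine Run.seq (Run.setW (by simp [WExp.eval, hl, hlW]) ?_)
  refine Run.loop (fun τ => ∃ h', Good n V s h' ∧
      Records n (σ.word 23) (σ.word 24) (σ.word 25) h' ∧ τ.word 34 0 = h'.length ∧
      h'.length < W ∧ Arborescence.run h' (τ.word 35) = Arborescence.run h fun _ => 0)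
    (fun τ => τ.word 34 0 * (n + 1)) ?_ ?_ ?_
  · refine ⟨h, hg, hr, by simp [Store.setWord_word, WExp.eval, hl], hlW, ?_⟩
    rw [Store.setWord_word_of_ne _ _ _ (by decide), funext h35]
  · rintro τ hs ⟨h', hg', hr', h34, hW', hrun⟩ hc
    have g0 := hs.1 0 (by decide)
    have g23 := hs.1 23 (by decide)
    have g24 := hs.1 24 (by decide)
    have g25 := hs.1 25 (by decide)
    simp [Store.setWord_word_of_ne] at g0 g23 g24 g25
    have hpos : 1 ≤ h'.length := by
      rw [← h34]; simpa [BExp.Holds, WExp.eval] using hc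
    rcases h' with _ | ⟨e, h'⟩
    · simp at hpos
    rw [List.length_cons] at h34 hW' hpos
    refine Run.seq (Run.setW (by simp [WExp.eval, h34]; omega) ?_)
    refine Run.seq (Run.setW (by simp [WExp.eval]; omega) (Run.seq ?_))
    refine Run.forTo n 0 (fun m υ => (υ.word 36 0 = 1 ∧ ∀ v < m, v ∈ e.C → τ.word 35 v = 0) ∨
      (υ.word 36 0 = 0 ∧ ∃ v ∈ e.C, τ.word 35 v ≠ 0)) (by decide) ?_ (by omega) ?_ ?_ ?_
    · intro υ hυ
      have u0 := hυ.1 0 (by decide)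
      simp [Store.setWord_word_of_ne] at u0
      simp [WExp.eval, u0, g0, hn]
    · left; simp [Store.setWord_word, WExp.eval]
    · intro j hj υ hυ hj' hI
      have u0 := hυ.1 0 (by decide)
      have u23 := hυ.1 23 (by decide)
      have u35 := hυ.1 35 (by decide)
      have u34 := hυ.1 34 (by decide)
      simp [Store.setWord_word_of_ne] at u0 u23 u35
      have u34' : υ.word 34 0 = h'.length := by
        rw [u34]; simp [Store.setWord_word, WExp.eval, h34]
      have hmem := hr'.2.2.2 j hj
      refine Run.ite ?_ ?_
      · intro hc'
        simp only [BExp.Holds, WExp.eval, u0, u23, u35, u34', hj', g0, g23, hn] at hc'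
        refine Run.setW (by simp [WExp.eval]; omega) ⟨le_rfl, ?_⟩
        right
        exact ⟨by simp [Store.setWord_word, WExp.eval], j, hmem.1 (by omega), by omega⟩
      · intro hc'
        simp only [BExp.Holds, WExp.eval, u0, u23, u35, u34', hj', g0, g23, hn] at hc'
        refine Run.skip ⟨le_rfl, ?_⟩
        simp only [Store.setWord_word, Nat.reduceEqDiff, if_false]
        rcases hI with ⟨h1, h2⟩ | h1
        · left
          refine ⟨h1, fun v hv hvC => ?_⟩
          rcases Nat.lt_succ_iff_lt_or_eq.1 hv with h3 | rfl
          · exact h2 v h3 hvC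
          · have := hmem.2 hvC
            omega
        · exact Or.inr h1
    · intro M υ hM hυ _ hI
      have u24 := hυ.1 24 (by decide)
      have u25 := hυ.1 25 (by decide)
      have u35 := hυ.1 35 (by decide)
      have u34 := hυ.1 34 (by decide)
      simp [Store.setWord_word_of_ne] at u24 u25 u35
      have u34' : υ.word 34 0 = h'.length := by
        rw [u34]; simp [Store.setWord_word, WExp.eval, h34]
      obtain ⟨hg1, hgC, hgp, hgq, _⟩ := hg'
      obtain ⟨hr1, hr2, hr3, _⟩ := hr'
      have hcost : ∀ ω : Store, ω.word 34 0 = h'.length →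
          ω.word 34 0 * (n + 1) + (0 + (0 + (M + 0))) + 1 ≤ τ.word 34 0 * (n + 1) := by
        intro ω hω
        rw [hω, h34, add_mul]
        omega
      rw [Arborescence.run] at hrun
      refine Run.ite ?_ ?_
      · intro hc'
        simp only [BExp.Holds, WExp.eval] at hc'
        refine Run.setW (by simp [WExp.eval, u25, u34', g25, hr3]; omega) ⟨⟨h', hg1, hr1, ?_,
          by omega, ?_⟩, hcost _ ?_⟩
        · simpa [Store.setWord_word] using u34'
        · rw [← hrun]
          congr 1
          rcases hI with ⟨_, h2⟩ | ⟨h1, _⟩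
          · rw [step, if_neg]
            · funext v
              simp [Store.setWord_word, WExp.eval, u24, u25, u34', g24, g25, hr2, hr3, u35,
                Function.update_apply]
            · rintro ⟨v, hv, hv'⟩
              exact hv' (h2 v (Finset.mem_range.1 (hgC hv)) hv)
          · omega
        · simpa [Store.setWord_word] using u34'
      · intro hc'
        simp only [BExp.Holds, WExp.eval] at hc'
        refine Run.skip ⟨⟨h', hg1, hr1, u34', by omega, ?_⟩, hcost _ u34'⟩
        rw [← hrun]
        congr 1
        rcases hI with ⟨h1, _⟩ | ⟨_, h2⟩
        · omega
        · rw [step, if_pos h2, u35]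
  · rintro M τ hM hs ⟨h', hg', hr', h34, hW', hrun⟩ hc
    have h0 : h'.length = 0 := by
      rw [← h34]; simpa [BExp.Holds, WExp.eval] using hc
    rw [List.length_eq_zero_iff] at h0
    subst h0
    refine ⟨?_, hrun⟩
    simpa [WExp.eval, Store.setWord_word, hl] using hM

/-- Write the ranges. -/
def outputProg : Prog :=
  .forTo 32 (.var 0) (.ite (.wle (.const 1) (.load 35 (.var 32)))
    (.setR 2 (.var 32) (.sqrt (sqDistExp (.var 32) (.sub (.load 35 (.var 32)) (.const 1)))))
    .skip) ;;
  .forTo 32 (.var 0) (.ite (.rle (.load 2 (.const 0)) (.sqrt (sqDistExp (.const 0) (.var 32))))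
    (.setR 2 (.const 0) (.sqrt (sqDistExp (.const 0) (.var 32)))) .skip)

/-- The root has no parent, so the first loop leaves its range at zero, a valid start for the
running maximum of the second. -/
theorem run_outputProg {σ : Store} {n : ℕ} (hn : σ.word 0 0 = n) (hpos : 0 < n) (hW : n < W)
    (h35 : σ.word 35 0 = 0) (h2 : σ.real 2 0 = 0) :
    Run W outputProg σ fun M τ => M ≤ 2 * n ∧
      (∀ v < n, v ≠ 0 → σ.word 35 v ≠ 0 → τ.real 2 v = √(sqDist σ v (σ.word 35 v - 1))) ∧
      (∀ q < n, √(sqDist σ 0 q) ≤ τ.real 2 0) ∧ ∃ q < n, τ.real 2 0 = √(sqDist σ 0 q) := by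
  have hself : √(sqDist σ 0 0) = 0 := by simp [sqDist]
  refine Run.seq (Run.forTo n 0 (fun m τ => τ.real 2 0 = 0 ∧
    ∀ v < m, σ.word 35 v ≠ 0 → τ.real 2 v = √(sqDist σ v (σ.word 35 v - 1)))
    (by decide) ?_ hW ?_ ?_ ?_)
  · intro τ hs
    simp [WExp.eval, hs.1 0 (by decide), hn]
  · simp [h2]
  · rintro j hj τ hs hj' ⟨h1, h3⟩
    have g35 := hs.1 35 (by decide)
    have k0 := hs.2 0 (by decide)
    have k1 := hs.2 1 (by decide)
    refine Run.ite ?_ ?_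
    · intro hc
      simp only [BExp.Holds, WExp.eval, g35, hj'] at hc
      refine Run.setR ⟨le_rfl, ?_⟩
      simp only [RExp.eval, WExp.eval, k0, k1, g35, hj', Store.setWord_real, Store.setReal_real,
        if_true]
      refine ⟨?_, fun v hv hv0 => ?_⟩
      · rw [if_neg (by rintro rfl; omega)]; exact h1
      · split_ifs with hvj
        · rw [hvj, sqDist]
        · exact h3 v (by omega) hv0
    · intro hc
      simp only [BExp.Holds, WExp.eval, g35, hj'] at hc
      refine Run.skip ⟨le_rfl, h1, fun v hv hv0 => ?_⟩
      rcases Nat.lt_succ_iff_lt_or_eq.1 hv with h | rfl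
      · exact h3 v h hv0
      · omega
  · rintro M₁ τ₁ hM₁ hs₁ - ⟨h1, h3⟩
    have e0 := hs₁.1 0 (by decide)
    have r0 := hs₁.2 0 (by decide)
    have r1 := hs₁.2 1 (by decide)
    refine Run.forTo n 0 (fun m τ => (∀ v < n, v ≠ 0 → τ.real 2 v = τ₁.real 2 v) ∧
      (∀ q < m, √(sqDist σ 0 q) ≤ τ.real 2 0) ∧ ∃ q < n, τ.real 2 0 = √(sqDist σ 0 q))
      (by decide) ?_ hW ?_ ?_ ?_
    · intro τ hs
      simp [WExp.eval, hs.1 0 (by decide), e0, hn]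
    · refine ⟨fun _ _ _ => rfl, by simp, 0, hpos, ?_⟩
      rw [hself]; exact h1
    · rintro j hj τ hs hj' ⟨h4, h5, h6⟩
      have k0 := hs.2 0 (by decide)
      have k1 := hs.2 1 (by decide)
      have hval : RExp.eval τ (.sqrt (sqDistExp (.const 0) (.var 32))) = √(sqDist σ 0 j) := by
        simp only [RExp.eval, WExp.eval, k0, k1, r0, r1, hj', sqDist]
      refine Run.ite ?_ ?_
      · intro hc
        simp only [BExp.Holds, hval] at hc
        refine Run.setR ⟨le_rfl, ?_⟩
        rw [hval]
        simp only [WExp.eval, Store.setWord_real, Store.setReal_real, if_true]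
        refine ⟨fun v hv hv0 => by rw [if_neg hv0]; exact h4 v hv hv0, fun q hq => ?_, j, hj, rfl⟩
        rcases Nat.lt_succ_iff_lt_or_eq.1 hq with h | rfl
        · exact (h5 q h).trans hc
        · exact le_rfl
      · intro hc
        simp only [BExp.Holds, hval] at hc
        refine Run.skip ⟨le_rfl, h4, fun q hq => ?_, h6⟩
        rcases Nat.lt_succ_iff_lt_or_eq.1 hq with h | rfl
        · exact h5 q h
        · exact (not_le.1 hc).le
    · rintro M₂ τ hM₂ hs - ⟨h4, h5, h6⟩
      exact ⟨by omega, fun v hv hv0 hv1 => by rw [h4 v hv hv0, h3 v hv hv1], h5, h6⟩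

/-- The whole algorithm. -/
def mainProg : Prog :=
  .ite (.wle (.var 0) (.const 0)) .skip (ranksProg ;; growProg ;; expandProg ;; outputProg)

/-- The properties of the memory in which the algorithm halts. -/
def Computes (σ : Store) (n : ℕ) (τ : Store) : Prop :=
  ∃ (V : ℕ → ℕ → ℕ) (f : ℕ → ℕ),
    (∀ p < n, ∀ q < n, q ≠ p → GoodRank (sqDist σ p) n q (V p q)) ∧
    f 0 = 0 ∧ (∀ v < n, v ≠ 0 → f v ≠ 0) ∧ (∀ v, f v ≤ n) ∧ (∀ v < n, Path f v 0) ∧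
    (∀ g : ℕ → ℕ, (∀ v < n, g v < n) → (∀ v < n, ∃ k : ℕ, g^[k] v = 0) →
      cost n V f ≤ ∑ v ∈ (Finset.range n).erase 0, V v (g v)) ∧
    (∀ v < n, v ≠ 0 → τ.real 2 v = √(sqDist σ v (f v - 1))) ∧
    (∀ q < n, √(sqDist σ 0 q) ≤ τ.real 2 0) ∧ ∃ q < n, τ.real 2 0 = √(sqDist σ 0 q)

theorem run_mainProg {σ : Store} {n : ℕ} (hpos : 0 < n) (hW : 4 * n + 200 ≤ W)
    (hw : ∀ a i, σ.word a i = if a = 0 ∧ i = 0 then n else 0) (h2 : σ.real 2 0 = 0) :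
    Run W mainProg σ fun M τ => M + 1 ≤ 3000 * (n + 1) ^ 2 ∧ Computes σ n τ := by
  have hn : σ.word 0 0 = n := by simp [hw]
  refine Run.ite (fun hc => ?_) fun _ => ?_
  · simp only [BExp.Holds, WExp.eval, hn] at hc
    omega
  refine Run.seq ((run_ranksProg hn hW).frame ?_)
  rintro M₁ τ₁ hs₁ ⟨hM₁, hgood⟩
  have hword : ∀ a, a ∉ ranksProg.wordWrites → ∀ i, τ₁.word a i = if a = 0 ∧ i = 0 then n else 0 :=
    fun a ha i => by rw [hs₁.1 a ha, hw]
  have r0 := hs₁.2 0 (by decide)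
  have r1 := hs₁.2 1 (by decide)
  have r2 := hs₁.2 2 (by decide)
  refine Run.seq ((run_growProg (n := n) (V := fun p q => τ₁.word 2 (p * n + q))
    (by simp [hword 0 (by decide)]) hpos (fun _ _ _ _ => rfl)
    (fun p hp q hq hpq => (hgood p hp q hq hpq.symm).2.2) hW
    (by simp [hword 20 (by decide)]) (by simp [hword 21 (by decide)])
    (by simp [hword 26 (by decide)]) (by simp [hword 27 (by decide)])
    (by simp [hword 33 (by decide)])).frame ?_)
  rintro M₂ τ₂ hs₂ ⟨hM₂, h, H, hlen, hk, hvis⟩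
  have c0 := hs₂.1 0 (by decide)
  have c35 := hs₂.1 35 (by decide)
  have q0 := hs₂.2 0 (by decide)
  have q1 := hs₂.2 1 (by decide)
  have q2 := hs₂.2 2 (by decide)
  have HI := H.inv
  rw [hk] at HI
  obtain ⟨f1, f2, f3, f4, f5⟩ := HI.final hvis
  refine Run.seq ((run_expandProg (n := n) (by simp [c0, hword 0 (by decide)]) (by omega) HI.good
    H.records H.length (by omega) (by simp [c35, hword 35 (by decide)])).frame ?_)
  rintro M₃ τ₃ hs₃ ⟨hM₃, h35⟩
  have d0 := hs₃.1 0 (by decide)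
  have p0 := hs₃.2 0 (by decide)
  have p1 := hs₃.2 1 (by decide)
  have p2 := hs₃.2 2 (by decide)
  have hd : sqDist τ₃ = sqDist σ := by
    funext a b
    rw [sqDist, sqDist, p0, p1, q0, q1, r0, r1]
  refine (run_outputProg (n := n) (by simp [d0, c0, hword 0 (by decide)]) hpos (by omega)
    (by rw [h35, f1]) (by rw [p2, q2, r2, h2])).mono ?_
  rintro M₄ τ ⟨hM₄, o1, o2, o3⟩
  rw [hd] at o1 o2 o3
  rw [h35] at o1
  refine ⟨?_, _, _, hgood, f1, f2, f3, f4, f5, fun v hv hv0 => o1 v hv hv0 (f2 v hv hv0), o2, o3⟩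
  have hmul : h.length * (n + 1) ≤ 3 * n * (n + 1) := Nat.mul_le_mul_right _ hlen
  have hsum : n * (2013 * n + 1) + (3 * n + 4) * (3 * n) + 3 * n * (n + 1) + 2 * n + 1 ≤
      3000 * (n + 1) ^ 2 := by
    have h1 : 3000 * (n + 1) ^ 2 = 3000 * (n * n) + 6000 * n + 3000 := by ring
    have h2 : n * (2013 * n + 1) + (3 * n + 4) * (3 * n) + 3 * n * (n + 1) + 2 * n + 1 =
        2025 * (n * n) + 18 * n + 1 := by ring
    omega
  omega

end RealRAM

/-! ### From the final memory to the approximation guarantee -/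

namespace Interference

open RealRAM Selection

variable {n : ℕ}

theorem sqrt_sqDist_input (P : Fin n → Plane) (a b : Fin n) :
    √(sqDist (input P) a b) = dist (P a) (P b) := by
  rw [EuclideanSpace.dist_eq]
  simp [sqDist, input, Real.dist_eq, Fin.sum_univ_two, pow_two]

/-- The extra one is `p` itself, which the edge weight excludes. -/
theorem cnt_sqDist_input (P : Fin n → Plane) (p q : Fin n) :
    cnt (sqDist (input P) p) n (fun x => x ≤ sqDist (input P) p q) = edgeWeight P p q + 1 := by
  classical
  have hle : ∀ z : Fin n, sqDist (input P) p z ≤ sqDist (input P) p q ↔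
      dist (P p) (P z) ≤ dist (P p) (P q) := by
    intro z
    rw [← sqrt_sqDist_input, ← sqrt_sqDist_input, Real.sqrt_le_sqrt_iff]
    exact add_nonneg (mul_self_nonneg _) (mul_self_nonneg _)
  have h1 : cnt (sqDist (input P) p) n (fun x => x ≤ sqDist (input P) p q) =
      (Finset.univ.filter fun z : Fin n => dist (P p) (P z) ≤ dist (P p) (P q)).card := by
    rw [cnt, Finset.card_filter, Finset.card_filter, ← Fin.sum_univ_eq_sum_range
      (fun i => if sqDist (input P) p i ≤ sqDist (input P) p q then 1 else 0)]
    exact Finset.sum_congr rfl fun z _ => by simp only [hle]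
  have h2 : (Finset.univ.filter fun z : Fin n => dist (P p) (P z) ≤ dist (P p) (P q)) =
      insert p (Finset.univ.filter fun z : Fin n => z ≠ p ∧
        dist (P p) (P z) ≤ dist (P p) (P q)) := by
    ext z
    by_cases hz : z = p <;> simp [hz]
  rw [h1, h2, Finset.card_insert_of_notMem (by simp), edgeWeight]

theorem IsSinkTree.parent_ne {s : Fin n} {parent : Fin n → Fin n} (h : IsSinkTree s parent)
    {v : Fin n} (hv : v ≠ s) : parent v ≠ v := by
  intro hp
  obtain ⟨k, hk⟩ := h.2 v
  rw [Function.iterate_fixed hp] at hk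
  exact hv hk

/-- A program that has computed a minimum sink tree for approximate ranks outputs a valid range
assignment of at most twice the minimum total interference. -/
theorem exists_of_computes (hpos : 0 < n) {P : Fin n → Plane} (hP : Function.Injective P)
    {τ : Store} (h : Computes (input P) n τ) :
    ∃ r : Fin n → ℝ≥0, Outputs τ r ∧ Valid P r ∧ totalInterference P r ≤ 2 * opt P := by
  obtain ⟨V, f, hV, f0, f1, f2, f3, f4, o1, o2, o3⟩ := h
  -- The two-sided estimate behind the factor two; its additive one, collected on `n - 1` tree
  -- edges, pays for the broadcast.
  have hV' : ∀ p q : Fin n, q ≠ p → edgeWeight P p q + 1 ≤ V p q ∧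
      V p q ≤ 2 * edgeWeight P p q := by
    intro p q hqp
    obtain ⟨h1, h2, _⟩ := hV p p.2 q q.2 (by simpa [Fin.ext_iff] using hqp)
    rw [cnt_sqDist_input] at h1 h2
    omega
  set s : Fin n := ⟨0, hpos⟩ with hs
  have hlt : ∀ v : Fin n, f v - 1 < n := fun v => by have := f2 v; omega
  -- In `f` zero means undefined and parents are shifted by one. Only the root is undefined, and the
  -- default makes it its own parent.
  set parent : Fin n → Fin n := fun v => if f v = 0 then v else ⟨f v - 1, hlt v⟩ with hparent
  have hpar : ∀ v : Fin n, v ≠ s → f v ≠ 0 ∧ ((parent v : Fin n) : ℕ) = f v - 1 := by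
    intro v hv
    have h1 := f1 v v.2 fun h => hv (Fin.ext h)
    exact ⟨h1, by simp [hparent, h1]⟩
  have htree : IsSinkTree s parent := by
    refine ⟨by simp [hparent, hs, f0], fun p => ?_⟩
    have key : ∀ v, Arborescence.Path f v 0 → ∀ hv : v < n, ∃ k : ℕ, parent^[k] ⟨v, hv⟩ = s := by
      intro v hpath
      induction hpath using Relation.ReflTransGen.head_induction_on with
      | refl => exact fun _ => ⟨0, rfl⟩
      | @head a c hac _ ih =>
        intro ha
        have hc : c < n := by have := f2 a; omega
        obtain ⟨k, hk⟩ := ih hc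
        refine ⟨k + 1, ?_⟩
        rw [Function.iterate_succ_apply]
        have : parent ⟨a, ha⟩ = ⟨c, hc⟩ := by simp [hparent, hac]
        rw [this, hk]
    exact key p (f3 p p.2) p.2
  have hcost : treeWeight P s parent + (n - 1) ≤ Arborescence.cost n V f := by
    have h1 : Arborescence.cost n V f = ∑ v : Fin n, if f v = 0 then 0 else V v (f v - 1) :=
      (Fin.sum_univ_eq_sum_range (fun v => if f v = 0 then 0 else V v (f v - 1)) n).symm
    have h2 : n - 1 = ∑ _v ∈ (Finset.univ : Finset (Fin n)).erase s, 1 := by simp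
    rw [h1, ← Finset.add_sum_erase _ _ (Finset.mem_univ s), treeWeight, h2,
      ← Finset.sum_add_distrib]
    refine (Finset.sum_le_sum fun v hv => ?_).trans (Nat.le_add_left _ _)
    have hvs := (Finset.mem_erase.1 hv).1
    obtain ⟨h3, h4⟩ := hpar v hvs
    rw [if_neg h3, ← h4]
    exact (hV' v _ (htree.parent_ne hvs)).1
  obtain ⟨parent', ht', hopt⟩ := exists_sinkTree_le_opt P s
  -- Minimality for `V` is applied to the tree extracted from an optimal assignment.
  have hcost' : Arborescence.cost n V f ≤ 2 * treeWeight P s parent' := by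
    set g : ℕ → ℕ := fun v => if hv : v < n then parent' ⟨v, hv⟩ else v with hg
    have hgv : ∀ v : Fin n, g v = parent' v := fun v => by simp [hg]
    have hit : ∀ (k : ℕ) (v : Fin n), g^[k] v = (parent'^[k] v : Fin n) := by
      intro k
      induction k with
      | zero => exact fun _ => rfl
      | succ k ih =>
        intro v
        rw [Function.iterate_succ_apply, Function.iterate_succ_apply, hgv, ih]
    refine (f4 g (fun v hv => ?_) fun v hv => ?_).trans ?_
    · have := hgv ⟨v, hv⟩
      simp only at this
      rw [this]; exact (parent' _).2
    · obtain ⟨k, hk⟩ := ht'.2 ⟨v, hv⟩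
      exact ⟨k, by rw [hit k ⟨v, hv⟩, hk]⟩
    · have h1 : ∑ v ∈ (Finset.range n).erase 0, V v (g v) =
          ∑ v ∈ (Finset.univ : Finset (Fin n)).erase s, V v (g v) := by
        symm
        refine Finset.sum_bij (fun v _ => (v : ℕ)) ?_ ?_ ?_ ?_
        · intro v hv
          simpa [hs, Fin.ext_iff] using hv
        · intro a _ b _ hab; exact Fin.ext hab
        · intro b hb
          simp only [Finset.mem_erase, Finset.mem_range] at hb
          exact ⟨⟨b, hb.2⟩, by simp [hs, Fin.ext_iff, hb.1], rfl⟩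
        · intro v _; rfl
      rw [h1, treeWeight, Finset.mul_sum]
      refine Finset.sum_le_sum fun v hv => ?_
      rw [hgv]
      exact (hV' v _ (ht'.parent_ne (Finset.mem_erase.1 hv).1)).2
  refine ⟨fun p => max (rootCover P s p) (treeRange P parent p), fun p => ?_,
    valid_max_rootCover_treeRange P htree, ?_⟩
  · by_cases hps : p = s
    · subst hps
      have h1 : treeRange P parent s = 0 := by simp [treeRange, htree.1]
      beta_reduce
      rw [h1, max_eq_left zero_le, rootCover, if_pos rfl]
      obtain ⟨q, hq, hq'⟩ := o3
      refine le_antisymm ?_ ?_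
      · have h2 : nndist (P s) (P ⟨q, hq⟩) ≤ Finset.univ.sup fun q => nndist (P s) (P q) :=
          Finset.le_sup (f := fun q => nndist (P s) (P q)) (Finset.mem_univ _)
        have h3 := sqrt_sqDist_input P s ⟨q, hq⟩
        simp only [hs] at h3 h2 ⊢
        rw [hq', h3]
        exact_mod_cast h2
      · have h2 : 0 ≤ τ.real 2 0 := (Real.sqrt_nonneg _).trans (o2 0 hpos)
        have h3 : (Finset.univ.sup fun q => nndist (P s) (P q)) ≤ (⟨τ.real 2 0, h2⟩ : ℝ≥0) := by
          refine Finset.sup_le fun q _ => ?_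
          have h4 := o2 q q.2
          rw [← Fin.val_mk hpos, sqrt_sqDist_input P ⟨0, hpos⟩ q] at h4
          exact h4
        exact_mod_cast h3
    · have h1 : rootCover P s p = 0 := by simp [rootCover, hps]
      have h0 : (p : ℕ) ≠ 0 := fun h => hps (Fin.ext h)
      beta_reduce
      rw [h1, max_eq_right zero_le, treeRange, coe_nndist, ← sqrt_sqDist_input,
        (hpar p hps).2]
      exact o1 p p.2 h0
  · have := totalInterference_max_rootCover_treeRange_le hP htree
    omega

/-- Broadcast and tree are each bounded by `opt` separately. -/
theorem totalInterference_max_le_two_mul_opt {P : Fin n → Plane} (hP : Function.Injective P)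
    {s : Fin n} {parent : Fin n → Fin n} (h : IsMinSinkTree P s parent) :
    totalInterference P (fun p => max (rootCover P s p) (treeRange P parent p)) ≤ 2 * opt P := by
  obtain ⟨parent', h1, h2⟩ := exists_sinkTree_le_opt P s
  have h3 := totalInterference_max_rootCover_treeRange_le hP h.1
  have h4 := h.2 _ h1
  have h5 := pred_le_opt P s
  omega

end Interference

theorem mainTheorem3 :
    (∃ (c : RealRAM.Prog) (k : ℕ) (T : ℕ → ℕ),
      ((fun n : ℕ => (T n : ℝ)) =O[Filter.atTop] fun n : ℕ => (n : ℝ) ^ 2) ∧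
      ∀ (n : ℕ) (P : Fin n → Interference.Plane), Function.Injective P →
        ∃ (t : ℕ) (τ : RealRAM.Store) (r : Fin n → ℝ≥0),
          RealRAM.Exec ((n + 2) ^ k) c (RealRAM.input P) t τ ∧ t ≤ T n ∧
          RealRAM.Outputs τ r ∧
          Interference.Valid P r ∧
          Interference.totalInterference P r ≤ 2 * Interference.opt P) ∧
    (∀ (n : ℕ) (P : Fin n → Interference.Plane), Function.Injective P →
      ∀ (s : Fin n) (parent : Fin n → Fin n), Interference.IsMinSinkTree P s parent →
        Interference.IsOptimalBroadcast P s (Interference.rootCover P s) ∧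
        Interference.IsOptimalSink P s (Interference.treeRange P parent) ∧
        Interference.Valid P
          (fun p => max (Interference.rootCover P s p) (Interference.treeRange P parent p)) ∧
        Interference.totalInterference P
          (fun p => max (Interference.rootCover P s p) (Interference.treeRange P parent p))
            ≤ 2 * Interference.opt P) := by
  refine ⟨⟨RealRAM.mainProg, 20, fun n => RealRAM.mainProg.overhead * (3000 * (n + 1) ^ 2), ?_, ?_⟩,
    fun n P hP s parent h => ⟨Interference.isOptimalBroadcast_rootCover hP s,
      Interference.isOptimalSink_treeRange hP h,
      Interference.valid_max_rootCover_treeRange P h.1,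
      Interference.totalInterference_max_le_two_mul_opt hP h⟩⟩
  -- For `n ≥ 1`, `(n + 1) ^ 2 ≤ 4 * n ^ 2`, which turns `3000` into `12000`.
  · refine Asymptotics.IsBigO.of_bound (RealRAM.mainProg.overhead * 12000) ?_
    filter_upwards [Filter.eventually_ge_atTop 1] with n hn
    have h1 : (1 : ℝ) ≤ n := by exact_mod_cast hn
    rw [Real.norm_of_nonneg (by positivity), Real.norm_of_nonneg (by positivity)]
    push_cast
    rw [mul_assoc]
    refine mul_le_mul_of_nonneg_left ?_ (Nat.cast_nonneg _)
    nlinarith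
  · intro n P hP
    rcases Nat.eq_zero_or_pos n with rfl | hpos
    · refine ⟨_, _, fun _ => 0, RealRAM.Exec.iteTrue ?_ (RealRAM.Exec.skip _), ?_,
        fun p => p.elim0, fun p => p.elim0, ?_⟩
      · simp [RealRAM.BExp.Holds, RealRAM.WExp.eval, RealRAM.input]
      · simp [RealRAM.mainProg, RealRAM.Prog.overhead, RealRAM.BExp.cost, RealRAM.WExp.cost]
        omega
      · simp [Interference.totalInterference]
    -- The generous exponent only serves to cover the constant `200` for small `n`.
    · have hW : 4 * n + 200 ≤ (n + 2) ^ 20 := by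
        have h1 : 2 ^ 19 ≤ (n + 2) ^ 19 := Nat.pow_le_pow_left (by omega) _
        rw [pow_succ]
        nlinarith
      obtain ⟨t, τ, N, h1, h2, h3, h4⟩ := RealRAM.run_mainProg (σ := RealRAM.input P) hpos hW
        (fun _ _ => rfl) (by simp [RealRAM.input])
      obtain ⟨r, hr1, hr2, hr3⟩ := Interference.exists_of_computes hpos hP h4
      exact ⟨t, τ, r, h1, h2.trans (Nat.mul_le_mul_left _ h3), hr1, hr2, hr3⟩
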